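/- An instance of the word-model counting problem with unary bound consists of a finite set $\mathit{AP}$ of atomic propositions (listed explicitly), an LTL formula $\varphi$ over $\mathit{AP}$ (built from atomic propositions and the constant true with $\neg,\wedge,\vee$ and the temporal operators Next, Until, Release), and a bound $k\in\mathbb N$ written in unary. A $k$-word-model of $\varphi$ is a pair $(u,v)$ of finite words over the alphabet $2^{\mathit{AP}}$ with $v\neq\varepsilon$, $|uv|=k$ and $uv^\omega\models\varphi$. Let $f$ be the function that maps the word encoding an instance $(\mathit{AP},\varphi,k)$ to the number of $k$-word-models of $\varphi$ over $\mathit{AP}$, and every word that encodes no instance to $0$. A function $g\colon\Sigma^*\to\mathbb N$ (with $\Sigma$ a finite alphabet) is in $\#\mathrm P$ if there is a nondeterministic Turing machine $\mathcal M$ and a polynomial $p$ such that every run of $\mathcal M$ on every input of length $n$ has at most $p(n)$ steps and $g(w)$ is the number of accepting runs of $\mathcal M$ on $w$, for every $w\in\Sigma^*$. **Theorem.** The function $f$ is $\#\mathrm P$-complete under parsimonious reductions: $f\in\#\mathrm P$, and for every function $g\colon\Sigma^*\to\mathbb N$ in $\#\mathrm P$ there is a polynomial-time computable function $r$ such that $g(x)=f(r(x))$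 for all $x\in\Sigma^*$. -/

import Mathlib

namespace LTLCount

/-! ## Nondeterministic Turing machines and the class #P -/

/-- Head movements. -/
inductive Move where
  | left
  | stay
  | right

/-- The displacement of the head caused by a movement. -/
def Move.offset : Move → ℤ
  | .left => -1
  | .stay => 0
  | .right => 1

/-- A nondeterministic Turing machine with input alphabet `A`, with finitely many tapes (one of
which is the input tape), each of them infinite in both directions. -/
structure NTM (A : Type) where
  /-- states -/
  Q : Type
  [finiteQ : Finite Q]
  /-- tape alphabet -/
  Γ : Type
  [finiteΓ : Finite Γ]
  /-- indices of the tapes -/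
  K : Type
  [finiteK : Finite K]
  [decEqK : DecidableEq K]
  /-- the tape that holds the input -/
  inputTape : K
  /-- the blank symbol -/
  blank : Γ
  /-- the input alphabet as a part of the tape alphabet, which does not contain the blank -/
  symb : A → Γ
  symb_injective : Function.Injective symb
  symb_ne_blank : ∀ a, symb a ≠ blank
  /-- initial state -/
  start : Q
  /-- accepting states; they are terminal, see `NTM.Step` -/
  accept : Set Q
  /-- the possible transitions (new state, symbols written, head movements), given the current
  state and the symbols that are read -/
  δ : Q → (K → Γ) → Set (Q × (K → Γ) × (K → Move))

attribute [instance] NTM.finiteQ NTM.finiteΓ NTM.finiteK NTM.decEqK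

namespace NTM

/-- Configurations: state, absolute head positions, tape contents. -/
@[ext]
structure Cfg {A : Type} (M : NTM A) where
  state : M.Q
  head : M.K → ℤ
  tape : M.K → ℤ → M.Γ

/-- The initial configuration on input `w`: the input `w` is written in the cells
`0, …, |w| - 1` of the input tape, all other cells are blank, all heads are at cell `0`. -/
def init {A : Type} (M : NTM A) (w : List A) : M.Cfg where
  state := M.start
  head := fun _ => 0
  tape := fun k i =>
    if k = M.inputTape ∧ 0 ≤ i then (w[i.toNat]?).elim M.blank M.symb else M.blank

/-- The symbols under the heads. -/
def Cfg.read {A : Type} {M : NTM A} (c : M.Cfg) : M.K → M.Γ :=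
  fun k => c.tape k (c.head k)

/-- The configuration after performing a transition. -/
def Cfg.apply {A : Type} {M : NTM A} (c : M.Cfg)
    (t : M.Q × (M.K → M.Γ) × (M.K → Move)) : M.Cfg where
  state := t.1
  head := fun k => c.head k + (t.2.2 k).offset
  tape := fun k => Function.update (c.tape k) (c.head k) (t.2.1 k)

/-- The successor relation on configurations. Accepting configurations have no successor. -/
def Step {A : Type} (M : NTM A) (c c' : M.Cfg) : Prop :=
  c.state ∉ M.accept ∧ ∃ t ∈ M.δ c.state c.read, c' = c.apply t

/-- `ρ` is a (possibly unfinished) run on input `w`: a nonempty sequence of configurations that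
starts in the initial configuration and follows the successor relation. -/
def IsRun {A : Type} (M : NTM A) (w : List A) (ρ : List M.Cfg) : Prop :=
  ρ.head? = some (M.init w) ∧ ρ.IsChain M.Step

/-- `ρ` is an accepting run on `w`: a run that ends in an accepting state. -/
def IsAcceptingRun {A : Type} (M : NTM A) (w : List A) (ρ : List M.Cfg) : Prop :=
  M.IsRun w ρ ∧ ∃ c, ρ.getLast? = some c ∧ c.state ∈ M.accept

/-- The number of accepting runs of `M` on `w`. -/
noncomputable def numAcceptingRuns {A : Type} (M : NTM A) (w : List A) : ℕ :=
  {ρ : List M.Cfg | M.IsAcceptingRun w ρ}.ncard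

/-- `M` is polynomial-time bounded: for some polynomial `p`, every run of `M` (accepting or not)
on every input of length `n` makes at most `p n` steps. -/
def IsPolyTime {A : Type} (M : NTM A) : Prop :=
  ∃ p : Polynomial ℕ, ∀ (w : List A) (ρ : List M.Cfg), M.IsRun w ρ →
    ρ.length ≤ p.eval w.length + 1

end NTM

/-- The class #P of functions from words to natural numbers. -/
def InSharpP {A : Type} (f : List A → ℕ) : Prop :=
  ∃ M : NTM A, M.IsPolyTime ∧ ∀ w, f w = M.numAcceptingRuns w

/-- Polynomial-time computable functions between words (by a deterministic Turing machine). -/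
def PolyTimeComputable {A B : Type} (r : List A → List B) : Prop :=
  Nonempty (Turing.TM2ComputableInPolyTime (id : List A → List A) (id : List B → List B) r)

/-- Hardness for #P under parsimonious reductions. -/
def SharpPHard {B : Type} (g : List B → ℕ) : Prop :=
  ∀ (A : Type) [Finite A] (f : List A → ℕ), InSharpP f →
    ∃ r : List A → List B, PolyTimeComputable r ∧ ∀ x, f x = g (r x)

/-- Completeness for #P under parsimonious reductions. -/
def SharpPComplete {B : Type} (g : List B → ℕ) : Prop :=
  SharpPHard g ∧ InSharpP g

/-! ## Linear-time temporal logic -/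

/-- LTL formulas over the atomic propositions `AP`. Further operators are derived as usual, for
instance `F φ = tt U φ` and `G φ = (¬ tt) V φ`. -/
inductive LTL (AP : Type) where
  | tt : LTL AP
  | atom : AP → LTL AP
  | neg : LTL AP → LTL AP
  | and : LTL AP → LTL AP → LTL AP
  | or : LTL AP → LTL AP → LTL AP
  | next : LTL AP → LTL AP
  | untl : LTL AP → LTL AP → LTL AP
  | release : LTL AP → LTL AP → LTL AP

/-- `φ.SatAt σ i`: the suffix of the infinite word `σ` from position `i` on satisfies `φ`. -/
def LTL.SatAt {AP : Type} (σ : ℕ → Set AP) : ℕ → LTL AP → Prop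
  | _, .tt => True
  | i, .atom p => p ∈ σ i
  | i, .neg φ => ¬ SatAt σ i φ
  | i, .and φ ψ => SatAt σ i φ ∧ SatAt σ i ψ
  | i, .or φ ψ => SatAt σ i φ ∨ SatAt σ i ψ
  | i, .next φ => SatAt σ (i + 1) φ
  | i, .untl φ ψ => ∃ j, i ≤ j ∧ SatAt σ j ψ ∧ ∀ l, i ≤ l → l < j → SatAt σ l φ
  | i, .release φ ψ => ∀ j, i ≤ j → SatAt σ j ψ ∨ ∃ l, i ≤ l ∧ l < j ∧ SatAt σ l φ

/-- `σ ⊨ φ`. -/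
def LTL.Sat {AP : Type} (σ : ℕ → Set AP) (φ : LTL AP) : Prop :=
  LTL.SatAt σ 0 φ

/-- The infinite word `u v^ω` for a nonempty word `v`. -/
def omegaWord {α : Type} (u v : List α) (hv : v ≠ []) : ℕ → α := fun n =>
  if h : n < u.length then u[n]
  else v[(n - u.length) % v.length]'(Nat.mod_lt _ (List.length_pos_iff.mpr hv))

/-- `(u, v)` is a `k`-word-model of `φ`: `|uv| = k` and `u v^ω ⊨ φ` (so `v` is nonempty). -/
def LTL.IsWordModel {AP : Type} (φ : LTL AP) (k : ℕ) (m : List (Set AP) × List (Set AP)) : Prop :=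
  m.1.length + m.2.length = k ∧ ∃ hv : m.2 ≠ [], LTL.Sat (omegaWord m.1 m.2 hv) φ

/-- The number of `k`-word-models of `φ`. -/
noncomputable def LTL.numWordModels {AP : Type} (φ : LTL AP) (k : ℕ) : ℕ :=
  {m : List (Set AP) × List (Set AP) | φ.IsWordModel k m}.ncard

/-! ## The counting problem as a function on words -/

/-- An instance: the set of atomic propositions `{0, …, numProps - 1}`, a formula, a bound. -/
structure Instance where
  numProps : ℕ
  formula : LTL (Fin numProps)
  bound : ℕ

/-- The alphabet in which instances are written. -/
inductive Symb where
  | one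
  | sep
  | tt
  | atom
  | neg
  | and
  | or
  | next
  | untl
  | release
deriving DecidableEq

instance : Fintype Symb :=
  ⟨{.one, .sep, .tt, .atom, .neg, .and, .or, .next, .untl, .release}, by
    intro x; cases x <;> simp⟩

/-- A formula in prefix notation; the atomic proposition `i` is written `atom 1^i sep`. -/
def LTL.encode {n : ℕ} : LTL (Fin n) → List Symb
  | .tt => [.tt]
  | .atom i => .atom :: (List.replicate i.val .one ++ [.sep])
  | .neg φ => .neg :: φ.encode
  | .and φ ψ => .and :: (φ.encode ++ ψ.encode)
  | .or φ ψ => .or :: (φ.encode ++ ψ.encode)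
  | .next φ => .next :: φ.encode
  | .untl φ ψ => .untl :: (φ.encode ++ ψ.encode)
  | .release φ ψ => .release :: (φ.encode ++ ψ.encode)

/-- The word `1^n sep φ 1^k` for a formula `φ` over `n` atomic propositions and a bound `k`, which
is thus given in unary. -/
def Instance.encode (x : Instance) : List Symb :=
  List.replicate x.numProps .one ++ (.sep :: (x.formula.encode ++ List.replicate x.bound .one))

theorem replicate_one_sep_inj : ∀ (m n : ℕ) (s t : List Symb),
    List.replicate m .one ++ (.sep :: s) = List.replicate n .one ++ (.sep :: t) →
      m = n ∧ s = t
  | 0, 0, s, t, h => by simpa using h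
  | 0, n + 1, s, t, h => by simp [List.replicate_succ] at h
  | m + 1, 0, s, t, h => by simp [List.replicate_succ] at h
  | m + 1, n + 1, s, t, h => by
    have h' : List.replicate m Symb.one ++ (.sep :: s) = List.replicate n .one ++ (.sep :: t) := by
      simpa [List.replicate_succ] using h
    obtain ⟨h1, h2⟩ := replicate_one_sep_inj m n s t h'
    exact ⟨by omega, h2⟩

theorem LTL.encode_append_inj {n : ℕ} (φ : LTL (Fin n)) : ∀ (ψ : LTL (Fin n)) (s t : List Symb),
    φ.encode ++ s = ψ.encode ++ t → φ = ψ ∧ s = t := by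
  induction φ with
  | tt => intro ψ s t h; cases ψ <;> simp_all [LTL.encode]
  | atom i =>
    intro ψ s t h
    cases ψ <;> simp [LTL.encode] at h
    obtain ⟨h1, h2⟩ := replicate_one_sep_inj _ _ _ _ h
    exact ⟨by rw [Fin.ext h1], h2⟩
  | neg φ ih =>
    intro ψ s t h
    cases ψ <;> simp [LTL.encode] at h
    obtain ⟨h1, h2⟩ := ih _ _ _ h
    exact ⟨by rw [h1], h2⟩
  | next φ ih =>
    intro ψ s t h
    cases ψ <;> simp [LTL.encode] at h
    obtain ⟨h1, h2⟩ := ih _ _ _ h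
    exact ⟨by rw [h1], h2⟩
  | and φ φ' ih ih' | or φ φ' ih ih' | untl φ φ' ih ih' | release φ φ' ih ih' =>
    intro ψ s t h
    cases ψ <;> simp [LTL.encode] at h
    obtain ⟨h1, h2⟩ := ih _ _ _ h
    obtain ⟨h3, h4⟩ := ih' _ _ _ h2
    exact ⟨by rw [h1, h3], h4⟩

/-- Different instances are written as different words. -/
theorem Instance.encode_injective : Function.Injective Instance.encode := by
  rintro ⟨m, φ, k⟩ ⟨n, ψ, l⟩ h
  obtain ⟨h1, h2⟩ := replicate_one_sep_inj _ _ _ _ h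
  dsimp only at h1 h2
  subst h1
  obtain ⟨h3, h4⟩ := LTL.encode_append_inj _ _ _ _ h2
  have h5 : k = l := by simpa using congrArg List.length h4
  rw [h3, h5]

/-- Counting word-models for unary bounds: the word that encodes `(φ, k)` is mapped to the number
of `k`-word-models of `φ`, and a word that encodes no instance is mapped to `0`. -/
noncomputable def countWordModelsUnary : List Symb → ℕ :=
  Function.extend Instance.encode (fun x => x.formula.numWordModels x.bound) (fun _ => 0)

end LTLCount

namespace LTLCount

/-! ## Nondeterministic stack machines and their simulation by Turing machines -/

/-- The operations on a stack. -/
inductive Op (Γ : Type) where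
  | keep
  | pop
  | push (a : Γ)

/-- The effect of an operation on a stack. -/
def Op.act {Γ : Type} : Op Γ → List Γ → List Γ
  | .keep, l => l
  | .pop, l => l.tail
  | .push a, l => a :: l

/-- The symbol that an operation pushes. -/
def Op.pushed {Γ : Type} : Op Γ → Option Γ
  | .push a => some a
  | _ => none

/-- The head movement that realizes an operation. -/
def Op.move {Γ : Type} : Op Γ → Move
  | .keep => .stay
  | .pop => .right
  | .push _ => .left

/-- The transitions of a nondeterministic stack machine: the state and the topmost symbols determine
a list of possible new states and operations. -/
abbrev StackMachine (Q K Γ : Type) := Q → (K → Option Γ) → List (Q × (K → Op Γ))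

/-- The topmost symbols of the stacks. -/
def tops {K Γ : Type} (S : K → List Γ) : K → Option Γ := fun k => (S k).head?

/-- Apply an operation to every stack. -/
def actAll {K Γ : Type} (o : K → Op Γ) (S : K → List Γ) : K → List Γ := fun k => (o k).act (S k)

/-- `Counts δ acc q S N T`: from state `q` and stacks `S` there are `N` accepting runs, and every run
makes at most `T` steps. -/
inductive Counts {Q K Γ : Type} (δ : StackMachine Q K Γ) (acc : Q) :
    Q → (K → List Γ) → ℕ → ℕ → Prop
  | accept (S T) : Counts δ acc acc S 1 T
  | dead (q S T) : q ≠ acc → δ q (tops S) = [] → Counts δ acc q S 0 T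
  | one (q S q' o N T) : q ≠ acc → δ q (tops S) = [(q', o)] → Counts δ acc q' (actAll o S) N T →
      Counts δ acc q S N (T + 1)
  | two (q S q₁ o₁ q₂ o₂ N₁ N₂ T) : q ≠ acc → δ q (tops S) = [(q₁, o₁), (q₂, o₂)] →
      (q₁ ≠ q₂ ∨ ∃ k, (o₁ k).pushed ≠ (o₂ k).pushed) →
      Counts δ acc q₁ (actAll o₁ S) N₁ T → Counts δ acc q₂ (actAll o₂ S) N₂ T →
      Counts δ acc q S (N₁ + N₂) (T + 1)

theorem Counts.mono {Q K Γ : Type} {δ : StackMachine Q K Γ} {acc q : Q} {S : K → List Γ}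
    {N T : ℕ} (h : Counts δ acc q S N T) : ∀ {T' : ℕ}, T ≤ T' → Counts δ acc q S N T' := by
  induction h with
  | accept S T => intro T' _; exact .accept S T'
  | dead q S T h1 h2 => intro T' _; exact .dead q S T' h1 h2
  | one q S q' o N T h1 h2 _ ih =>
    intro T' hT
    obtain ⟨T', rfl⟩ : ∃ t, T' = t + 1 := ⟨T' - 1, by omega⟩
    exact .one q S q' o N T' h1 h2 (ih (by omega))
  | two q S q₁ o₁ q₂ o₂ N₁ N₂ T h1 h2 h3 _ _ ih₁ ih₂ =>
    intro T' hT
    obtain ⟨T', rfl⟩ : ∃ t, T' = t + 1 := ⟨T' - 1, by omega⟩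
    exact .two q S q₁ o₁ q₂ o₂ N₁ N₂ T' h1 h2 h3 (ih₁ (by omega)) (ih₂ (by omega))

/-- The Turing machine that simulates a stack machine. Each stack is held by a tape, with the
topmost symbol under the head and the others to the right of it; a pushed symbol is kept in the
state until the next step. -/
def StackMachine.toNTM {Q K Γ : Type} [Finite Q] [Finite K] [DecidableEq K] [Finite Γ]
    (δ : StackMachine Q K Γ) (start acc : Q) (k₀ : K) : NTM Γ where
  Q := Q × (K → Option Γ)
  Γ := Option Γ
  K := K
  inputTape := k₀
  blank := none
  symb := some
  symb_injective := Option.some_injective _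
  symb_ne_blank := Option.some_ne_none
  start := (start, fun _ => none)
  accept := {q | q.1 = acc}
  δ := fun q r => {t | ∃ u ∈ δ q.1 (fun k => (q.2 k).or (r k)),
    t = ((u.1, fun k => (u.2 k).pushed), fun k => (q.2 k).or (r k), fun k => (u.2 k).move)}

/-- A tape that holds a stack also does so after an operation. -/
theorem holds_apply {Γ : Type} (τ : ℤ → Option Γ) (h : ℤ) (x : Option Γ) (l : List Γ) (o : Op Γ)
    (H : ∀ j : ℕ, (if j = 0 then x.or (τ h) else τ (h + j)) = l[j]?) (j : ℕ) :
    (if j = 0 then o.pushed.or (Function.update τ h (x.or (τ h)) (h + o.move.offset))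
      else Function.update τ h (x.or (τ h)) (h + o.move.offset + j)) = (o.act l)[j]? := by
  have h0 : x.or (τ h) = l[0]? := by simpa using H 0
  have h1 : ∀ j : ℕ, τ (h + (j + 1)) = l[j + 1]? := fun j => by simpa using H (j + 1)
  cases o with
  | keep =>
    rcases j with _ | j
    · simpa [Op.pushed, Op.move, Op.act, Move.offset] using h0
    · simp only [Nat.add_eq_zero_iff, one_ne_zero, and_false, if_false, Op.move, Move.offset,
        Op.act, add_zero, ← h1]
      rw [Function.update_of_ne (by push_cast; omega)]
      push_cast; rfl
  | pop =>
    have h2 : h + Move.right.offset ≠ h := by simp [Move.offset]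
    rcases j with _ | j
    · simp only [if_true, Op.pushed, Op.move, Op.act, Option.none_or, Function.update_of_ne h2]
      simpa [Move.offset] using h1 0
    · simp only [Nat.add_eq_zero_iff, one_ne_zero, and_false, if_false, Op.move, Op.act,
        Move.offset]
      rw [Function.update_of_ne (by push_cast; omega), List.getElem?_tail, ← h1]
      congr 1
      push_cast; ring
  | push a =>
    rcases j with _ | _ | j
    · simp [Op.pushed, Op.act]
    · simpa [Op.move, Op.act, Move.offset] using h0
    · simp only [Nat.add_eq_zero_iff, one_ne_zero, and_false, if_false, Op.move, Move.offset,
        Op.act, List.getElem?_cons_succ, ← h1]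
      rw [Function.update_of_ne (by push_cast; omega)]
      congr 1
      push_cast; ring

namespace StackMachine

variable {Q K Γ : Type} [Finite Q] [Finite K] [DecidableEq K] [Finite Γ]
  (δ : StackMachine Q K Γ) (start acc : Q) (k₀ : K)

/-- The configuration `c` of the Turing machine represents the state `q` and the stacks `S`. -/
def Represents (c : (δ.toNTM start acc k₀).Cfg) (q : Q) (S : K → List Γ) : Prop :=
  c.state.1 = q ∧ ∀ (k : K) (j : ℕ), (if j = 0 then (c.state.2 k).or (c.tape k (c.head k))
    else c.tape k (c.head k + j)) = (S k)[j]?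

/-- The configuration after a transition of the stack machine. -/
def next (c : (δ.toNTM start acc k₀).Cfg) (u : Q × (K → Op Γ)) : (δ.toNTM start acc k₀).Cfg :=
  c.apply ((u.1, fun k => (u.2 k).pushed), fun k => (c.state.2 k).or (c.tape k (c.head k)),
    fun k => (u.2 k).move)

variable {δ start acc k₀}

theorem Represents.tops_eq {c : (δ.toNTM start acc k₀).Cfg} {q : Q} {S : K → List Γ}
    (h : Represents δ start acc k₀ c q S) :
    (fun k => (c.state.2 k).or (c.tape k (c.head k))) = tops S := by
  funext k
  have := h.2 k 0
  simpa [tops, List.head?_eq_getElem?] using this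

theorem Represents.step_iff {c c' : (δ.toNTM start acc k₀).Cfg} {q : Q} {S : K → List Γ}
    (h : Represents δ start acc k₀ c q S) (hq : q ≠ acc) :
    (δ.toNTM start acc k₀).Step c c' ↔ ∃ u ∈ δ q (tops S), c' = δ.next start acc k₀ c u := by
  have h1 := h.tops_eq
  obtain ⟨h2, -⟩ := h
  constructor
  · rintro ⟨-, t, ⟨u, hu, rfl⟩, rfl⟩
    refine ⟨u, ?_, rfl⟩
    rw [← h1, ← h2]
    exact hu
  · rintro ⟨u, hu, rfl⟩
    refine ⟨fun h3 => hq (h2.symm.trans h3), _, ⟨u, ?_, rfl⟩, rfl⟩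
    rw [← h1, ← h2] at hu
    exact hu

theorem Represents.next {c : (δ.toNTM start acc k₀).Cfg} {q : Q} {S : K → List Γ}
    (h : Represents δ start acc k₀ c q S) (u : Q × (K → Op Γ)) :
    Represents δ start acc k₀ (δ.next start acc k₀ c u) u.1 (actAll u.2 S) :=
  ⟨rfl, fun k => holds_apply (c.tape k) (c.head k) (c.state.2 k) (S k) (u.2 k) (h.2 k)⟩

end StackMachine

/-- Runs from a given configuration. -/
def NTM.IsRunFrom {A : Type} (M : NTM A) (c : M.Cfg) (ρ : List M.Cfg) : Prop :=
  ρ.head? = some c ∧ ρ.IsChain M.Step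

/-- Accepting runs from a given configuration. -/
def NTM.acceptingFrom {A : Type} (M : NTM A) (c : M.Cfg) : Set (List M.Cfg) :=
  {ρ | M.IsRunFrom c ρ ∧ ∃ c, ρ.getLast? = some c ∧ c.state ∈ M.accept}

theorem NTM.isRunFrom_iff {A : Type} {M : NTM A} {c : M.Cfg} {ρ : List M.Cfg} :
    M.IsRunFrom c ρ ↔ ρ = [c] ∨ ∃ c' ρ', M.Step c c' ∧ M.IsRunFrom c' ρ' ∧ ρ = c :: ρ' := by
  constructor
  · rintro ⟨h1, h2⟩
    match ρ with
    | [] => simp at h1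
    | [d] => left; simpa using h1
    | d :: e :: ρ' =>
      right
      obtain rfl : d = c := by simpa using h1
      rw [List.isChain_cons_cons] at h2
      exact ⟨e, e :: ρ', h2.1, ⟨rfl, h2.2⟩, rfl⟩
  · rintro (rfl | ⟨c', ρ', h1, ⟨h2, h3⟩, rfl⟩)
    · exact ⟨rfl, List.isChain_singleton _⟩
    · refine ⟨rfl, ?_⟩
      match ρ' with
      | [] => simp at h2
      | d :: ρ' =>
        obtain rfl : d = c' := by simpa using h2
        exact List.isChain_cons_cons.2 ⟨h1, h3⟩

theorem NTM.acceptingFrom_of_mem {A : Type} {M : NTM A} {c : M.Cfg} (h : c.state ∈ M.accept) :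
    M.acceptingFrom c = {[c]} := by
  ext ρ
  simp only [acceptingFrom, Set.mem_ofPred_eq, Set.mem_singleton_iff]
  constructor
  · rintro ⟨h1, -⟩
    rcases NTM.isRunFrom_iff.1 h1 with rfl | ⟨c', ρ', h2, -⟩
    · rfl
    · exact absurd h h2.1
  · rintro rfl
    exact ⟨⟨rfl, List.isChain_singleton _⟩, c, rfl, h⟩

theorem NTM.acceptingFrom_of_notMem {A : Type} {M : NTM A} {c : M.Cfg} (h : c.state ∉ M.accept) :
    M.acceptingFrom c = ⋃ c' ∈ {c' | M.Step c c'}, List.cons c '' M.acceptingFrom c' := by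
  ext ρ
  simp only [acceptingFrom, Set.mem_ofPred_eq, Set.mem_iUnion, Set.mem_image, exists_prop]
  constructor
  · rintro ⟨h1, d, h2, h3⟩
    rcases NTM.isRunFrom_iff.1 h1 with rfl | ⟨c', ρ', h4, h5, rfl⟩
    · obtain rfl : c = d := by simpa using h2
      exact absurd h3 h
    · refine ⟨c', h4, ρ', ⟨h5, d, ?_, h3⟩, rfl⟩
      obtain ⟨h6, -⟩ := h5
      match ρ' with
      | [] => simp at h6
      | e :: ρ' => simpa using h2
  · rintro ⟨c', h4, ρ', ⟨h5, d, h2, h3⟩, rfl⟩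
    refine ⟨NTM.isRunFrom_iff.2 (Or.inr ⟨c', ρ', h4, h5, rfl⟩), d, ?_, h3⟩
    match ρ' with
    | [] => simp at h2
    | e :: ρ' => simpa using h2

theorem NTM.disjoint_acceptingFrom {A : Type} {M : NTM A} {c c₁ c₂ : M.Cfg} (h : c₁ ≠ c₂) :
    Disjoint (List.cons c '' M.acceptingFrom c₁) (List.cons c '' M.acceptingFrom c₂) := by
  rw [Set.disjoint_left]
  rintro _ ⟨ρ, h1, rfl⟩ ⟨ρ', h2, h3⟩
  obtain rfl : ρ' = ρ := by simpa using h3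
  exact h (Option.some_injective _ (h1.1.1.symm.trans h2.1.1))

theorem Counts.runs {Q K Γ : Type} [Finite Q] [Finite K] [DecidableEq K] [Finite Γ]
    {δ : StackMachine Q K Γ} {start acc : Q} {k₀ : K} {q : Q} {S : K → List Γ} {N T : ℕ}
    (h : Counts δ acc q S N T) : ∀ {c : (δ.toNTM start acc k₀).Cfg},
      StackMachine.Represents δ start acc k₀ c q S →
      ((δ.toNTM start acc k₀).acceptingFrom c).encard = N ∧
      ∀ ρ, (δ.toNTM start acc k₀).IsRunFrom c ρ → ρ.length ≤ T + 1 := by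
  induction h with
  | accept S T =>
    intro c hc
    have hmem : c.state ∈ (δ.toNTM start acc k₀).accept := hc.1
    refine ⟨by rw [NTM.acceptingFrom_of_mem hmem]; simp, fun ρ hρ => ?_⟩
    rcases NTM.isRunFrom_iff.1 hρ with rfl | ⟨c', ρ', h2, -⟩
    · simp
    · exact absurd hmem h2.1
  | dead q S T h1 h2 =>
    intro c hc
    have hmem : c.state ∉ (δ.toNTM start acc k₀).accept := fun h => h1 (hc.1.symm.trans h)
    have hs : {c' | (δ.toNTM start acc k₀).Step c c'} = ∅ := by
      ext c'; simp [hc.step_iff h1, h2]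
    refine ⟨by rw [NTM.acceptingFrom_of_notMem hmem, hs]; simp, fun ρ hρ => ?_⟩
    rcases NTM.isRunFrom_iff.1 hρ with rfl | ⟨c', ρ', h3, -⟩
    · simp
    · have : c' ∈ {c' | (δ.toNTM start acc k₀).Step c c'} := h3
      simp [hs] at this
  | one q S q' o N T h1 h2 _ ih =>
    intro c hc
    have hmem : c.state ∉ (δ.toNTM start acc k₀).accept := fun h => h1 (hc.1.symm.trans h)
    have hs : {c' | (δ.toNTM start acc k₀).Step c c'} = {δ.next start acc k₀ c (q', o)} := by
      ext c'; simp [hc.step_iff h1, h2]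
    obtain ⟨ih1, ih2⟩ := ih (hc.next (q', o))
    constructor
    · rw [NTM.acceptingFrom_of_notMem hmem, hs]
      simp only [Set.mem_singleton_iff, Set.iUnion_iUnion_eq_left]
      rw [(List.cons_injective).encard_image, ih1]
    · intro ρ hρ
      rcases NTM.isRunFrom_iff.1 hρ with rfl | ⟨c', ρ', h3, h4, rfl⟩
      · simp
      · have : c' ∈ {c' | (δ.toNTM start acc k₀).Step c c'} := h3
        rw [hs] at this
        obtain rfl := this
        simpa using ih2 _ h4
  | two q S q₁ o₁ q₂ o₂ N₁ N₂ T h1 h2 h3 _ _ ih₁ ih₂ =>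
    intro c hc
    have hmem : c.state ∉ (δ.toNTM start acc k₀).accept := fun h => h1 (hc.1.symm.trans h)
    have hs : {c' | (δ.toNTM start acc k₀).Step c c'} =
        {δ.next start acc k₀ c (q₁, o₁), δ.next start acc k₀ c (q₂, o₂)} := by
      ext c'; simp [hc.step_iff h1, h2]
    have hne : δ.next start acc k₀ c (q₁, o₁) ≠ δ.next start acc k₀ c (q₂, o₂) := by
      intro h
      have h4 : (q₁, fun k => (o₁ k).pushed) = (q₂, fun k => (o₂ k).pushed) :=
        congrArg NTM.Cfg.state h
      rw [Prod.mk.injEq] at h4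
      rcases h3 with h3 | ⟨k, h3⟩
      · exact h3 h4.1
      · exact h3 (congrFun h4.2 k)
    obtain ⟨ih1, ih2⟩ := ih₁ (hc.next (q₁, o₁))
    obtain ⟨ih3, ih4⟩ := ih₂ (hc.next (q₂, o₂))
    constructor
    · rw [NTM.acceptingFrom_of_notMem hmem, hs, Set.biUnion_pair,
        Set.encard_union_eq (NTM.disjoint_acceptingFrom hne),
        (List.cons_injective).encard_image, (List.cons_injective).encard_image, ih1, ih3]
      simp
    · intro ρ hρ
      rcases NTM.isRunFrom_iff.1 hρ with rfl | ⟨c', ρ', h3, h4, rfl⟩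
      · simp
      · have : c' ∈ {c' | (δ.toNTM start acc k₀).Step c c'} := h3
        rw [hs] at this
        rcases this with rfl | rfl
        · simpa using ih2 _ h4
        · simpa using ih4 _ h4

/-- A function that a stack machine counts in polynomial time is in #P. -/
theorem inSharpP_of_counts {Q K Γ : Type} [Finite Q] [Finite K] [DecidableEq K] [Finite Γ]
    (δ : StackMachine Q K Γ) (start acc : Q) (k₀ : K) (f : List Γ → ℕ) (p : Polynomial ℕ)
    (h : ∀ w, Counts δ acc start (fun k => if k = k₀ then w else []) (f w) (p.eval w.length)) :
    InSharpP f := by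
  have hinit : ∀ w, StackMachine.Represents δ start acc k₀ ((δ.toNTM start acc k₀).init w) start
      (fun k => if k = k₀ then w else []) := by
    refine fun w => ⟨rfl, fun k j => ?_⟩
    have h1 : (if k = k₀ ∧ (0 : ℤ) ≤ j then (w[(j : ℤ).toNat]?).elim none some else none) =
        (if k = k₀ then w else [])[j]? := by
      by_cases hk : k = k₀
      · simp only [hk, true_and, Int.natCast_nonneg, if_true, Int.toNat_natCast]
        cases w[j]? <;> rfl
      · simp [hk]
    rw [← h1]
    rcases j with _ | j
    · rfl
    · simp only [Nat.add_eq_zero_iff, one_ne_zero, and_false]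
      simp only [NTM.init, zero_add]
      rfl
  refine ⟨δ.toNTM start acc k₀, ⟨p, fun w ρ hρ => ((h w).runs (hinit w)).2 ρ hρ⟩, fun w => ?_⟩
  have h1 : ((δ.toNTM start acc k₀).acceptingFrom ((δ.toNTM start acc k₀).init w)).ncard = f w := by
    rw [Set.ncard, ((h w).runs (hinit w)).1]
    simp
  exact h1.symm

end LTLCount

namespace LTLCount

/-! ## A stack machine that counts word-models -/

theorem Counts.step {Q K Γ : Type} {δ : StackMachine Q K Γ} {acc q q' : Q} {S S' : K → List Γ}
    {o : K → Op Γ} {N T : ℕ} (hq : q ≠ acc) (hδ : δ q (tops S) = [(q', o)])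
    (hS : actAll o S = S') (h : Counts δ acc q' S' N T) : Counts δ acc q S N (T + 1) :=
  .one q S q' o N T hq hδ (hS ▸ h)

theorem Counts.step_le {Q K Γ : Type} {δ : StackMachine Q K Γ} {acc q q' : Q} {S S' : K → List Γ}
    {o : K → Op Γ} {N T T' : ℕ} (hq : q ≠ acc) (hδ : δ q (tops S) = [(q', o)])
    (hS : actAll o S = S') (h : Counts δ acc q' S' N T) (hT : T + 1 ≤ T') :
    Counts δ acc q S N T' :=
  (Counts.step hq hδ hS h).mono hT

theorem Counts.branch {Q K Γ : Type} {δ : StackMachine Q K Γ} {acc q q₁ q₂ : Q}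
    {S S₁ S₂ : K → List Γ} {o₁ o₂ : K → Op Γ} {N₁ N₂ T : ℕ} (hq : q ≠ acc)
    (hδ : δ q (tops S) = [(q₁, o₁), (q₂, o₂)])
    (hne : q₁ ≠ q₂ ∨ ∃ k, (o₁ k).pushed ≠ (o₂ k).pushed)
    (hS₁ : actAll o₁ S = S₁) (hS₂ : actAll o₂ S = S₂)
    (h₁ : Counts δ acc q₁ S₁ N₁ T) (h₂ : Counts δ acc q₂ S₂ N₂ T) :
    Counts δ acc q S (N₁ + N₂) (T + 1) :=
  .two q S q₁ o₁ q₂ o₂ N₁ N₂ T hq hδ hne (hS₁ ▸ h₁) (hS₂ ▸ h₂)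

/-- The states of the machine. -/
inductive CState where
  | readNum | rev | guess | guessRow | guessBack | main | pushTrue | restore | skip | skipRow
  | skipBack | copyRow | restoreWord | back | acc
  | readBound (seen : Bool)
  | moveOut (op : Symb)
  | moveBack (op : Symb)
  | choose (op : Symb)
  | pass (op : Symb) (g c ok : Bool)
  | final (v : Bool)
deriving DecidableEq, Fintype

/-- The stacks of the machine: the input, the number of propositions, the reversed formula, the
positions (with a mark for the beginning of the loop), the guessed word, the rows of truth values of
the formulas that have been evaluated, and auxiliary stacks. -/
inductive CStack where
  | inp | num | tok | pos | pos' | word | word' | rows | aux | arg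
deriving DecidableEq

instance : Finite CStack :=
  Finite.of_surjective (![.inp, .num, .tok, .pos, .pos', .word, .word', .rows, .aux, .arg] :
    Fin 10 → CStack) fun x => by
      cases x
      exacts [⟨0, rfl⟩, ⟨1, rfl⟩, ⟨2, rfl⟩, ⟨3, rfl⟩, ⟨4, rfl⟩, ⟨5, rfl⟩, ⟨6, rfl⟩, ⟨7, rfl⟩,
        ⟨8, rfl⟩, ⟨9, rfl⟩]

/-- The symbol for a truth value. -/
def bit : Bool → Symb
  | true => .one
  | false => .sep

/-- The truth value of a symbol. -/
def isOne : Symb → Bool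
  | .one => true
  | _ => false

@[simp] theorem isOne_bit (b : Bool) : isOne (bit b) = b := by cases b <;> rfl

/-- The operations given by a list. -/
def ops (l : List (CStack × Op Symb)) : CStack → Op Symb := fun k => (l.lookup k).getD .keep

/-- The quantity that is passed on to the preceding position in the evaluation of an operator. -/
def carry : Symb → Bool → Bool → Bool → Bool
  | .next, _, b, _ => b
  | .untl, a, b, c => b || (a && c)
  | .release, a, b, c => b && (a || c)
  | _, _, _, _ => false

/-- The truth value of an operator. -/
def value : Symb → Bool → Bool → Bool → Bool
  | .neg, _, b, _ => !b
  | .and, a, b, _ => a && b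
  | .or, a, b, _ => a || b
  | .next, _, _, c => c
  | .untl, a, b, c => b || (a && c)
  | .release, a, b, c => b && (a || c)
  | _, _, _, _ => false

/-- Whether the guess `g` needs no confirmation. -/
def okStart : Symb → Bool → Bool
  | .untl, g => !g
  | .release, g => g
  | _, _ => true

/-- Whether the value `b` of the second operand confirms the guess. -/
def okStep : Symb → Bool → Bool
  | .untl, b => b
  | .release, b => !b
  | _, _ => false

/-- The transitions. -/
def checker : StackMachine CState CStack Symb
  | .readNum, t => match t .inp with
    | some .one => [(.readNum, ops [(.inp, .pop), (.num, .push .one)])]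
    | some .sep => [(.rev, ops [(.inp, .pop)])]
    | _ => []
  | .rev, t => match t .inp with
    | some a => [(.rev, ops [(.inp, .pop), (.tok, .push a)])]
    | none => [(.readBound false, ops [])]
  | .readBound false, t => match t .tok with
    | some .one => [(.readBound true, ops [(.tok, .pop), (.pos, .push .one)]),
        (.readBound false, ops [(.tok, .pop), (.pos, .push .sep)])]
    | _ => []
  | .readBound true, t => match t .tok with
    | some .one => [(.readBound true, ops [(.tok, .pop), (.pos, .push .sep)])]
    | _ => [(.guess, ops [])]
  | .guess, t => match t .num with
    | some _ => [(.guessRow, ops [(.num, .pop)])]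
    | none => [(.main, ops [])]
  | .guessRow, t => match t .pos with
    | some m => [(.guessRow, ops [(.pos, .pop), (.pos', .push m), (.word, .push .sep)]),
        (.guessRow, ops [(.pos, .pop), (.pos', .push m), (.word, .push .one)])]
    | none => [(.guessBack, ops [])]
  | .guessBack, t => match t .pos' with
    | some m => [(.guessBack, ops [(.pos', .pop), (.pos, .push m)])]
    | none => [(.guess, ops [])]
  | .main, t => match t .tok with
    | some .tt => [(.pushTrue, ops [(.tok, .pop)])]
    | some .sep => [(.skip, ops [(.tok, .pop)])]
    | some .neg => [(.choose .neg, ops [(.tok, .pop)])]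
    | some .next => [(.choose .next, ops [(.tok, .pop)])]
    | some .and => [(.moveOut .and, ops [(.tok, .pop)])]
    | some .or => [(.moveOut .or, ops [(.tok, .pop)])]
    | some .untl => [(.moveOut .untl, ops [(.tok, .pop)])]
    | some .release => [(.moveOut .release, ops [(.tok, .pop)])]
    | some _ => []
    | none => [(.final false, ops [])]
  | .pushTrue, t => match t .pos with
    | some m => [(.pushTrue, ops [(.pos, .pop), (.pos', .push m), (.rows, .push .one)])]
    | none => [(.restore, ops [])]
  | .restore, t => match t .pos' with
    | some m => [(.restore, ops [(.pos', .pop), (.pos, .push m)])]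
    | none => [(.main, ops [])]
  | .skip, t => match t .tok with
    | some .one => [(.skipRow, ops [(.tok, .pop)])]
    | some .atom => [(.copyRow, ops [(.tok, .pop)])]
    | _ => []
  | .skipRow, t => match t .pos with
    | none => [(.skipBack, ops [])]
    | some m => match t .word with
      | none => []
      | some b => [(.skipRow, ops [(.pos, .pop), (.pos', .push m), (.word, .pop),
          (.word', .push b)])]
  | .skipBack, t => match t .pos' with
    | some m => [(.skipBack, ops [(.pos', .pop), (.pos, .push m)])]
    | none => [(.skip, ops [])]
  | .copyRow, t => match t .pos with
    | none => [(.restoreWord, ops [])]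
    | some m => match t .word with
      | none => []
      | some b => [(.copyRow, ops [(.pos, .pop), (.pos', .push m), (.word, .pop),
          (.word', .push b), (.rows, .push b)])]
  | .restoreWord, t => match t .word' with
    | some b => [(.restoreWord, ops [(.word', .pop), (.word, .push b)])]
    | none => [(.restore, ops [])]
  | .moveOut op, t => match t .pos with
    | none => [(.moveBack op, ops [])]
    | some m => match t .rows with
      | none => []
      | some b => [(.moveOut op, ops [(.pos, .pop), (.pos', .push m), (.rows, .pop),
          (.aux, .push b)])]
  | .moveBack op, t => match t .pos' with
    | none => [(.choose op, ops [])]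
    | some m => match t .aux with
      | none => []
      | some b => [(.moveBack op, ops [(.pos', .pop), (.pos, .push m), (.aux, .pop),
          (.arg, .push b)])]
  | .choose op, _ => [(.pass op true true (okStart op true), ops []),
      (.pass op false false (okStart op false), ops [])]
  | .pass op g c ok, t => match t .pos with
    | none => [(.back, ops [])]
    | some m => match t .rows with
      | none => []
      | some b =>
        if isOne m && !(carry op ((t .arg).any isOne) (isOne b) c == g && (ok || okStep op (isOne b)))
        then []
        else [(.pass op g (carry op ((t .arg).any isOne) (isOne b) c) (ok || okStep op (isOne b)),
          ops [(.pos, .pop), (.pos', .push m), (.rows, .pop), (.arg, .pop),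
            (.aux, .push (bit (value op ((t .arg).any isOne) (isOne b) c)))])]
  | .back, t => match t .pos' with
    | none => [(.main, ops [])]
    | some m => match t .aux with
      | none => []
      | some b => [(.back, ops [(.pos', .pop), (.pos, .push m), (.aux, .pop),
          (.rows, .push b)])]
  | .final v, t => match t .pos with
    | none => match t .rows with
      | none => if v then [(.acc, ops [])] else []
      | some _ => []
    | some _ => match t .rows with
      | none => []
      | some b => [(.final (isOne b), ops [(.pos, .pop), (.rows, .pop)])]
  | .acc, _ => []

/-- The stacks with the given contents. -/
def stk (inp num tok pos pos' word word' rows aux arg : List Symb) : CStack → List Symb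
  | .inp => inp
  | .num => num
  | .tok => tok
  | .pos => pos
  | .pos' => pos'
  | .word => word
  | .word' => word'
  | .rows => rows
  | .aux => aux
  | .arg => arg

/-- The number of accepting runs and the number of steps of the machine `checker`. -/
abbrev CheckerCounts := Counts checker CState.acc

/-- The truth values of `f` at the positions below `k`, the last one first. -/
def row (f : ℕ → Bool) : ℕ → List Symb
  | 0 => []
  | k + 1 => bit (f k) :: row f k

@[simp] theorem row_length (f : ℕ → Bool) (k : ℕ) : (row f k).length = k := by
  induction k with
  | zero => rfl
  | succ k ih => simp [row, ih]

theorem row_congr {f g : ℕ → Bool} {k : ℕ} (h : ∀ j < k, f j = g j) : row f k = row g k := by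
  induction k with
  | zero => rfl
  | succ k ih => simp only [row]; rw [h k (by omega), ih fun j hj => h j (by omega)]

section Loops

variable {I U R M P W V S A B : List Symb} {N T : ℕ}

theorem rev_loop (l : List Symb) : ∀ {R},
    CheckerCounts (.readBound false) (stk [] U (l.reverse ++ R) M P W V S A B) N T →
    CheckerCounts .rev (stk l U R M P W V S A B) N (T + l.length + 1) := by
  induction l with
  | nil => exact fun h => .step nofun rfl (by funext k; cases k <;> rfl) h
  | cons a l ih =>
    intro R h
    refine .step nofun rfl (by funext k; cases k <;> rfl) (ih (R := a :: R) ?_)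
    simpa using h

theorem readNum_loop (n : ℕ) : ∀ {U},
    CheckerCounts .rev (stk I (List.replicate n .one ++ U) R M P W V S A B) N T →
    CheckerCounts .readNum (stk (List.replicate n .one ++ .sep :: I) U R M P W V S A B) N
      (T + n + 1) := by
  induction n with
  | zero => exact fun h => .step nofun rfl (by funext k; cases k <;> rfl) h
  | succ n ih =>
    intro U h
    refine .step nofun rfl (by funext k; cases k <;> rfl) (ih (U := .one :: U) ?_)
    rw [List.replicate_succ'] at h
    simpa using h

theorem guessBack_loop (l : List Symb) : ∀ {M},
    CheckerCounts .guess (stk I U R (l.reverse ++ M) [] W V S A B) N T →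
    CheckerCounts .guessBack (stk I U R M l W V S A B) N (T + l.length + 1) := by
  induction l with
  | nil => exact fun h => .step nofun rfl (by funext k; cases k <;> rfl) h
  | cons a l ih =>
    intro M h
    refine .step nofun rfl (by funext k; cases k <;> rfl) (ih (M := a :: M) ?_)
    simpa using h

theorem restore_loop (l : List Symb) : ∀ {M},
    CheckerCounts .main (stk I U R (l.reverse ++ M) [] W V S A B) N T →
    CheckerCounts .restore (stk I U R M l W V S A B) N (T + l.length + 1) := by
  induction l with
  | nil => exact fun h => .step nofun rfl (by funext k; cases k <;> rfl) h
  | cons a l ih =>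
    intro M h
    refine .step nofun rfl (by funext k; cases k <;> rfl) (ih (M := a :: M) ?_)
    simpa using h

theorem skipBack_loop (l : List Symb) : ∀ {M},
    CheckerCounts .skip (stk I U R (l.reverse ++ M) [] W V S A B) N T →
    CheckerCounts .skipBack (stk I U R M l W V S A B) N (T + l.length + 1) := by
  induction l with
  | nil => exact fun h => .step nofun rfl (by funext k; cases k <;> rfl) h
  | cons a l ih =>
    intro M h
    refine .step nofun rfl (by funext k; cases k <;> rfl) (ih (M := a :: M) ?_)
    simpa using h

theorem restoreWord_loop (l : List Symb) : ∀ {W},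
    CheckerCounts .restore (stk I U R M P (l.reverse ++ W) [] S A B) N T →
    CheckerCounts .restoreWord (stk I U R M P W l S A B) N (T + l.length + 1) := by
  induction l with
  | nil => exact fun h => .step nofun rfl (by funext k; cases k <;> rfl) h
  | cons a l ih =>
    intro W h
    refine .step nofun rfl (by funext k; cases k <;> rfl) (ih (W := a :: W) ?_)
    simpa using h

theorem pushTrue_loop (l : List Symb) : ∀ {P S},
    CheckerCounts .restore
      (stk I U R [] (l.reverse ++ P) W V (List.replicate l.length .one ++ S) A B) N T →
    CheckerCounts .pushTrue (stk I U R l P W V S A B) N (T + l.length + 1) := by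
  induction l with
  | nil => exact fun h => .step nofun rfl (by funext k; cases k <;> rfl) h
  | cons a l ih =>
    intro P S h
    refine .step nofun rfl (by funext k; cases k <;> rfl) (ih (P := a :: P) (S := .one :: S) ?_)
    rw [List.length_cons, List.replicate_succ'] at h
    simpa using h

theorem skipRow_loop (l r : List Symb) (hr : r.length = l.length) : ∀ {P V},
    CheckerCounts .skipBack (stk I U R [] (l.reverse ++ P) W (r.reverse ++ V) S A B) N T →
    CheckerCounts .skipRow (stk I U R l P (r ++ W) V S A B) N (T + l.length + 1) := by
  induction l generalizing r with
  | nil =>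
    obtain rfl := List.eq_nil_of_length_eq_zero hr
    exact fun h => .step nofun rfl (by funext k; cases k <;> rfl) h
  | cons a l ih =>
    intro P V h
    obtain ⟨b, r, rfl⟩ := List.exists_cons_of_length_eq_add_one hr
    refine .step nofun rfl (by funext k; cases k <;> rfl)
      (ih r (by simpa using hr) (P := a :: P) (V := b :: V) ?_)
    simpa using h

theorem skipRow_dead (a : Symb) (l : List Symb) :
    CheckerCounts .skipRow (stk I U R (a :: l) P [] V S A B) 0 T :=
  .dead _ _ _ nofun rfl

theorem copyRow_dead (a : Symb) (l : List Symb) :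
    CheckerCounts .copyRow (stk I U R (a :: l) P [] V S A B) 0 T :=
  .dead _ _ _ nofun rfl

theorem copyRow_loop (l r : List Symb) (hr : r.length = l.length) : ∀ {P V S},
    CheckerCounts .restoreWord
      (stk I U R [] (l.reverse ++ P) W (r.reverse ++ V) (r.reverse ++ S) A B) N T →
    CheckerCounts .copyRow (stk I U R l P (r ++ W) V S A B) N (T + l.length + 1) := by
  induction l generalizing r with
  | nil =>
    obtain rfl := List.eq_nil_of_length_eq_zero hr
    exact fun h => .step nofun rfl (by funext k; cases k <;> rfl) h
  | cons a l ih =>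
    intro P V S h
    obtain ⟨b, r, rfl⟩ := List.exists_cons_of_length_eq_add_one hr
    refine .step nofun rfl (by funext k; cases k <;> rfl)
      (ih r (by simpa using hr) (P := a :: P) (V := b :: V) (S := b :: S) ?_)
    simpa using h

theorem moveOut_loop (op : Symb) (l r : List Symb) (hr : r.length = l.length) : ∀ {P A},
    CheckerCounts (.moveBack op) (stk I U R [] (l.reverse ++ P) W V S (r.reverse ++ A) B) N T →
    CheckerCounts (.moveOut op) (stk I U R l P W V (r ++ S) A B) N (T + l.length + 1) := by
  induction l generalizing r with
  | nil =>
    obtain rfl := List.eq_nil_of_length_eq_zero hr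
    exact fun h => .step nofun rfl (by funext k; cases k <;> rfl) h
  | cons a l ih =>
    intro P A h
    obtain ⟨b, r, rfl⟩ := List.exists_cons_of_length_eq_add_one hr
    refine .step nofun rfl (by funext k; cases k <;> rfl)
      (ih r (by simpa using hr) (P := a :: P) (A := b :: A) ?_)
    simpa using h

theorem moveBack_loop (op : Symb) (l r : List Symb) (hr : r.length = l.length) : ∀ {M B},
    CheckerCounts (.choose op) (stk I U R (l.reverse ++ M) [] W V S A (r.reverse ++ B)) N T →
    CheckerCounts (.moveBack op) (stk I U R M l W V S (r ++ A) B) N (T + l.length + 1) := by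
  induction l generalizing r with
  | nil =>
    obtain rfl := List.eq_nil_of_length_eq_zero hr
    exact fun h => .step nofun rfl (by funext k; cases k <;> rfl) h
  | cons a l ih =>
    intro M B h
    obtain ⟨b, r, rfl⟩ := List.exists_cons_of_length_eq_add_one hr
    refine .step nofun rfl (by funext k; cases k <;> rfl)
      (ih r (by simpa using hr) (M := a :: M) (B := b :: B) ?_)
    simpa using h

theorem back_loop (l r : List Symb) (hr : r.length = l.length) : ∀ {M S},
    CheckerCounts .main (stk I U R (l.reverse ++ M) [] W V (r.reverse ++ S) A B) N T →
    CheckerCounts .back (stk I U R M l W V S (r ++ A) B) N (T + l.length + 1) := by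
  induction l generalizing r with
  | nil =>
    obtain rfl := List.eq_nil_of_length_eq_zero hr
    exact fun h => .step nofun rfl (by funext k; cases k <;> rfl) h
  | cons a l ih =>
    intro M S h
    obtain ⟨b, r, rfl⟩ := List.exists_cons_of_length_eq_add_one hr
    refine .step nofun rfl (by funext k; cases k <;> rfl)
      (ih r (by simpa using hr) (M := a :: M) (S := b :: S) ?_)
    simpa using h

theorem final_loop (f : ℕ → Bool) (l : List Symb) : ∀ (v : Bool),
    CheckerCounts (.final v) (stk I U R l P W V (row f l.length) A B)
      (if (if l = [] then v else f 0) then 1 else 0) (T + l.length + 1) := by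
  induction l with
  | nil =>
    intro v
    cases v
    · exact .dead _ _ _ nofun rfl
    · exact .step nofun rfl rfl (.accept _ _)
  | cons a l ih =>
    intro v
    have h := ih (isOne (bit (f l.length)))
    have h1 : (if a :: l = [] then v else f 0) =
        if l = [] then isOne (bit (f l.length)) else f 0 := by
      cases l <;> simp
    rw [h1]
    exact .step nofun rfl (by funext k; cases k <;> rfl) h

theorem final_dead_short (a : Symb) (l : List Symb) (v : Bool) :
    CheckerCounts (.final v) (stk I U R (a :: l) P W V [] A B) 0 T :=
  .dead _ _ _ nofun rfl

theorem final_dead_long (r : List Symb) (s : Symb) (l : List Symb) (hr : r.length = l.length) :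
    ∀ (v : Bool), CheckerCounts (.final v) (stk I U R l P W V (r ++ s :: S) A B) 0
      (T + l.length) := by
  induction l generalizing r with
  | nil =>
    obtain rfl := List.eq_nil_of_length_eq_zero hr
    exact fun v => .dead _ _ _ nofun rfl
  | cons a l ih =>
    intro v
    obtain ⟨b, r, rfl⟩ := List.exists_cons_of_length_eq_add_one hr
    exact .step nofun rfl (by funext k; cases k <;> rfl) (ih r (by simpa using hr) _)

/-- The sum of the values of `F` over all the words obtained by pushing `j` bits. -/
def bitSum (F : List Bool → ℕ) : ℕ → List Bool → ℕ
  | 0, W => F W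
  | j + 1, W => bitSum F j (false :: W) + bitSum F j (true :: W)

theorem bitSum_add (F : List Bool → ℕ) (i : ℕ) : ∀ (j : ℕ) (W : List Bool),
    bitSum (bitSum F i) j W = bitSum F (i + j) W
  | 0, _ => rfl
  | j + 1, W => by
    rw [← add_assoc, bitSum, bitSum, bitSum_add F i j, bitSum_add F i j]

theorem guessRow_loop {F : List Bool → ℕ} (l : List Symb) : ∀ {P} {L : ℕ},
    (∀ W, W.length = L + l.length → CheckerCounts .guessBack
      (stk I U R [] (l.reverse ++ P) (W.map bit) V S A B) (F W) T) →
    ∀ W, W.length = L → CheckerCounts .guessRow (stk I U R l P (W.map bit) V S A B)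
      (bitSum F l.length W) (T + l.length + 1) := by
  induction l with
  | nil => exact fun h W hW => .step nofun rfl (by funext k; cases k <;> rfl) (h W hW)
  | cons a l ih =>
    intro P L h W hW
    have h' : ∀ W, W.length = L + 1 + l.length → CheckerCounts .guessBack
      (stk I U R [] (l.reverse ++ a :: P) (W.map bit) V S A B) (F W) T := fun W' hW' => by
        simpa using h W' (by rw [hW', List.length_cons]; omega)
    exact .branch nofun rfl (Or.inr ⟨.word, nofun⟩) (by funext k; cases k <;> rfl)
      (by funext k; cases k <;> rfl) (ih h' (false :: W) (by simp [hW]))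
      (ih h' (true :: W) (by simp [hW]))

theorem guess_loop {F : List Bool → ℕ} (n : ℕ) : ∀ {L : ℕ},
    (∀ W, W.length = L + n * M.length →
      CheckerCounts .main (stk I [] R M [] (W.map bit) V S A B) (F W) T) →
    ∀ W, W.length = L →
      CheckerCounts .guess (stk I (List.replicate n .one) R M [] (W.map bit) V S A B)
        (bitSum F (n * M.length) W) (T + n * (2 * M.length + 3) + 1) := by
  induction n with
  | zero =>
    intro L h W hW
    rw [Nat.zero_mul]
    exact .step nofun rfl (by funext k; cases k <;> rfl) ((h W (by omega)).mono (by omega))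
  | succ n ih =>
    intro L h W hW
    have h0 := ih (L := L + M.length) fun W hW' => h W (by rw [hW']; ring)
    have h1 := fun W hW => guessBack_loop (M := []) M.reverse (by simpa using h0 W hW)
    have h2 := guessRow_loop (P := []) M (by simpa using h1) W hW
    rw [bitSum_add, ← Nat.succ_mul] at h2
    refine .step nofun rfl (by funext k; cases k <;> rfl) (h2.mono ?_)
    ring_nf
    omega

theorem readBound_true_loop (s : ℕ) (hR : R.head? ≠ some .one) (r : ℕ) : ∀ (c : ℕ), s < c →
    CheckerCounts .guess (stk I U R (row (fun j => j == s) (c + r)) P W V S A B) N T →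
    CheckerCounts (.readBound true)
      (stk I U (List.replicate r .one ++ R) (row (fun j => j == s) c) P W V S A B) N
      (T + r + 1) := by
  induction r with
  | zero =>
    intro c _ h
    refine .step (o := ops []) nofun ?_ (by funext k; cases k <;> rfl) h
    rcases R with _ | ⟨a, R⟩
    · rfl
    · cases a <;> first | rfl | exact absurd rfl hR
  | succ r ih =>
    intro c hc h
    rw [(by omega : c + (r + 1) = c + 1 + r)] at h
    have h1 := ih (c + 1) (by omega) h
    have h2 : (c == s) = false := by simpa using (by omega : c ≠ s)
    rw [row, h2] at h1
    exact .step nofun rfl (by funext k; cases k <;> rfl) h1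

theorem readBound_false_loop {F : ℕ → ℕ} (hR : R.head? ≠ some .one) (r : ℕ) : ∀ (c : ℕ),
    (∀ s < c + r,
      CheckerCounts .guess (stk I U R (row (fun j => j == s) (c + r)) P W V S A B) (F s) T) →
    CheckerCounts (.readBound false)
      (stk I U (List.replicate r .one ++ R) (row (fun _ => false) c) P W V S A B)
      (∑ s ∈ Finset.Ico c (c + r), F s) (T + r + 1) := by
  induction r with
  | zero =>
    intro c _
    simp only [add_zero, Finset.Ico_self, Finset.sum_empty]
    refine .dead _ _ _ nofun ?_
    rcases R with _ | ⟨a, R⟩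
    · rfl
    · cases a <;> first | rfl | exact absurd rfl hR
  | succ r ih =>
    intro c h
    rw [Finset.sum_eq_sum_Ico_succ_bot (by omega)]
    have hc : c + (r + 1) = c + 1 + r := by omega
    rw [hc] at h ⊢
    have h1 := readBound_true_loop c hR r (c + 1) (by omega) (h c (by omega))
    have h2 : row (fun j => j == c) (c + 1) = .one :: row (fun _ => false) c := by
      simp only [row, beq_self_eq_true, bit]
      rw [row_congr (g := fun _ => false)]
      intro j hj
      simpa using (by omega : j ≠ c)
    rw [h2] at h1
    exact .branch nofun rfl (Or.inl nofun) (by funext k; cases k <;> rfl)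
      (by funext k; cases k <;> rfl) h1 (ih (c + 1) h)

end Loops

end LTLCount

namespace LTLCount

/-! ## Evaluation of the operators -/

/-- The quantities computed in a pass over the positions `k - 1, …, 0`, starting with `g`. -/
structure IsPass (op : Symb) (a b : ℕ → Bool) (k : ℕ) (g : Bool) (C ok : ℕ → Bool) : Prop where
  carry_top : C k = g
  ok_top : ok k = okStart op g
  carry_eq : ∀ j < k, C j = carry op (a j) (b j) (C (j + 1))
  ok_eq : ∀ j < k, ok j = (ok (j + 1) || okStep op (b j))

theorem exists_backward {α : Type} (F : ℕ → α → α) (k : ℕ) : ∀ x : α,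
    ∃ C : ℕ → α, C k = x ∧ ∀ j < k, C j = F j (C (j + 1)) := by
  induction k with
  | zero => exact fun x => ⟨fun _ => x, rfl, fun j hj => absurd hj (by omega)⟩
  | succ k ih =>
    intro x
    obtain ⟨C, h1, h2⟩ := ih (F k x)
    refine ⟨Function.update C (k + 1) x, by simp, fun j hj => ?_⟩
    rw [Function.update_of_ne (by omega)]
    rcases Nat.lt_succ_iff_lt_or_eq.1 hj with h3 | rfl
    · rw [Function.update_of_ne (by omega), h2 j h3]
    · rw [Function.update_self, h1]

theorem exists_isPass (op : Symb) (a b : ℕ → Bool) (k : ℕ) (g : Bool) :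
    ∃ C ok, IsPass op a b k g C ok := by
  obtain ⟨C, h1, h2⟩ := exists_backward (fun j => carry op (a j) (b j)) k g
  obtain ⟨ok, h3, h4⟩ := exists_backward (fun j x => x || okStep op (b j)) k (okStart op g)
  exact ⟨C, ok, h1, h3, h2, h4⟩

/-- Exactly one guess `g` is confirmed by the pass, and it leads to the values `v`. -/
def Evaluates (op : Symb) (a b : ℕ → Bool) (s k : ℕ) (v : ℕ → Bool) : Prop :=
  ∃ g₀, ∀ g C ok, IsPass op a b k g C ok →
    ((C s = g ∧ ok s = true) ↔ g = g₀) ∧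
      (g = g₀ → ∀ j < k, value op (a j) (b j) (C (j + 1)) = v j)

theorem IsPass.ok_of_top {op : Symb} {a b : ℕ → Bool} {k : ℕ} {g : Bool} {C ok : ℕ → Bool}
    (h : IsPass op a b k g C ok) (h1 : okStart op g = true) (j : ℕ) (hj : j ≤ k) :
    ok j = true := by
  refine Nat.decreasingInduction (motive := fun j _ => ok j = true) (fun j hj ih => ?_)
    (h.ok_top.trans h1) hj
  rw [h.ok_eq j hj, ih, Bool.true_or]

theorem IsPass.ok_of_step {op : Symb} {a b : ℕ → Bool} {k : ℕ} {g : Bool} {C ok : ℕ → Bool}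
    (h : IsPass op a b k g C ok) {i j : ℕ} (hi : i < k) (h1 : okStep op (b i) = true)
    (hj : j ≤ i) : ok j = true := by
  refine Nat.decreasingInduction (motive := fun j _ => ok j = true) (fun j hj ih => ?_) ?_ hj
  · rw [h.ok_eq j (by omega), ih, Bool.true_or]
  · rw [h.ok_eq i hi, h1, Bool.or_true]

theorem IsPass.ok_cases {op : Symb} {a b : ℕ → Bool} {k : ℕ} {g : Bool} {C ok : ℕ → Bool}
    (h : IsPass op a b k g C ok) {j : ℕ} (hj : j ≤ k) (h1 : ok j = true) :
    okStart op g = true ∨ ∃ i, j ≤ i ∧ i < k ∧ okStep op (b i) = true := by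
  by_contra! h2
  have : ok j = false := by
    refine Nat.decreasingInduction (motive := fun i _ => j ≤ i → ok i = false)
      (fun i hi ih hji => ?_) (fun _ => ?_) hj le_rfl
    · rw [h.ok_eq i hi, ih (by omega), Bool.false_or]
      simpa using h2.2 i hji hi
    · rw [h.ok_top]; simpa using h2.1
  simp [this] at h1

theorem evaluates_of_carry_false {op : Symb} {a b v : ℕ → Bool} {s k : ℕ} (hs : s < k)
    (h1 : ∀ a b c, carry op a b c = false) (h2 : ∀ g, okStart op g = true)
    (h3 : ∀ j c, value op (a j) (b j) c = v j) : Evaluates op a b s k v := by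
  refine ⟨false, fun g C ok h => ⟨?_, fun _ j _ => h3 _ _⟩⟩
  rw [h.ok_of_top (h2 g) s hs.le, h.carry_eq s hs, h1]
  simp [eq_comm]

theorem evaluates_next {a b : ℕ → Bool} {s k : ℕ} (hs : s < k) (hb : b k = b s) :
    Evaluates .next a b s k (fun j => b (j + 1)) := by
  refine ⟨b k, fun g C ok h => ⟨?_, ?_⟩⟩
  · rw [h.ok_of_top rfl s hs.le, h.carry_eq s hs, hb]
    simp [carry, eq_comm]
  · rintro rfl j hj
    rcases Nat.lt_or_ge (j + 1) k with h1 | h1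
    · rw [h.carry_eq _ h1]; rfl
    · obtain rfl : k = j + 1 := by omega
      exact h.carry_top

theorem evaluates_untl {a b v : ℕ → Bool} {s k : ℕ} (hs : s < k)
    (hv : ∀ j, v j = (b j || (a j && v (j + 1)))) (hk : v k = v s)
    (h0 : (∀ j, s ≤ j → j < k → b j = false) → v s = false) : Evaluates .untl a b s k v := by
  have hcorrect : ∀ {g C ok}, IsPass .untl a b k g C ok → ∀ {i}, i ≤ k → C i = v i →
      ∀ j ≤ i, C j = v j := by
    intro g C ok h i hi h1 j hj
    refine Nat.decreasingInduction (motive := fun j _ => C j = v j) (fun j hj ih => ?_) h1 hj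
    rw [h.carry_eq j (by omega), hv, ih]; rfl
  refine ⟨v k, fun g C ok h => ⟨⟨fun ⟨h1, h2⟩ => ?_, ?_⟩, ?_⟩⟩
  · by_cases hb : ∃ j, s ≤ j ∧ j < k ∧ b j = true
    · obtain ⟨j, h3, h4, h5⟩ := hb
      have h6 : C j = v j := by rw [h.carry_eq j h4, hv, h5]; rfl
      rw [← h1, hcorrect h h4.le h6 s h3, hk]
    · have h3 : ∀ j, s ≤ j → j < k → b j = false := by
        intro j h4 h5
        by_contra h6
        exact hb ⟨j, h4, h5, by simpa using h6⟩
      rw [hk, h0 h3]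
      rcases h.ok_cases hs.le h2 with h4 | ⟨i, h4, h5, h6⟩
      · simpa [okStart] using h4
      · exact absurd ⟨i, h4, h5, h6⟩ hb
  · rintro rfl
    refine ⟨by rw [hcorrect h le_rfl h.carry_top s hs.le, hk], ?_⟩
    by_cases hb : ∃ j, s ≤ j ∧ j < k ∧ b j = true
    · obtain ⟨j, h3, h4, h5⟩ := hb
      exact h.ok_of_step h4 h5 h3
    · refine h.ok_of_top ?_ s hs.le
      rw [hk, h0]
      · rfl
      · intro j h4 h5
        by_contra h6
        exact hb ⟨j, h4, h5, by simpa using h6⟩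
  · rintro rfl j hj
    rw [hcorrect h le_rfl h.carry_top (j + 1) hj, hv j]; rfl

theorem evaluates_release {a b v : ℕ → Bool} {s k : ℕ} (hs : s < k)
    (hv : ∀ j, v j = (b j && (a j || v (j + 1)))) (hk : v k = v s)
    (h0 : (∀ j, s ≤ j → j < k → b j = true) → v s = true) : Evaluates .release a b s k v := by
  obtain ⟨g₀, h⟩ := evaluates_untl (a := fun j => !a j) (b := fun j => !b j) (v := fun j => !v j)
    hs (fun j => by simp [hv j]) (by simp [hk]) (fun h => by simpa using h0 (by simpa using h))
  refine ⟨!g₀, fun g C ok hp => ?_⟩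
  have hp' : IsPass .untl (fun j => !a j) (fun j => !b j) k (!g) (fun j => !C j) ok :=
    ⟨by simp [hp.carry_top], by simp [hp.ok_top, okStart],
      fun j hj => by simp [hp.carry_eq j hj, carry], fun j hj => by simp [hp.ok_eq j hj, okStep]⟩
  obtain ⟨h1, h2⟩ := h _ _ _ hp'
  constructor
  · rw [show (g = !g₀) ↔ ((!g) = g₀) by cases g <;> cases g₀ <;> simp, ← h1]
    simp
  · rintro rfl j hj
    have := h2 (by simp) j hj
    simp only [value] at this ⊢
    generalize a j = x at *
    generalize b j = y at *
    generalize C (j + 1) = z at *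
    generalize v j = w at *
    revert this
    revert x y z w
    decide

section Pass

variable {I U R P W V S A : List Symb} {N T : ℕ}

theorem pass_step {op : Symb} {a b : ℕ → Bool} {s k : ℕ} {g : Bool} {C ok : ℕ → Bool}
    (h : IsPass op a b k g C ok) {X : ℕ → List Symb}
    (hX : ∀ j < k, (X (j + 1)).head?.any isOne = a j ∧ (X (j + 1)).tail = X j) (j : ℕ) (hj : j < k)
    (hg : j = s → C s = g ∧ ok s = true)
    (h1 : CheckerCounts (.pass op g (C j) (ok j)) (stk I U R (row (fun j => j == s) j)
      (bit (j == s) :: P) W V (row b j ++ S) (bit (value op (a j) (b j) (C (j + 1))) :: A) (X j))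
      N T) :
    CheckerCounts (.pass op g (C (j + 1)) (ok (j + 1))) (stk I U R (row (fun j => j == s) (j + 1)) P
      W V (row b (j + 1) ++ S) A (X (j + 1))) N (T + 1) := by
  obtain ⟨h2, h3⟩ := hX j hj
  refine .step (o := ops [(.pos, .pop), (.pos', .push (bit (j == s))), (.rows, .pop), (.arg, .pop),
    (.aux, .push (bit (value op (a j) (b j) (C (j + 1)))))]) nofun ?_ ?_ h1
  · change (if isOne (bit (j == s)) &&
      !(carry op ((X (j + 1)).head?.any isOne) (isOne (bit (b j))) (C (j + 1)) == g &&
        (ok (j + 1) || okStep op (isOne (bit (b j))))) then [] else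
      [(CState.pass op g (carry op ((X (j + 1)).head?.any isOne) (isOne (bit (b j))) (C (j + 1)))
        (ok (j + 1) || okStep op (isOne (bit (b j)))), ops [(.pos, .pop),
          (.pos', .push (bit (j == s))), (.rows, .pop), (.arg, .pop), (.aux, .push (bit
            (value op ((X (j + 1)).head?.any isOne) (isOne (bit (b j))) (C (j + 1)))))])]) = _
    rw [isOne_bit, isOne_bit, h2, ← h.carry_eq j hj, ← h.ok_eq j hj, if_neg]
    by_cases h4 : j = s
    · subst h4
      simp [(hg rfl).1, (hg rfl).2]
    · simp [h4]
  · funext k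
    cases k <;> first | rfl | exact h3

theorem pass_loop {op : Symb} {a b v : ℕ → Bool} {s k : ℕ} {g : Bool} {C ok : ℕ → Bool}
    (h : IsPass op a b k g C ok) {X : ℕ → List Symb}
    (hX : ∀ j < k, (X (j + 1)).head?.any isOne = a j ∧ (X (j + 1)).tail = X j)
    (hg : C s = g ∧ ok s = true) (hv : ∀ j < k, value op (a j) (b j) (C (j + 1)) = v j) (j : ℕ)
    (hj : j ≤ k) : ∀ {P A},
    CheckerCounts .back (stk I U R [] ((row (fun j => j == s) j).reverse ++ P) W V S
      ((row v j).reverse ++ A) (X 0)) N T →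
    CheckerCounts (.pass op g (C j) (ok j)) (stk I U R (row (fun j => j == s) j) P W V
      (row b j ++ S) A (X j)) N (T + j + 1) := by
  induction j with
  | zero => exact fun h => .step nofun rfl (by funext k; cases k <;> rfl) h
  | succ j ih =>
    intro P A h1
    refine pass_step h hX j hj (fun _ => hg) (ih (by omega) ?_)
    simpa [row, hv j hj] using h1

theorem pass_dead {op : Symb} {a b : ℕ → Bool} {s k : ℕ} {g : Bool} {C ok : ℕ → Bool}
    (h : IsPass op a b k g C ok) {X : ℕ → List Symb}
    (hX : ∀ j < k, (X (j + 1)).head?.any isOne = a j ∧ (X (j + 1)).tail = X j)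
    (hg : ¬ (C s = g ∧ ok s = true)) (j : ℕ) (hsj : s < j) (hj : j ≤ k) : ∀ {P A},
    CheckerCounts (.pass op g (C j) (ok j)) (stk I U R (row (fun j => j == s) j) P W V
      (row b j ++ S) A (X j)) 0 (T + j) := by
  induction j, hsj using Nat.le_induction with
  | base =>
    intro P A
    refine .dead _ _ _ nofun ?_
    change (if isOne (bit (s == s)) &&
      !(carry op ((X (s + 1)).head?.any isOne) (isOne (bit (b s))) (C (s + 1)) == g &&
        (ok (s + 1) || okStep op (isOne (bit (b s))))) then [] else _) = []
    rw [isOne_bit, isOne_bit, (hX s hj).1, ← h.carry_eq s hj, ← h.ok_eq s hj, if_pos]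
    simpa [imp_iff_not_or] using hg
  | succ j hsj ih =>
    intro P A
    exact pass_step h hX j hj (fun h1 => absurd h1 (by omega)) (ih (by omega))

theorem pass_empty {op x : Symb} {g c ok : Bool} {M B : List Symb} :
    CheckerCounts (.pass op g c ok) (stk I U R (x :: M) P W V [] A B) 0 T :=
  .dead _ _ _ nofun rfl

theorem choose_empty {op x : Symb} {M B : List Symb} :
    CheckerCounts (.choose op) (stk I U R (x :: M) P W V [] A B) 0 (T + 1) :=
  .branch (N₁ := 0) (N₂ := 0) nofun rfl (Or.inl nofun) (by funext k; cases k <;> rfl)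
    (by funext k; cases k <;> rfl) pass_empty pass_empty

theorem choose_loop {op : Symb} {a b v : ℕ → Bool} {s k : ℕ} (hs : s < k)
    (h : Evaluates op a b s k v) {X : ℕ → List Symb}
    (hX : ∀ j < k, (X (j + 1)).head?.any isOne = a j ∧ (X (j + 1)).tail = X j) (hX0 : X 0 = [])
    (h1 : CheckerCounts .main (stk I U R (row (fun j => j == s) k) [] W V (row v k ++ S) [] [])
      N T) :
    CheckerCounts (.choose op) (stk I U R (row (fun j => j == s) k) [] W V (row b k ++ S) [] (X k))
      N (T + 2 * k + 3) := by
  obtain ⟨g₀, h⟩ := h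
  have hgood : ∀ g, g = g₀ → CheckerCounts (.pass op g g (okStart op g)) (stk I U R
      (row (fun j => j == s) k) [] W V (row b k ++ S) [] (X k)) N (T + 2 * k + 2) := by
    intro g hg
    obtain ⟨C, ok, hp⟩ := exists_isPass op a b k g
    obtain ⟨h2, h3⟩ := h g C ok hp
    have h4 := back_loop (I := I) (U := U) (R := R) (W := W) (V := V) (A := []) (B := []) (N := N)
      (T := T) (row (fun j => j == s) k).reverse (row v k).reverse (by simp) (M := []) (S := S)
      (by simpa using h1)
    have h5 := pass_loop (I := I) (U := U) (R := R) (W := W) (V := V) (S := S) hp hX (h2.2 hg)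
      (h3 hg) k le_rfl (P := []) (A := []) (by simpa [hX0] using h4)
    rw [hp.carry_top, hp.ok_top] at h5
    exact h5.mono (by omega)
  have hbad : ∀ g, g ≠ g₀ → CheckerCounts (.pass op g g (okStart op g)) (stk I U R
      (row (fun j => j == s) k) [] W V (row b k ++ S) [] (X k)) 0 (T + 2 * k + 2) := by
    intro g hg
    obtain ⟨C, ok, hp⟩ := exists_isPass op a b k g
    obtain ⟨h2, h3⟩ := h g C ok hp
    have h5 := pass_dead (I := I) (U := U) (R := R) (W := W) (V := V) (S := S) (T := T) hp hX
      (fun h => hg (h2.1 h)) k hs le_rfl (P := []) (A := [])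
    rw [hp.carry_top, hp.ok_top] at h5
    exact h5.mono (by omega)
  cases g₀ with
  | true =>
    exact .branch (N₁ := N) (N₂ := 0) nofun rfl (Or.inl nofun) (by funext k; cases k <;> rfl)
      (by funext k; cases k <;> rfl) (hgood true rfl) (hbad false nofun)
  | false =>
    rw [← zero_add N]
    exact .branch (N₁ := 0) (N₂ := N) nofun rfl (Or.inl nofun) (by funext k; cases k <;> rfl)
      (by funext k; cases k <;> rfl) (hbad true nofun) (hgood false rfl)

end Pass

end LTLCount

namespace LTLCount

/-! ## Truth values on ultimately periodic words -/

theorem LTL.satAt_congr {AP : Type} {σ σ' : ℕ → Set AP} (φ : LTL AP) : ∀ {i i' : ℕ},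
    (∀ d, σ (i + d) = σ' (i' + d)) → (φ.SatAt σ i ↔ φ.SatAt σ' i') := by
  induction φ with
  | tt => exact fun _ => Iff.rfl
  | atom p => intro i i' h; simp only [SatAt]; rw [show σ i = σ' i' from h 0]
  | neg φ ih => exact fun h => not_congr (ih h)
  | and φ ψ ih1 ih2 => exact fun h => and_congr (ih1 h) (ih2 h)
  | or φ ψ ih1 ih2 => exact fun h => or_congr (ih1 h) (ih2 h)
  | next φ ih =>
    intro i i' h
    exact ih fun d => by rw [add_assoc, h, add_assoc]
  | untl φ ψ ih1 ih2 =>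
    have key : ∀ {σ σ' : ℕ → Set AP} {i i' : ℕ},
        (∀ d, φ.SatAt σ (i + d) ↔ φ.SatAt σ' (i' + d)) →
        (∀ d, ψ.SatAt σ (i + d) ↔ ψ.SatAt σ' (i' + d)) →
        (φ.untl ψ).SatAt σ i → (φ.untl ψ).SatAt σ' i' := by
      rintro σ σ' i i' h1 h2 ⟨j, hj, h3, h4⟩
      obtain ⟨d, rfl⟩ := Nat.exists_eq_add_of_le hj
      refine ⟨i' + d, by omega, (h2 d).1 h3, fun l hl hl' => ?_⟩
      obtain ⟨e, rfl⟩ := Nat.exists_eq_add_of_le hl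
      exact (h1 e).1 (h4 _ (by omega) (by omega))
    intro i i' h
    have h1 := fun d => ih1 (i := i + d) (i' := i' + d) fun e => by rw [add_assoc, h, add_assoc]
    have h2 := fun d => ih2 (i := i + d) (i' := i' + d) fun e => by rw [add_assoc, h, add_assoc]
    exact ⟨key h1 h2, key (fun d => (h1 d).symm) (fun d => (h2 d).symm)⟩
  | release φ ψ ih1 ih2 =>
    have key : ∀ {σ σ' : ℕ → Set AP} {i i' : ℕ},
        (∀ d, φ.SatAt σ (i + d) ↔ φ.SatAt σ' (i' + d)) →
        (∀ d, ψ.SatAt σ (i + d) ↔ ψ.SatAt σ' (i' + d)) →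
        (φ.release ψ).SatAt σ i → (φ.release ψ).SatAt σ' i' := by
      intro σ σ' i i' h1 h2 h3 j hj
      obtain ⟨d, rfl⟩ := Nat.exists_eq_add_of_le hj
      rcases h3 (i + d) (by omega) with h4 | ⟨l, hl, hl', h4⟩
      · exact Or.inl ((h2 d).1 h4)
      · obtain ⟨e, rfl⟩ := Nat.exists_eq_add_of_le hl
        exact Or.inr ⟨i' + e, by omega, by omega, (h1 e).1 h4⟩
    intro i i' h
    have h1 := fun d => ih1 (i := i + d) (i' := i' + d) fun e => by rw [add_assoc, h, add_assoc]
    have h2 := fun d => ih2 (i := i + d) (i' := i' + d) fun e => by rw [add_assoc, h, add_assoc]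
    exact ⟨key h1 h2, key (fun d => (h1 d).symm) (fun d => (h2 d).symm)⟩

theorem LTL.satAt_untl_iff {AP : Type} {σ : ℕ → Set AP} {φ ψ : LTL AP} {i : ℕ} :
    (φ.untl ψ).SatAt σ i ↔ ψ.SatAt σ i ∨ (φ.SatAt σ i ∧ (φ.untl ψ).SatAt σ (i + 1)) := by
  constructor
  · rintro ⟨j, h1, h2, h3⟩
    rcases Nat.eq_or_lt_of_le h1 with rfl | h1
    · exact Or.inl h2
    · exact Or.inr ⟨h3 i le_rfl h1, j, h1, h2, fun l hl hl' => h3 l (by omega) hl'⟩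
  · rintro (h | ⟨h1, j, h2, h3, h4⟩)
    · exact ⟨i, le_rfl, h, fun l hl hl' => absurd hl (by omega)⟩
    · refine ⟨j, by omega, h3, fun l hl hl' => ?_⟩
      rcases Nat.eq_or_lt_of_le hl with rfl | hl
      · exact h1
      · exact h4 l hl hl'

theorem LTL.satAt_release_iff_not_untl {AP : Type} {σ : ℕ → Set AP} {φ ψ : LTL AP} {i : ℕ} :
    (φ.release ψ).SatAt σ i ↔ ¬ (φ.neg.untl ψ.neg).SatAt σ i := by
  simp only [SatAt]
  push Not
  refine forall_congr' fun j => forall_congr' fun _ => ?_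
  rw [or_iff_not_imp_left]

theorem LTL.satAt_release_iff {AP : Type} {σ : ℕ → Set AP} {φ ψ : LTL AP} {i : ℕ} :
    (φ.release ψ).SatAt σ i ↔ ψ.SatAt σ i ∧ (φ.SatAt σ i ∨ (φ.release ψ).SatAt σ (i + 1)) := by
  rw [satAt_release_iff_not_untl, satAt_release_iff_not_untl, satAt_untl_iff]
  generalize (φ.neg.untl ψ.neg).SatAt σ (i + 1) = x
  simp only [SatAt]
  tauto

/-- The word `σ` repeats its part between the positions `s` and `k`. -/
structure IsLasso {α : Type} (σ : ℕ → α) (s k : ℕ) : Prop where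
  lt : s < k
  periodic : ∀ i, s ≤ i → σ (i + (k - s)) = σ i

open Classical in
/-- The truth value of a formula at a position. -/
noncomputable def truth {AP : Type} (σ : ℕ → Set AP) (φ : LTL AP) (j : ℕ) : Bool :=
  decide (φ.SatAt σ j)

theorem truth_eq_true {AP : Type} {σ : ℕ → Set AP} {φ : LTL AP} {j : ℕ} :
    truth σ φ j = true ↔ φ.SatAt σ j := by
  simp [truth]

theorem truth_eq_false {AP : Type} {σ : ℕ → Set AP} {φ : LTL AP} {j : ℕ} :
    truth σ φ j = false ↔ ¬ φ.SatAt σ j := by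
  simp [truth]

section Lasso

variable {AP : Type} {σ : ℕ → Set AP} {s k : ℕ} (h : IsLasso σ s k)
include h

theorem IsLasso.satAt_add (φ : LTL AP) {i : ℕ} (hi : s ≤ i) :
    φ.SatAt σ (i + (k - s)) ↔ φ.SatAt σ i := by
  refine φ.satAt_congr fun d => ?_
  rw [← h.periodic (i + d) (by omega)]
  congr 1
  omega

theorem IsLasso.truth_eq (φ : LTL AP) : truth σ φ k = truth σ φ s := by
  have h1 := h.satAt_add φ le_rfl
  rw [Nat.add_sub_cancel' h.lt.le] at h1
  rw [Bool.eq_iff_iff, truth_eq_true, truth_eq_true, h1]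

theorem IsLasso.exists_satAt (φ : LTL AP) (i : ℕ) : ∀ {j : ℕ}, s ≤ j → j ≤ i →
    φ.SatAt σ j → ∃ j, s ≤ j ∧ j < k ∧ φ.SatAt σ j := by
  have := h.lt
  induction i with
  | zero => exact fun h1 h2 h3 => ⟨_, h1, by omega, h3⟩
  | succ i ih =>
    intro j h1 h2 h3
    rcases Nat.lt_or_ge j k with h4 | h4
    · exact ⟨j, h1, h4, h3⟩
    · refine ih (j := j - (k - s)) (by omega) (by omega) ?_
      rw [← h.satAt_add φ (by omega)]
      rwa [Nat.sub_add_cancel (by omega)]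

theorem IsLasso.evaluates_untl (φ ψ : LTL AP) :
    Evaluates .untl (truth σ φ) (truth σ ψ) s k (truth σ (φ.untl ψ)) := by
  refine LTLCount.evaluates_untl h.lt (fun j => ?_) (h.truth_eq _) fun h0 => ?_
  · rw [Bool.eq_iff_iff, Bool.or_eq_true, Bool.and_eq_true]
    simp only [truth_eq_true]
    exact LTL.satAt_untl_iff
  · by_contra h1
    rw [Bool.not_eq_false, truth_eq_true] at h1
    obtain ⟨j, h2, h3, -⟩ := h1
    obtain ⟨i, h4, h5, h6⟩ := h.exists_satAt ψ j h2 le_rfl h3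
    rw [← truth_eq_true, h0 i h4 h5] at h6
    simp at h6

theorem IsLasso.evaluates_release (φ ψ : LTL AP) :
    Evaluates .release (truth σ φ) (truth σ ψ) s k (truth σ (φ.release ψ)) := by
  refine LTLCount.evaluates_release h.lt (fun j => ?_) (h.truth_eq _) fun h0 => ?_
  · rw [Bool.eq_iff_iff, Bool.and_eq_true, Bool.or_eq_true]
    simp only [truth_eq_true]
    exact LTL.satAt_release_iff
  · rw [truth_eq_true, LTL.satAt_release_iff_not_untl]
    rintro ⟨j, h2, h3, -⟩
    obtain ⟨i, h4, h5, h6⟩ := h.exists_satAt ψ.neg j h2 le_rfl h3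
    exact h6 (truth_eq_true.1 (h0 i h4 h5))

theorem IsLasso.evaluates_next (a : ℕ → Bool) (φ : LTL AP) :
    Evaluates .next a (truth σ φ) s k (truth σ φ.next) :=
  LTLCount.evaluates_next h.lt (h.truth_eq φ)

theorem IsLasso.evaluates_neg (a : ℕ → Bool) (φ : LTL AP) :
    Evaluates .neg a (truth σ φ) s k (truth σ φ.neg) :=
  evaluates_of_carry_false h.lt (fun _ _ _ => rfl) (fun _ => rfl) fun j c => by
    rw [Bool.eq_iff_iff]
    simp [value, truth_eq_true, truth_eq_false, LTL.SatAt]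

theorem IsLasso.evaluates_and (φ ψ : LTL AP) :
    Evaluates .and (truth σ φ) (truth σ ψ) s k (truth σ (φ.and ψ)) :=
  evaluates_of_carry_false h.lt (fun _ _ _ => rfl) (fun _ => rfl) fun j c => by
    rw [Bool.eq_iff_iff]
    simp [value, truth_eq_true, LTL.SatAt]

theorem IsLasso.evaluates_or (φ ψ : LTL AP) :
    Evaluates .or (truth σ φ) (truth σ ψ) s k (truth σ (φ.or ψ)) :=
  evaluates_of_carry_false h.lt (fun _ _ _ => rfl) (fun _ => rfl) fun j c => by
    rw [Bool.eq_iff_iff]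
    simp [value, truth_eq_true, LTL.SatAt]

end Lasso

/-! ## Parsing from right to left -/

/-- Read the reversed word of a formula, given the formulas that have already been read (and the
number of ones that have been read, within an atom). -/
def parse (n : ℕ) : Option ℕ → List Symb → List (LTL (Fin n)) → Option (List (LTL (Fin n)))
  | none, [], fs => some fs
  | none, .tt :: ts, fs => parse n none ts (.tt :: fs)
  | none, .sep :: ts, fs => parse n (some 0) ts fs
  | none, .neg :: ts, φ :: fs => parse n none ts (φ.neg :: fs)
  | none, .next :: ts, φ :: fs => parse n none ts (φ.next :: fs)
  | none, .and :: ts, φ :: ψ :: fs => parse n none ts (φ.and ψ :: fs)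
  | none, .or :: ts, φ :: ψ :: fs => parse n none ts (φ.or ψ :: fs)
  | none, .untl :: ts, φ :: ψ :: fs => parse n none ts (φ.untl ψ :: fs)
  | none, .release :: ts, φ :: ψ :: fs => parse n none ts (φ.release ψ :: fs)
  | some i, .one :: ts, fs => if i < n then parse n (some (i + 1)) ts fs else none
  | some i, .atom :: ts, fs => if h : i < n then parse n none ts (.atom ⟨i, h⟩ :: fs) else none
  | _, _, _ => none

theorem parse_replicate {n : ℕ} {ts : List Symb} {fs : List (LTL (Fin n))} (j : ℕ) : ∀ {i : ℕ},
    i + j ≤ n → parse n (some i) (List.replicate j .one ++ ts) fs = parse n (some (i + j)) ts fs := by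
  induction j with
  | zero => exact fun _ => rfl
  | succ j ih =>
    intro i h
    rw [List.replicate_succ, List.cons_append, parse, if_pos (by omega), ih (by omega)]
    congr 2
    omega

theorem parse_encode {n : ℕ} (φ : LTL (Fin n)) : ∀ (ts : List Symb) (fs : List (LTL (Fin n))),
    parse n none (φ.encode.reverse ++ ts) fs = parse n none ts (φ :: fs) := by
  induction φ with
  | tt => exact fun ts fs => rfl
  | atom p =>
    intro ts fs
    simp only [LTL.encode, List.reverse_cons, List.reverse_append, List.reverse_replicate,
      List.append_assoc, List.reverse_nil, List.nil_append, List.cons_append]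
    rw [parse, parse_replicate _ (by omega), Nat.zero_add, parse, dif_pos p.2]
  | neg φ ih | next φ ih =>
    intro ts fs
    simp only [LTL.encode, List.reverse_cons, List.append_assoc, ih]
    rfl
  | and φ ψ ih1 ih2 | or φ ψ ih1 ih2 | untl φ ψ ih1 ih2 | release φ ψ ih1 ih2 =>
    intro ts fs
    simp only [LTL.encode, List.reverse_cons, List.reverse_append, List.append_assoc, ih1, ih2]
    rfl

theorem parse_sound {n : ℕ} (m : Option ℕ) (ts : List Symb) (fs gs : List (LTL (Fin n))) :
    parse n m ts fs = some gs → gs.flatMap LTL.encode = ts.reverse ++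
      (m.elim [] fun i => List.replicate i .one ++ [.sep]) ++ fs.flatMap LTL.encode := by
  induction m, ts, fs using parse.induct n with
  | case1 fs => intro h; simp only [parse, Option.some.injEq] at h; simp [h]
  | case10 i ts fs hi ih =>
    intro h
    rw [parse, if_pos hi] at h
    rw [ih h]
    simp [List.replicate_succ]
  | case11 i ts fs hi =>
    intro h
    rw [parse, if_neg hi] at h
    simp at h
  | case12 i ts fs hi ih =>
    intro h
    rw [parse, dif_pos hi] at h
    rw [ih h]
    simp [LTL.encode]
  | case13 i ts fs hi =>
    intro h
    rw [parse, dif_neg hi] at h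
    simp at h
  | case14 => intro h; simp_all [parse]
  | _ =>
    rename_i ih
    intro h
    rw [parse] at h
    rw [ih h]
    simp [LTL.encode]

end LTLCount

namespace LTLCount

/-! ## Evaluation of a formula by the machine -/

section Evaluation

variable {I U R P W V S A B : List Symb} {N T : ℕ}

theorem moveOut_empty {op x : Symb} {M : List Symb} :
    CheckerCounts (.moveOut op) (stk I U R (x :: M) P W V [] A B) 0 T :=
  .dead _ _ _ nofun rfl

variable {n s k : ℕ} {σ : ℕ → Set (Fin n)}

/-- The stack that holds the truth values of formulas. -/
noncomputable def valueStack (σ : ℕ → Set (Fin n)) (k : ℕ) (fs : List (LTL (Fin n))) :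
    List Symb :=
  fs.flatMap fun φ => row (truth σ φ) k

theorem valueStack_cons (φ : LTL (Fin n)) (fs : List (LTL (Fin n))) :
    valueStack σ k (φ :: fs) = row (truth σ φ) k ++ valueStack σ k fs := rfl

open Classical in
/-- The number of accepting runs, depending on the result of parsing. -/
noncomputable def outcome (σ : ℕ → Set (Fin n)) : Option (List (LTL (Fin n))) → ℕ
  | some [φ] => if φ.Sat σ then 1 else 0
  | _ => 0

theorem exists_row_cons (f : ℕ → Bool) (hk : 0 < k) : ∃ x l, row f k = x :: l := by
  obtain ⟨k, rfl⟩ := Nat.exists_eq_add_one.2 hk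
  exact ⟨_, _, rfl⟩

theorem unary_counts (h : IsLasso σ s k) (op : Symb) (c : LTL (Fin n) → LTL (Fin n))
    (hop : ∀ t : CStack → Option Symb, t .tok = some op →
      checker .main t = [(.choose op, ops [(.tok, .pop)])])
    (hc : ∀ φ, Evaluates op (fun _ => false) (truth σ φ) s k (truth σ (c φ))) (N : ℕ)
    (fs : List (LTL (Fin n))) (h0 : fs = [] → N = 0)
    (h1 : ∀ φ fs', fs = φ :: fs' → CheckerCounts .main (stk I U R (row (fun j => j == s) k) [] W V
      (valueStack σ k (c φ :: fs')) [] []) N T) :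
    CheckerCounts .main (stk I U (op :: R) (row (fun j => j == s) k) [] W V
      (valueStack σ k fs) [] []) N (T + 2 * k + 4) := by
  refine .step (S' := stk I U R (row (fun j => j == s) k) [] W V (valueStack σ k fs) [] [])
    (o := ops [(.tok, .pop)]) nofun (hop _ rfl) (by funext k; cases k <;> rfl) ?_
  match fs, h0, h1 with
  | [], h0, _ =>
    obtain ⟨x, l, hx⟩ := exists_row_cons (fun j => j == s) (by have := h.lt; omega : 0 < k)
    rw [h0 rfl, hx]
    exact choose_empty.mono (by omega : 0 + 1 ≤ _)
  | φ :: fs, _, h1 =>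
    exact choose_loop h.lt (hc φ) (X := fun _ => []) (fun j _ => ⟨rfl, rfl⟩) rfl (h1 φ fs rfl)

theorem binary_counts (h : IsLasso σ s k) (op : Symb)
    (c : LTL (Fin n) → LTL (Fin n) → LTL (Fin n))
    (hop : ∀ t : CStack → Option Symb, t .tok = some op →
      checker .main t = [(.moveOut op, ops [(.tok, .pop)])])
    (hc : ∀ φ ψ, Evaluates op (truth σ φ) (truth σ ψ) s k (truth σ (c φ ψ))) (N : ℕ)
    (fs : List (LTL (Fin n))) (h0 : fs.length < 2 → N = 0)
    (h1 : ∀ φ ψ fs', fs = φ :: ψ :: fs' → CheckerCounts .main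
      (stk I U R (row (fun j => j == s) k) [] W V (valueStack σ k (c φ ψ :: fs')) [] []) N T) :
    CheckerCounts .main (stk I U (op :: R) (row (fun j => j == s) k) [] W V
      (valueStack σ k fs) [] []) N (T + 4 * k + 6) := by
  refine .step (S' := stk I U R (row (fun j => j == s) k) [] W V (valueStack σ k fs) [] [])
    (o := ops [(.tok, .pop)]) nofun (hop _ rfl) (by funext k; cases k <;> rfl) ?_
  obtain ⟨x, l, hx⟩ := exists_row_cons (fun j => j == s) (by have := h.lt; omega : 0 < k)
  have hlx : l.length + 1 = k := by simpa using (congrArg List.length hx).symm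
  have hmove : ∀ {φ : LTL (Fin n)} {fs : List (LTL (Fin n))} {N : ℕ},
      CheckerCounts (.choose op) (stk I U R (row (fun j => j == s) k) [] W V (valueStack σ k fs) []
        (row (truth σ φ) k)) N (T + 2 * k + 3) →
      CheckerCounts (.moveOut op) (stk I U R (row (fun j => j == s) k) [] W V
        (valueStack σ k (φ :: fs)) [] []) N (T + 4 * k + 5) := by
    intro φ fs N h2
    have h3 := moveBack_loop (M := []) (A := []) (B := []) op (row (fun j => j == s) k).reverse
      (row (truth σ φ) k).reverse (by simp) (by simpa using h2)
    have h4 := moveOut_loop (P := []) (A := []) op (row (fun j => j == s) k)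
      (row (truth σ φ) k) (by simp) (by simpa using h3)
    exact h4.mono (by simp; omega)
  match fs, h0, h1 with
  | [], h0, _ =>
    rw [h0 (by simp), hx]
    exact moveOut_empty
  | [φ], h0, _ =>
    refine hmove ?_
    rw [h0 (by simp), hx]
    exact choose_empty.mono (by omega : 0 + 1 ≤ _)
  | φ :: ψ :: fs, _, h1 =>
    refine hmove (choose_loop h.lt (hc φ ψ) (X := row (truth σ φ)) (fun j _ => ⟨?_, rfl⟩) rfl
      (h1 φ ψ fs rfl))
    simp [row]

theorem final_counts (h : IsLasso σ s k) (fs : List (LTL (Fin n))) :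
    CheckerCounts .main (stk I U [] (row (fun j => j == s) k) [] W V (valueStack σ k fs) [] [])
      (outcome σ (some fs)) (k + 2) := by
  refine .step (S' := stk I U [] (row (fun j => j == s) k) [] W V (valueStack σ k fs) [] [])
    nofun rfl (by funext k; cases k <;> rfl) ?_
  obtain ⟨x, l, hx⟩ := exists_row_cons (fun j => j == s) (by have := h.lt; omega : 0 < k)
  match fs with
  | [] =>
    rw [hx]
    exact final_dead_short _ _ _
  | [φ] =>
    have h1 := final_loop (I := I) (U := U) (R := []) (P := []) (W := W) (V := V) (A := [])
      (B := []) (T := 0) (truth σ φ) (row (fun j => j == s) k) false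
    have h2 : (row (fun j => j == s) k) ≠ [] := by simp [hx]
    rw [row_length] at h1
    rw [valueStack_cons, valueStack, List.flatMap_nil, List.append_nil]
    refine Counts.mono ?_ (by omega : 0 + k + 1 ≤ _)
    convert h1 using 1
    rw [if_neg h2, outcome]
    by_cases h3 : φ.Sat σ
    · rw [if_pos h3, if_pos (truth_eq_true.2 h3)]
    · rw [if_neg h3, if_neg (mt truth_eq_true.1 h3)]
  | φ :: ψ :: fs =>
    obtain ⟨y, r, hy⟩ := exists_row_cons (truth σ ψ) (by have := h.lt; omega : 0 < k)
    rw [valueStack_cons, valueStack_cons, hy]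
    exact (final_dead_long (T := 0) _ _ _ (by simp) _).mono (by simp)

theorem checker_main_counts (h : IsLasso σ s k) {G : List (List Symb)} (hG : G.length = n)
    (hσ : ∀ i (hi : i < n), (G[i]'(hG ▸ hi)).reverse = row (truth σ (.atom ⟨i, hi⟩)) k)
    (R : List Symb) :
    (∀ fs, CheckerCounts .main (stk I U R (row (fun j => j == s) k) [] G.flatten []
      (valueStack σ k fs) [] []) (outcome σ (parse n none R fs))
        ((R.length + 1) * (n * k + 4 * k + 6))) ∧
    (∀ i ≤ n, ∀ fs, CheckerCounts .skip (stk I U R (row (fun j => j == s) k) []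
      (G.drop i).flatten (G.take i).flatten.reverse (valueStack σ k fs) [] [])
        (outcome σ (parse n (some i) R fs)) ((R.length + 1) * (n * k + 4 * k + 6))) := by
  have hlen : ∀ i (hi : i < n), (G[i]'(hG ▸ hi)).length = k := by
    intro i hi
    rw [← List.length_reverse, hσ i hi, row_length]
  obtain ⟨x, l, hx⟩ := exists_row_cons (fun j => j == s) (by have := h.lt; omega : 0 < k)
  have hlx : l.length + 1 = k := by simpa using (congrArg List.length hx).symm
  induction R with
  | nil =>
    refine ⟨fun fs => (final_counts h fs).mono ?_, fun i _ fs => .dead _ _ _ nofun rfl⟩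
    simp only [List.length_nil]
    omega
  | cons t R ih =>
    obtain ⟨ih1, ih2⟩ := ih
    set D := n * k + 4 * k + 6 with hD
    have hT : (R.length + 1) * D + D = ((t :: R).length + 1) * D := by
      simp only [List.length_cons]; ring
    rw [← hT]
    constructor
    · intro fs
      cases t with
      | one => exact .dead _ _ _ nofun rfl
      | atom => exact .dead _ _ _ nofun rfl
      | sep =>
        exact .step_le nofun rfl (by funext k; cases k <;> rfl) (ih2 0 (by omega) fs) (by omega)
      | tt =>
        have h1 := restore_loop (M := []) (row (fun j => j == s) k).reverse
          (by simpa using ih1 (.tt :: fs))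
        have h2 : row (truth σ (.tt : LTL (Fin n))) k =
            List.replicate (row (fun j => j == s) k).length .one := by
          rw [row_length]
          have h3 : ∀ j, truth σ (.tt : LTL (Fin n)) j = true := fun j => truth_eq_true.2 trivial
          clear hx hlx hσ ih1 ih2 h h1 hT hlen hD
          induction k with
          | zero => rfl
          | succ k ih => rw [row, ih, List.replicate_succ, h3]; rfl
        rw [valueStack_cons, h2] at h1
        have h3 := pushTrue_loop (P := []) (row (fun j => j == s) k) (by simpa using h1)
        refine .step_le nofun rfl (by funext k; cases k <;> rfl) h3 ?_
        simp
        omega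
      | neg =>
        refine (unary_counts h .neg LTL.neg (fun t ht => by simp only [checker, ht])
          (fun φ => h.evaluates_neg _ φ) _ fs ?_ ?_ (T := (R.length + 1) * D)).mono (by omega)
        · rintro rfl; rfl
        · rintro φ fs rfl; exact ih1 _
      | next =>
        refine (unary_counts h .next LTL.next (fun t ht => by simp only [checker, ht])
          (fun φ => h.evaluates_next _ φ) _ fs ?_ ?_ (T := (R.length + 1) * D)).mono (by omega)
        · rintro rfl; rfl
        · rintro φ fs rfl; exact ih1 _
      | and =>
        refine (binary_counts h .and LTL.and (fun t ht => by simp only [checker, ht])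
          (fun φ ψ => h.evaluates_and φ ψ) _ fs ?_ ?_ (T := (R.length + 1) * D)).mono (by omega)
        · rcases fs with _ | ⟨φ, _ | ⟨ψ, fs⟩⟩ <;> first | exact fun _ => rfl | simp
        · rintro φ ψ fs rfl; exact ih1 _
      | or =>
        refine (binary_counts h .or LTL.or (fun t ht => by simp only [checker, ht])
          (fun φ ψ => h.evaluates_or φ ψ) _ fs ?_ ?_ (T := (R.length + 1) * D)).mono (by omega)
        · rcases fs with _ | ⟨φ, _ | ⟨ψ, fs⟩⟩ <;> first | exact fun _ => rfl | simp
        · rintro φ ψ fs rfl; exact ih1 _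
      | untl =>
        refine (binary_counts h .untl LTL.untl (fun t ht => by simp only [checker, ht])
          (fun φ ψ => h.evaluates_untl φ ψ) _ fs ?_ ?_ (T := (R.length + 1) * D)).mono (by omega)
        · rcases fs with _ | ⟨φ, _ | ⟨ψ, fs⟩⟩ <;> first | exact fun _ => rfl | simp
        · rintro φ ψ fs rfl; exact ih1 _
      | release =>
        refine (binary_counts h .release LTL.release (fun t ht => by simp only [checker, ht])
          (fun φ ψ => h.evaluates_release φ ψ) _ fs ?_ ?_ (T := (R.length + 1) * D)).mono
            (by omega)
        · rcases fs with _ | ⟨φ, _ | ⟨ψ, fs⟩⟩ <;> first | exact fun _ => rfl | simp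
        · rintro φ ψ fs rfl; exact ih1 _
    · intro i hi fs
      have hdrop : ∀ hi : i < n, (G.drop i).flatten = G[i]'(hG ▸ hi) ++ (G.drop (i + 1)).flatten :=
        fun hi => by rw [List.drop_eq_getElem_cons (hG ▸ hi), List.flatten_cons]
      have htake : ∀ hi : i < n, (G.take (i + 1)).flatten.reverse =
          (G[i]'(hG ▸ hi)).reverse ++ (G.take i).flatten.reverse := fun hi => by
        rw [List.take_succ_eq_append_getElem (hG ▸ hi), List.flatten_append, List.flatten_singleton,
          List.reverse_append]
      have hend : ¬ i < n → (G.drop i).flatten = [] := fun hi => by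
        rw [List.drop_eq_nil_of_le (by omega)]; rfl
      cases t with
      | one =>
        refine .step_le (T := (R.length + 1) * D + D - 1)
          (S' := stk I U R (row (fun j => j == s) k) [] (G.drop i).flatten
            (G.take i).flatten.reverse (valueStack σ k fs) [] [])
          nofun rfl (by funext k; cases k <;> rfl) ?_ (by omega)
        by_cases hi : i < n
        · rw [parse, if_pos hi, hdrop hi]
          have h1 := skipBack_loop (M := []) (row (fun j => j == s) k).reverse
            (by simpa using ih2 (i + 1) (by omega) fs)
          rw [htake hi] at h1
          have h2 := skipRow_loop (P := []) (row (fun j => j == s) k) (G[i]'(hG ▸ hi))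
            (by simp [hlen i hi]) (by simpa using h1)
          refine h2.mono ?_
          simp
          omega
        · rw [parse, if_neg hi, hend hi, hx]
          exact skipRow_dead _ _
      | atom =>
        refine .step_le (T := (R.length + 1) * D + D - 1)
          (S' := stk I U R (row (fun j => j == s) k) [] (G.drop i).flatten
            (G.take i).flatten.reverse (valueStack σ k fs) [] [])
          nofun rfl (by funext k; cases k <;> rfl) ?_ (by omega)
        by_cases hi : i < n
        · rw [parse, dif_pos hi, hdrop hi]
          have h1 := restore_loop (M := []) (row (fun j => j == s) k).reverse
            (by simpa using ih1 (.atom ⟨i, hi⟩ :: fs))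
          have hsplit : G.flatten = (G.take (i + 1)).flatten ++ (G.drop (i + 1)).flatten := by
            rw [← List.flatten_append, List.take_append_drop]
          rw [hsplit, valueStack_cons] at h1
          have h2 := restoreWord_loop (G.take (i + 1)).flatten.reverse (by simpa using h1)
          rw [htake hi, ← hσ i hi] at h2
          have h3 := copyRow_loop (P := []) (row (fun j => j == s) k) (G[i]'(hG ▸ hi))
            (by simp [hlen i hi]) (by simpa using h2)
          refine h3.mono ?_
          have h4 : ((G[i]'(hG ▸ hi)).reverse ++ (G.take i).flatten.reverse).length ≤ n * k := by
            rw [← htake hi, List.length_reverse, List.length_flatten]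
            have h5 : ∀ x ∈ (G.take (i + 1)).map List.length, x ≤ k := by
              intro x hx
              obtain ⟨g, hg, rfl⟩ := List.mem_map.1 hx
              obtain ⟨j, hj, rfl⟩ := List.getElem_of_mem (List.mem_of_mem_take hg)
              exact (hlen j (hG ▸ hj)).le
            refine (List.sum_le_card_nsmul _ k h5).trans ?_
            rw [smul_eq_mul]
            refine Nat.mul_le_mul_right _ ?_
            simp
            omega
          simp only [List.length_append, List.length_reverse, List.length_flatten, List.map_take,
            row_length] at h4 ⊢
          omega
        · rw [parse, dif_neg hi, hend hi, hx]
          exact copyRow_dead _ _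
      | _ => exact .dead _ _ _ nofun rfl

end Evaluation

end LTLCount

namespace LTLCount

/-! ## Counting word-models is in #P -/

theorem coe_bitSum {F : List Bool → ℕ} {p : List Bool → Prop} [DecidablePred p]
    (hF : ∀ W, F W = if p W then 1 else 0) (j : ℕ) : ∀ W : List Bool,
    (bitSum F j W : ℕ∞) = {V | V.length = j + W.length ∧ W <:+ V ∧ p V}.encard := by
  induction j with
  | zero =>
    intro W
    have h : {V : List Bool | V.length = 0 + W.length ∧ W <:+ V ∧ p V} = {V | V = W ∧ p W} := by
      ext V
      constructor
      · rintro ⟨h1, h2, h3⟩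
        obtain rfl := h2.eq_of_length (by omega)
        exact ⟨rfl, h3⟩
      · rintro ⟨rfl, h3⟩
        exact ⟨(Nat.zero_add _).symm, List.suffix_rfl, h3⟩
    rw [h, bitSum, hF]
    by_cases hp : p W <;> simp [hp]
  | succ j ih =>
    intro W
    have h : {V : List Bool | V.length = j + 1 + W.length ∧ W <:+ V ∧ p V} =
        {V | V.length = j + (false :: W).length ∧ (false :: W) <:+ V ∧ p V} ∪
        {V | V.length = j + (true :: W).length ∧ (true :: W) <:+ V ∧ p V} := by
      ext V
      constructor
      · rintro ⟨h1, ⟨X, rfl⟩, h3⟩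
        obtain rfl | ⟨X, b, rfl⟩ := X.eq_nil_or_concat'
        · simp at h1
        · cases b
          · exact Or.inl ⟨by simp at h1 ⊢; omega, ⟨X, by simp⟩, h3⟩
          · exact Or.inr ⟨by simp at h1 ⊢; omega, ⟨X, by simp⟩, h3⟩
      · rintro (⟨h1, h2, h3⟩ | ⟨h1, h2, h3⟩)
        · exact ⟨by simp at h1; omega, (List.suffix_cons _ _).trans h2, h3⟩
        · exact ⟨by simp at h1; omega, (List.suffix_cons _ _).trans h2, h3⟩
    rw [h, Set.encard_union_eq, bitSum, Nat.cast_add, ih, ih]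
    rw [Set.disjoint_left]
    rintro V ⟨-, h2, -⟩ ⟨-, h3, -⟩
    have := (List.suffix_of_suffix_length_le h2 h3 (by simp)).eq_of_length (by simp)
    simp at this

theorem sum_encard_eq {α : Type} (A : ℕ → Set α) (k : ℕ) :
    ∑ s ∈ Finset.Ico 0 k, (A s).encard = {x : ℕ × α | x.1 < k ∧ x.2 ∈ A x.1}.encard := by
  induction k with
  | zero => simp
  | succ k ih =>
    have h : {x : ℕ × α | x.1 < k + 1 ∧ x.2 ∈ A x.1} =
        {x : ℕ × α | x.1 < k ∧ x.2 ∈ A x.1} ∪ Prod.mk k '' A k := by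
      ext ⟨s, a⟩
      simp only [Set.mem_ofPred_eq, Set.mem_union, Set.mem_image, Prod.mk.injEq]
      constructor
      · rintro ⟨h1, h2⟩
        rcases Nat.lt_succ_iff_lt_or_eq.1 h1 with h1 | rfl
        · exact Or.inl ⟨h1, h2⟩
        · exact Or.inr ⟨a, h2, rfl, rfl⟩
      · rintro (⟨h1, h2⟩ | ⟨b, h1, rfl, rfl⟩)
        · exact ⟨by omega, h2⟩
        · exact ⟨by omega, h1⟩
    rw [Finset.sum_Ico_succ_top (Nat.zero_le k), ih, h, Set.encard_union_eq,
      (Prod.mk_right_injective k).encard_image]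
    rw [Set.disjoint_left]
    rintro _ ⟨h1, -⟩ ⟨b, -, rfl⟩
    exact lt_irrefl _ h1

/-- The word over the sets of atomic propositions that is given by a list of bits. -/
def letters (n k : ℕ) (W : List Bool) : List (Set (Fin n)) :=
  (List.range k).map fun j => {p | W[p * k + j]? = some true}

theorem letters_length (n k : ℕ) (W : List Bool) : (letters n k W).length = k := by
  simp [letters]

theorem index_lt {n k p j : ℕ} (hp : p < n) (hj : j < k) : p * k + j < n * k :=
  calc p * k + j < p * k + k := by omega
    _ = (p + 1) * k := by ring
    _ ≤ n * k := Nat.mul_le_mul_right k hp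

theorem letters_injOn (n k : ℕ) : Set.InjOn (letters n k) {W | W.length = n * k} := by
  intro W hW V hV h
  have hW : W.length = n * k := hW
  have hV : V.length = n * k := hV
  refine List.ext_getElem (hW.trans hV.symm) fun i h1 h2 => ?_
  have hk : 0 < k := by
    rcases Nat.eq_zero_or_pos k with rfl | h
    · simp [hW] at h1
    · exact h
  have hi : i / k < n := (Nat.div_lt_iff_lt_mul hk).2 (hW ▸ h1)
  have h3 := congrArg (fun l => l[i % k]?) h
  simp only [letters, List.getElem?_map, List.getElem?_range (Nat.mod_lt i hk), Option.map_some,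
    Option.some.injEq] at h3
  have h4 := Set.ext_iff.1 h3 ⟨i / k, hi⟩
  simp only [Set.mem_ofPred_eq, Nat.div_add_mod', List.getElem?_eq_getElem h1,
    List.getElem?_eq_getElem h2, Option.some.injEq] at h4
  exact Bool.eq_iff_iff.2 h4

open Classical in
theorem exists_letters_eq {n k : ℕ} (l : List (Set (Fin n))) (hl : l.length = k) :
    ∃ W, W.length = n * k ∧ letters n k W = l := by
  refine ⟨(List.range (n * k)).map fun i => decide (∃ p : Fin n, p.val = i / k ∧
    p ∈ l.getD (i % k) ∅), by simp, List.ext_getElem (by simp [letters, hl]) fun j h1 h2 => ?_⟩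
  have hj : j < k := hl ▸ h2
  ext p
  have h3 := index_lt p.2 hj
  have h4 : (p.val * k + j) / k = p := by
    rw [Nat.mul_comm, Nat.mul_add_div (by omega), Nat.div_eq_of_lt hj, Nat.add_zero]
  have h5 : (p.val * k + j) % k = j := by
    rw [Nat.mul_comm, Nat.mul_add_mod, Nat.mod_eq_of_lt hj]
  simp only [letters, List.getElem_map, List.getElem_range, Set.mem_ofPred_eq, List.getElem?_map,
    List.getElem?_range h3, Option.map_some, Option.some.injEq, decide_eq_true_eq, h4, h5,
    List.getD_eq_getElem?_getD, List.getElem?_eq_getElem h2, Option.getD_some]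
  constructor
  · rintro ⟨q, hq, h6⟩
    rwa [← Fin.ext hq]
  · exact fun h6 => ⟨p, rfl, h6⟩

theorem encard_wordModels {n : ℕ} (φ : LTL (Fin n)) (k : ℕ) :
    {m | φ.IsWordModel k m}.encard = {x : ℕ × List Bool | x.1 < k ∧ x.2.length = n * k ∧
      φ.IsWordModel k ((letters n k x.2).take x.1, (letters n k x.2).drop x.1)}.encard := by
  have h : {m | φ.IsWordModel k m} = (fun x : ℕ × List Bool =>
      ((letters n k x.2).take x.1, (letters n k x.2).drop x.1)) '' {x : ℕ × List Bool | x.1 < k ∧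
        x.2.length = n * k ∧
        φ.IsWordModel k ((letters n k x.2).take x.1, (letters n k x.2).drop x.1)} := by
    ext ⟨u, v⟩
    constructor
    · intro h
      obtain ⟨h1, hv, -⟩ := id h
      simp only at h1 hv
      obtain ⟨W, hW, h2⟩ := exists_letters_eq (u ++ v) (by rw [List.length_append, h1])
      have hv' := List.length_pos_iff.2 hv
      refine ⟨(u.length, W), ⟨?_, hW, ?_⟩, ?_⟩
      · simp only; omega
      · simpa [h2] using h
      · simp [h2]
    · rintro ⟨x, ⟨-, -, h1⟩, h2⟩
      rw [← h2]
      exact h1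
  rw [h, Set.InjOn.encard_image]
  rintro ⟨s, W⟩ ⟨h1, h2, -⟩ ⟨t, V⟩ ⟨h3, h4, -⟩ h5
  simp only [Prod.mk.injEq] at h1 h3 h5 ⊢
  have h6 := congrArg List.length h5.1
  rw [List.length_take, List.length_take, letters_length, letters_length] at h6
  obtain rfl : s = t := by omega
  refine ⟨rfl, letters_injOn n k h2 h4 ?_⟩
  rw [← List.take_append_drop s (letters n k W), h5.1, h5.2, List.take_append_drop]

theorem isLasso_omegaWord {α : Type} (u v : List α) (hv : v ≠ []) :
    IsLasso (omegaWord u v hv) u.length (u.length + v.length) := by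
  have := List.length_pos_iff.2 hv
  refine ⟨by omega, fun i hi => ?_⟩
  have h1 : ¬ i + (u.length + v.length - u.length) < u.length := by omega
  simp only [omegaWord, dif_neg h1, dif_neg (by omega : ¬ i < u.length)]
  congr 1
  rw [show i + (u.length + v.length - u.length) - u.length = i - u.length + v.length by omega,
    Nat.add_mod_right]

theorem omegaWord_eq_getElem {α : Type} (u v : List α) (hv : v ≠ []) {i : ℕ}
    (hi : i < (u ++ v).length) : omegaWord u v hv i = (u ++ v)[i] := by
  rw [List.length_append] at hi
  unfold omegaWord
  split_ifs with h
  · rw [List.getElem_append_left h]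
  · rw [List.getElem_append_right (by omega)]
    congr 1
    exact Nat.mod_eq_of_lt (by omega)

theorem row_eq (f : ℕ → Bool) (k : ℕ) :
    row f k = ((List.range k).map fun j => bit (f j)).reverse := by
  induction k with
  | zero => rfl
  | succ k ih => simp [row, ih, List.range_succ]

theorem flatten_chunks {α : Type} (k n : ℕ) : ∀ W : List α, W.length = n * k →
    ((List.range n).map fun i => (W.drop (i * k)).take k).flatten = W := by
  induction n with
  | zero =>
    intro W hW
    rw [Nat.zero_mul] at hW
    rw [List.eq_nil_of_length_eq_zero hW]
    rfl
  | succ n ih =>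
    intro W hW
    have h := ih (W.drop k) (by rw [List.length_drop, hW, Nat.succ_mul]; omega)
    rw [List.range_succ_eq_map, List.map_cons, List.flatten_cons, List.map_map, Nat.zero_mul,
      List.drop_zero]
    conv_rhs => rw [← List.take_append_drop k W, ← h]
    congr 3
    funext i
    simp [List.drop_drop, Nat.succ_mul, Nat.add_comm]

theorem checker_main_counts_of_bits {n k s : ℕ} (hs : s < k) (W : List Bool) (hW : W.length = n * k)
    (R I : List Symb) (hv : (letters n k W).drop s ≠ []) :
    CheckerCounts .main
      (stk I [] R (row (fun j => j == s) k) [] (W.map bit) [] [] [] [])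
      (outcome (omegaWord ((letters n k W).take s) ((letters n k W).drop s) hv)
        (parse n none R [])) ((R.length + 1) * (n * k + 4 * k + 6)) := by
  have h := isLasso_omegaWord ((letters n k W).take s) _ hv
  have hlen := letters_length n k W
  rw [List.length_take, List.length_drop, hlen, Nat.min_eq_left hs.le,
    Nat.add_sub_cancel' hs.le] at h
  have h1 := (checker_main_counts (I := I) (U := []) h
    (G := (List.range n).map fun i => ((W.map bit).drop (i * k)).take k) (by simp) ?_ R).1 []
  · rwa [flatten_chunks k n (W.map bit) (by simpa using hW)] at h1
  · intro i hi
    rw [row_eq]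
    congr 1
    have hik : i * k + k ≤ n * k := by
      rw [← Nat.succ_mul]; exact Nat.mul_le_mul_right k hi
    refine List.ext_getElem (by simp [hW]; omega) fun j h1 h2 => ?_
    have hj : j < k := by simpa using h2
    have h3 := index_lt hi hj
    simp only [List.getElem_map, List.getElem_range, List.getElem_take, List.getElem_drop]
    congr 1
    rw [Bool.eq_iff_iff, truth_eq_true]
    simp only [LTL.SatAt]
    rw [omegaWord_eq_getElem _ _ hv (by simpa [hlen] using hj)]
    simp [letters, List.getElem?_eq_getElem (hW ▸ h3)]

theorem replicate_append_inj {α : Type} {x : α} {l l' : List α} (h : l.head? ≠ some x)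
    (h' : l'.head? ≠ some x) : ∀ {m n : ℕ},
    List.replicate m x ++ l = List.replicate n x ++ l' → m = n ∧ l = l'
  | 0, 0, e => ⟨rfl, e⟩
  | 0, n + 1, e => by
    rw [List.replicate_zero, List.nil_append] at e
    simp [e, List.replicate_succ] at h
  | m + 1, 0, e => by
    rw [List.replicate_zero, List.nil_append] at e
    simp [← e, List.replicate_succ] at h'
  | m + 1, n + 1, e => by
    rw [List.replicate_succ, List.replicate_succ, List.cons_append, List.cons_append,
      List.cons.injEq] at e
    obtain ⟨h1, h2⟩ := replicate_append_inj h h' e.2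
    exact ⟨by omega, h2⟩

theorem exists_replicate_append {α : Type} [DecidableEq α] (x : α) (l : List α) :
    ∃ n l', l = List.replicate n x ++ l' ∧ l'.head? ≠ some x := by
  induction l with
  | nil => exact ⟨0, [], rfl, nofun⟩
  | cons y l ih =>
    by_cases h : y = x
    · obtain ⟨n, l', h1, h2⟩ := ih
      exact ⟨n + 1, l', by rw [h, h1]; rfl, h2⟩
    · exact ⟨0, y :: l, rfl, by simpa using h⟩

theorem LTL.exists_encode_reverse {n : ℕ} (φ : LTL (Fin n)) :
    ∃ a l, φ.encode.reverse = a :: l ∧ a ≠ .one := by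
  induction φ with
  | tt => exact ⟨.tt, [], rfl, nofun⟩
  | atom p => exact ⟨.sep, _, by simp [encode]; rfl, nofun⟩
  | neg φ ih | next φ ih =>
    obtain ⟨a, l, h1, h2⟩ := ih
    exact ⟨a, l ++ [_], by rw [encode, List.reverse_cons, h1]; rfl, h2⟩
  | and φ ψ _ ih | or φ ψ _ ih | untl φ ψ _ ih | release φ ψ _ ih =>
    obtain ⟨a, l, h1, h2⟩ := ih
    exact ⟨a, l ++ φ.encode.reverse ++ [_], by
      rw [encode, List.reverse_cons, List.reverse_append, h1, List.cons_append]; rfl, h2⟩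

open Classical in
theorem sum_bitSum_eq {n k : ℕ} {R : List Symb} (hR : R.head? ≠ some .one) :
    ∑ s ∈ Finset.Ico 0 k, bitSum (fun W => if ∃ φ, parse n none R [] = some [φ] ∧
      φ.IsWordModel k ((letters n k W).take s, (letters n k W).drop s) then 1 else 0) (n * k) [] =
    countWordModelsUnary
      (List.replicate n .one ++ .sep :: (R.reverse ++ List.replicate k .one)) := by
  by_cases h : ∃ φ, parse n none R [] = some [φ]
  · obtain ⟨φ, h⟩ := h
    have h1 := parse_sound _ _ _ _ h
    simp only [List.flatMap_cons, List.flatMap_nil, List.append_nil, Option.elim_none] at h1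
    have h2 : List.replicate n Symb.one ++ .sep :: (R.reverse ++ List.replicate k .one) =
        Instance.encode ⟨n, φ, k⟩ := by rw [← h1]; rfl
    rw [h2, countWordModelsUnary, Instance.encode_injective.extend_apply]
    have h3 : ∀ (s : ℕ) (W : List Bool), (∃ ψ, parse n none R [] = some [ψ] ∧
        ψ.IsWordModel k ((letters n k W).take s, (letters n k W).drop s)) ↔
        φ.IsWordModel k ((letters n k W).take s, (letters n k W).drop s) := by
      intro s W
      simp [h]
    simp only [h3]
    rw [LTL.numWordModels, Set.ncard, encard_wordModels]
    have h4 := sum_encard_eq (fun s => {W : List Bool | W.length = n * k ∧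
      φ.IsWordModel k ((letters n k W).take s, (letters n k W).drop s)}) k
    simp only [Set.mem_ofPred_eq] at h4
    rw [← h4, ← ENat.toNat_natCast (∑ s ∈ _, _), Nat.cast_sum]
    congr 1
    refine Finset.sum_congr rfl fun s _ => ?_
    rw [coe_bitSum (fun W => rfl)]
    simp
  · have h1 : ∀ (s : ℕ) (W : List Bool), ¬ ∃ φ, parse n none R [] = some [φ] ∧
        φ.IsWordModel k ((letters n k W).take s, (letters n k W).drop s) :=
      fun s W ⟨φ, h2, _⟩ => h ⟨φ, h2⟩
    have h2 : ∀ (j : ℕ) (W : List Bool), bitSum (fun _ => 0) j W = 0 := by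
      intro j
      induction j with
      | zero => exact fun W => rfl
      | succ j ih => intro W; rw [bitSum, ih, ih]
    simp only [if_neg (h1 _ _), h2, Finset.sum_const_zero]
    rw [countWordModelsUnary, Function.extend_apply']
    rintro ⟨⟨m, φ, l⟩, h3⟩
    obtain ⟨h4, h5⟩ := replicate_one_sep_inj _ _ _ _ h3
    simp only at h4 h5
    subst h4
    have h6 := congrArg List.reverse h5
    rw [List.reverse_append, List.reverse_append, List.reverse_replicate, List.reverse_replicate,
      List.reverse_reverse] at h6
    obtain ⟨-, h7⟩ := replicate_append_inj (by
      obtain ⟨a, t, h8, h9⟩ := φ.exists_encode_reverse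
      simpa [h8] using h9) hR h6
    refine h ⟨φ, ?_⟩
    have h8 := parse_encode φ [] []
    rwa [List.append_nil, h7] at h8

open Classical in
theorem checker_counts (w : List Symb) :
    CheckerCounts .readNum (stk w [] [] [] [] [] [] [] [] []) (countWordModelsUnary w)
      ((w.length + 1) * (w.length * w.length + 4 * w.length + 6) +
        w.length * (2 * w.length + 3) + 3 * w.length + 10) := by
  obtain ⟨n, w', rfl, hw'⟩ := exists_replicate_append .one w
  have hdead : (∀ t, w' ≠ .sep :: t) → CheckerCounts .readNum
      (stk (List.replicate n .one ++ w') [] [] [] [] [] [] [] [] [])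
      (countWordModelsUnary (List.replicate n .one ++ w')) n := by
    intro h
    have h0 : countWordModelsUnary (List.replicate n .one ++ w') = 0 := by
      rw [countWordModelsUnary, Function.extend_apply']
      rintro ⟨x, hx⟩
      obtain ⟨-, h1⟩ := replicate_append_inj (by simp) hw' hx
      exact h _ h1.symm
    rw [h0]
    have h1 : ∀ (n : ℕ) (U : List Symb), CheckerCounts .readNum
        (stk (List.replicate n .one ++ w') U [] [] [] [] [] [] [] []) 0 n := by
      intro n
      induction n with
      | zero =>
        intro U
        refine .dead _ _ _ nofun ?_
        rcases w' with _ | ⟨a, w'⟩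
        · rfl
        · cases a <;> first | rfl | exact absurd rfl hw' | exact absurd rfl (h _)
      | succ n ih => exact fun U => .step nofun rfl (by funext k; cases k <;> rfl) (ih (.one :: U))
    exact h1 n []
  by_cases h : ∀ t, w' ≠ .sep :: t
  · exact (hdead h).mono (by simp; omega)
  push Not at h
  obtain ⟨t, rfl⟩ := h
  obtain ⟨k, R, hR, hR'⟩ := exists_replicate_append .one t.reverse
  obtain rfl : t = R.reverse ++ List.replicate k .one := by
    rw [← List.reverse_reverse t, hR]; simp
  rw [← sum_bitSum_eq hR']
  have h1 : ∀ s < k, CheckerCounts .guess (stk [] (List.replicate n .one) R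
      (row (fun j => j == s) k) [] [] [] [] [] []) _ _ := fun s hs =>
    guess_loop (n := n) (L := 0) (M := row (fun j => j == s) k) (R := R) (V := []) (S := [])
      (A := []) (B := []) (I := [])
      (F := fun W => if ∃ φ, parse n none R [] = some [φ] ∧
        φ.IsWordModel k ((letters n k W).take s, (letters n k W).drop s) then 1 else 0)
      (T := (R.length + 1) * (n * k + 4 * k + 6)) (fun W hW => by
        rw [Nat.zero_add, row_length] at hW
        have hv : (letters n k W).drop s ≠ [] := by
          rw [← List.length_pos_iff, List.length_drop, letters_length]; omega
        convert checker_main_counts_of_bits hs W hW R [] hv using 1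
        have hm : ∀ φ : LTL (Fin n),
            φ.IsWordModel k ((letters n k W).take s, (letters n k W).drop s) ↔
            φ.Sat (omegaWord ((letters n k W).take s) ((letters n k W).drop s) hv) := by
          intro φ
          simp only [LTL.IsWordModel, ← List.length_append, List.take_append_drop, letters_length,
            true_and]
          exact ⟨fun ⟨_, h⟩ => h, fun h => ⟨hv, h⟩⟩
        rcases parse n none R [] with _ | ⟨_ | ⟨φ, _ | ⟨ψ, fs⟩⟩⟩ <;> simp [outcome, hm]) [] rfl
  simp only [row_length] at h1
  have h2 := readBound_false_loop (I := []) (U := List.replicate n .one) (P := []) (W := [])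
    (V := []) (S := []) (A := []) (B := []) hR' k 0 (by simpa using h1)
  rw [Nat.zero_add, row] at h2
  have h3 := readNum_loop (U := []) (R := []) (M := []) (P := []) (W := []) (V := []) (S := [])
    (A := []) (B := []) (I := R.reverse ++ List.replicate k .one) n
    (rev_loop (R.reverse ++ List.replicate k .one) (R := [])
      (by rw [List.append_nil, List.append_nil, hR]; exact h2))
  refine h3.mono ?_
  simp only [List.length_append, List.length_replicate, List.length_cons, List.length_reverse]
  set L := n + (R.length + k + 1) with hL
  have b1 : (R.length + 1) * (n * k + 4 * k + 6) ≤ (L + 1) * (L * L + 4 * L + 6) := by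
    gcongr <;> omega
  have b2 : n * (2 * k + 3) ≤ L * (2 * L + 3) := by gcongr <;> omega
  omega

theorem inSharpP_countWordModelsUnary : InSharpP countWordModelsUnary := by
  refine inSharpP_of_counts checker .readNum .acc .inp _
    ((.X + 1) * (.X * .X + 4 * .X + 6) + .X * (2 * .X + 3) + 3 * .X + 10) fun w => ?_
  convert checker_counts w using 1
  · funext k
    cases k <;> rfl
  · simp

end LTLCount

namespace LTLCount

/-! ## Word generators and their implementation by Turing machines -/

open Turing TM2 Function

/-- Programs that write a word, with loops over the input. -/
inductive Gen (A B : Type) where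
  | emit (w : List B)
  | seq (g h : Gen A B)
  | foreach (f : A → Gen A B)

namespace Gen

variable {A B : Type}

/-- The word that a program writes. -/
def out : Gen A B → List A → List B
  | emit w, _ => w
  | seq g h, x => g.out x ++ h.out x
  | foreach f, x => x.flatMap fun a => (f a).out x

/-- The number of steps of the machine for a program. -/
def time : Gen A B → List A → ℕ
  | emit _, _ => 1
  | seq g h, x => h.time x + g.time x
  | foreach f, x => x.length + 1 + ((x.map fun a => 1 + (f a).time x).sum + 1)

/-- The nesting depth of the loops. -/
def depth [Fintype A] : Gen A B → ℕ
  | emit _ => 0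
  | seq g h => max g.depth h.depth
  | foreach f => (Finset.univ.sup fun a => (f a).depth) + 1

/-- The labels of the machine for a program. -/
def Lab : Gen A B → Type
  | emit _ => Unit
  | seq g h => g.Lab ⊕ h.Lab
  | foreach f => Bool ⊕ Σ a, (f a).Lab

theorem finite_lab [Finite A] (g : Gen A B) : Finite g.Lab := by
  induction g with
  | emit => exact inferInstanceAs (Finite Unit)
  | seq g h _ _ => exact inferInstanceAs (Finite (g.Lab ⊕ h.Lab))
  | foreach f _ => exact inferInstanceAs (Finite (Bool ⊕ Σ a, (f a).Lab))

/-- The label at which the execution of a program begins. Since words are written by pushing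
symbols on a stack, they are written backwards. -/
def entry : ∀ g : Gen A B, g.Lab
  | emit _ => ()
  | seq _ h => Sum.inr h.entry
  | foreach _ => Sum.inl false

/-- The stacks: for every level of nesting, a copy of the input and an auxiliary stack, and the
output. -/
abbrev Idx (D : ℕ) := Option (Fin (D + 1) × Bool)

/-- The stack alphabets. -/
abbrev Alph (A B : Type) (D : ℕ) : Idx D → Type
  | none => B
  | some _ => A

/-- The statements of the machine. -/
abbrev St (A B : Type) (D : ℕ) (Λ : Type) := TM2.Stmt (Alph A B D) Λ (Option A)

variable {D : ℕ} {Λ : Type}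

/-- The stack index of a level. -/
def lv (D j : ℕ) : Fin (D + 1) := Fin.ofNat (D + 1) j

theorem lv_ne {i j : ℕ} (hi : i ≤ D) (hj : j ≤ D) (h : i ≠ j) : lv D i ≠ lv D j := by
  intro e
  have := congrArg Fin.val e
  simp only [lv, Fin.val_ofNat, Nat.mod_eq_of_lt (by omega : i < D + 1),
    Nat.mod_eq_of_lt (by omega : j < D + 1)] at this
  exact h this

open Classical in
/-- Push the symbol that is held by the internal variable. -/
noncomputable def pushVar (i : Fin (D + 1) × Bool) (q : St A B D Λ) : St A B D Λ :=
  if h : Nonempty A then .push (some i) (fun v => v.getD h.some) q else q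

/-- Pop a symbol into the internal variable. -/
def popVar (i : Fin (D + 1) × Bool) (q : St A B D Λ) : St A B D Λ :=
  .pop (some i) (fun _ s => s) q

/-- The machine code of a program; `e` embeds its labels, and it ends at the label `exit`. -/
noncomputable def code : ∀ (g : Gen A B) (_j : ℕ) (_e : g.Lab → Λ) (_exit : Λ), g.Lab → St A B D Λ
  | emit w, _, _, exit, _ => w.foldl (fun q b => .push none (fun _ => b) q) (.goto fun _ => exit)
  | seq g _, j, e, exit, Sum.inl l => g.code j (fun l => e (Sum.inl l)) exit l
  | seq g h, j, e, _, Sum.inr l => h.code j (fun l => e (Sum.inr l)) (e (Sum.inl g.entry)) l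
  | foreach _, j, e, _, Sum.inl false => popVar (lv D j, false) (.branch Option.isSome
      (pushVar (lv D j, true) (.goto fun _ => e (Sum.inl false)))
      (.goto fun _ => e (Sum.inl true)))
  | foreach f, j, e, exit, Sum.inl true => popVar (lv D j, true) (.branch Option.isSome
      (pushVar (lv D j, false) (.goto fun v => v.elim exit fun a => e (Sum.inr ⟨a, (f a).entry⟩)))
      (.goto fun _ => exit))
  | foreach f, j, e, _, Sum.inr ⟨a, l⟩ =>
      (f a).code (j + 1) (fun l => e (Sum.inr ⟨a, l⟩)) (e (Sum.inl true)) l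

/-- The stacks with the given contents. -/
def stks (c t : Fin (D + 1) → List A) (o : List B) : ∀ k, List (Alph A B D k)
  | none => o
  | some (i, false) => c i
  | some (i, true) => t i

theorem update_none (c t : Fin (D + 1) → List A) (o o' : List B) :
    update (stks c t o) none o' = stks c t o' := by
  funext k
  rcases k with _ | ⟨i, _ | _⟩ <;> simp [stks]

theorem update_false (c t : Fin (D + 1) → List A) (o : List B) (i : Fin (D + 1)) (l : List A) :
    update (stks c t o) (some (i, false)) l = stks (update c i l) t o := by
  funext k
  rcases k with _ | ⟨i', _ | _⟩
  · simp [stks]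
  · by_cases h : i' = i
    · subst h; simp [stks]
    · rw [update_of_ne (by simp [h])]; simp [stks, h]
  · simp [stks]

theorem update_true (c t : Fin (D + 1) → List A) (o : List B) (i : Fin (D + 1)) (l : List A) :
    update (stks c t o) (some (i, true)) l = stks c (update t i l) o := by
  funext k
  rcases k with _ | ⟨i', _ | _⟩
  · simp [stks]
  · simp [stks]
  · by_cases h : i' = i
    · subst h; simp [stks]
    · rw [update_of_ne (by simp [h])]; simp [stks, h]

theorem stepAux_pushVar (i : Fin (D + 1) × Bool) (q : St A B D Λ) (a : A)
    (S : ∀ k, List (Alph A B D k)) :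
    stepAux (pushVar i q) (some a) S = stepAux q (some a) (update S (some i) (a :: S (some i))) := by
  rw [pushVar, dif_pos ⟨a⟩]
  rfl

/-- The machine makes `t` steps from the configuration `c` to the configuration `c'`. -/
def Reach (m : Λ → St A B D Λ) (t : ℕ) (c c' : TM2.Cfg (Alph A B D) Λ (Option A)) : Prop :=
  (flip bind (TM2.step m))^[t] (some c) = some c'

theorem Reach.trans {m : Λ → St A B D Λ} {s t : ℕ}
    {c c' c'' : TM2.Cfg (Alph A B D) Λ (Option A)} (h : Reach m s c c') (h' : Reach m t c' c'') :
    Reach m (s + t) c c'' := by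
  unfold Reach at *
  rw [Nat.add_comm s t, iterate_add_apply, h, h']

theorem Reach.one {m : Λ → St A B D Λ} {l : Λ} {q : St A B D Λ} (h : m l = q) (v : Option A)
    (S : ∀ k, List (Alph A B D k)) : Reach m 1 ⟨some l, v, S⟩ (stepAux q v S) := h ▸ rfl

theorem stepAux_pushes (v : Option A) (c t : Fin (D + 1) → List A) (w : List B) :
    ∀ (q : St A B D Λ) (o : List B),
    stepAux (w.foldl (fun q b => .push none (fun _ => b) q) q) v (stks c t o) =
      stepAux q v (stks c t (w ++ o)) := by
  induction w with
  | nil => exact fun _ _ => rfl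
  | cons b w ih =>
    intro q o
    rw [List.foldl_cons, ih, stepAux, update_none]
    rfl

theorem reach_code [Fintype A] {m : Λ → St A B D Λ} {x : List A} (g : Gen A B) :
    ∀ {j : ℕ} {e : g.Lab → Λ} {exit : Λ}, (∀ l, m (e l) = g.code j e exit l) →
    j + g.depth ≤ D + 1 → ∀ (v : Option A) (c t : Fin (D + 1) → List A) (o : List B),
    (∀ i, j ≤ i → i ≤ D → c (lv D i) = x ∧ t (lv D i) = []) →
    ∃ v', Reach m (g.time x) ⟨some (e g.entry), v, stks c t o⟩
      ⟨some exit, v', stks c t (g.out x ++ o)⟩ := by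
  induction g with
  | emit w =>
    intro j e exit hm _ v c t o _
    refine ⟨v, ?_⟩
    have h1 : m (e ()) = w.foldl (fun q b => .push none (fun _ => b) q) (.goto fun _ => exit) :=
      hm ()
    have h := Reach.one h1 v (stks c t o)
    rwa [stepAux_pushes] at h
  | seq g h ih1 ih2 =>
    intro j e exit hm hD v c t o hx
    simp only [depth] at hD
    obtain ⟨v1, h1⟩ := ih2 (fun l => hm (Sum.inr l)) (by omega) v c t o hx
    obtain ⟨v2, h2⟩ := ih1 (fun l => hm (Sum.inl l)) (by omega) v1 c t (h.out x ++ o) hx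
    refine ⟨v2, ?_⟩
    rw [out, List.append_assoc]
    exact h1.trans h2
  | foreach f ih =>
    intro j e exit hm hD v c t o hx
    simp only [depth] at hD
    have hj : j ≤ D := by omega
    have hf : ∀ a, j + 1 + (f a).depth ≤ D + 1 := fun a => by
      have := Finset.le_sup (f := fun a => (f a).depth) (Finset.mem_univ a)
      omega
    have m1 : m (e (Sum.inl false)) = popVar (lv D j, false) (.branch Option.isSome
      (pushVar (lv D j, true) (.goto fun _ => e (Sum.inl false)))
      (.goto fun _ => e (Sum.inl true))) := hm (Sum.inl false)
    have m2 : m (e (Sum.inl true)) = popVar (lv D j, true) (.branch Option.isSome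
      (pushVar (lv D j, false) (.goto fun v => v.elim exit fun a => e (Sum.inr ⟨a, (f a).entry⟩)))
      (.goto fun _ => exit)) := hm (Sum.inl true)
    have phase1 : ∀ (l r : List A) (v : Option A), Reach m (l.length + 1)
        ⟨some (e (Sum.inl false)), v, stks (update c (lv D j) l) (update t (lv D j) r) o⟩
        ⟨some (e (Sum.inl true)), none,
          stks (update c (lv D j) []) (update t (lv D j) (l.reverse ++ r)) o⟩ := by
      intro l
      induction l with
      | nil =>
        intro r v
        have h := Reach.one m1 v
          (stks (update c (lv D j) []) (update t (lv D j) r) o)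
        rw [popVar, stepAux, update_false] at h
        simpa [stks] using h
      | cons a l ih =>
        intro r v
        have h := Reach.one m1 v
          (stks (update c (lv D j) (a :: l)) (update t (lv D j) r) o)
        rw [popVar, stepAux, update_false] at h
        simp only [stks, update_self, List.head?_cons, stepAux, Option.isSome_some, cond_true,
          stepAux_pushVar, update_true, List.tail_cons, update_idem] at h
        have h' := h.trans (ih (a :: r) _)
        rw [List.reverse_cons, List.append_assoc]
        rwa [Nat.add_comm 1] at h'
    have phase2 : ∀ (l r : List A) (v : Option A) (o : List B), Reach m
        ((l.map fun a => 1 + (f a).time x).sum + 1)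
        ⟨some (e (Sum.inl true)), v, stks (update c (lv D j) r) (update t (lv D j) l) o⟩
        ⟨some exit, none, stks (update c (lv D j) (l.reverse ++ r)) (update t (lv D j) [])
          ((l.reverse.flatMap fun a => (f a).out x) ++ o)⟩ := by
      intro l
      induction l with
      | nil =>
        intro r v o
        have h := Reach.one m2 v
          (stks (update c (lv D j) r) (update t (lv D j) []) o)
        rw [popVar, stepAux, update_true] at h
        simpa [stks] using h
      | cons a l ih' =>
        intro r v o
        have h := Reach.one m2 v
          (stks (update c (lv D j) r) (update t (lv D j) (a :: l)) o)
        rw [popVar, stepAux, update_true] at h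
        simp only [stks, update_self, List.head?_cons, stepAux, Option.isSome_some, cond_true,
          stepAux_pushVar, update_false, List.tail_cons, update_idem, Option.elim_some] at h
        obtain ⟨v', h1⟩ := ih a (j := j + 1) (fun l => hm (Sum.inr ⟨a, l⟩)) (hf a) (some a)
          (update c (lv D j) (a :: r)) (update t (lv D j) l) o (fun i hi hi' => by
            have hne := lv_ne hi' hj (by omega : i ≠ j)
            rw [update_of_ne hne, update_of_ne hne]
            exact hx i (by omega) hi')
        have h2 := (h.trans h1).trans (ih' (a :: r) v' ((f a).out x ++ o))
        simpa [Nat.add_assoc] using h2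
    refine ⟨none, ?_⟩
    obtain ⟨hc, ht⟩ := hx j le_rfl hj
    have hc' : update c (lv D j) x = c := by rw [← hc, update_eq_self]
    have ht' : update t (lv D j) [] = t := by rw [← ht, update_eq_self]
    have h3 := (phase1 x [] v).trans (phase2 (x.reverse ++ []) [] none o)
    simp only [List.append_nil, List.reverse_reverse, List.map_reverse, List.sum_reverse, hc',
      ht'] at h3
    exact h3

theorem exists_time_le [Fintype A] (g : Gen A B) :
    ∃ p : Polynomial ℕ, ∀ x : List A, g.time x ≤ p.eval x.length := by
  induction g with
  | emit w => exact ⟨1, fun x => by simp [time]⟩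
  | seq g h ih1 ih2 =>
    obtain ⟨p, hp⟩ := ih1
    obtain ⟨q, hq⟩ := ih2
    exact ⟨q + p, fun x => by rw [Polynomial.eval_add]; exact add_le_add (hq x) (hp x)⟩
  | foreach f ih =>
    choose p hp using ih
    refine ⟨.X + 1 + (.X * (1 + ∑ a, p a) + 1), fun x => ?_⟩
    simp only [time, Polynomial.eval_add, Polynomial.eval_X, Polynomial.eval_one,
      Polynomial.eval_mul, Polynomial.eval_finsetSum]
    refine Nat.add_le_add_left (Nat.add_le_add_right ?_ 1) _
    have h := List.sum_le_card_nsmul (x.map fun a => 1 + (f a).time x)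
      (1 + ∑ a, (p a).eval x.length) (fun y hy => by
        obtain ⟨a, -, rfl⟩ := List.mem_map.1 hy
        exact Nat.add_le_add_left ((hp a x).trans
          (Finset.single_le_sum (f := fun a => (p a).eval x.length) (fun _ _ => Nat.zero_le _)
            (Finset.mem_univ a))) 1)
    simpa using h

/-- Push the symbol that is held by the internal variable on the input stacks of some levels. -/
noncomputable def pushAll (L : List (Fin (D + 1))) (q : St A B D Λ) : St A B D Λ :=
  L.foldr (fun i q => pushVar (i, false) q) q

/-- Remove the topmost symbols of the input stacks of some levels. -/
def popAll (L : List (Fin (D + 1))) (q : St A B D Λ) : St A B D Λ :=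
  L.foldr (fun i q => .pop (some (i, false)) (fun v _ => v) q) q

theorem stepAux_pushAll (q : St A B D Λ) (a : A) (t : Fin (D + 1) → List A) (o : List B)
    (L : List (Fin (D + 1))) : ∀ (c : Fin (D + 1) → List A), L.Nodup →
    stepAux (pushAll L q) (some a) (stks c t o) =
      stepAux q (some a) (stks (fun i => if i ∈ L then a :: c i else c i) t o) := by
  induction L with
  | nil => intro c _; simp [pushAll]
  | cons i L ih =>
    intro c hL
    rw [List.nodup_cons] at hL
    have h := ih (update c i (a :: c i)) hL.2
    rw [pushAll, List.foldr_cons, stepAux_pushVar, update_false]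
    refine h.trans ?_
    congr 2
    funext i'
    by_cases hi : i' = i
    · subst hi; simp [hL.1]
    · simp [hi]

theorem stepAux_popAll (q : St A B D Λ) (v : Option A) (t : Fin (D + 1) → List A) (o : List B)
    (L : List (Fin (D + 1))) : ∀ (c : Fin (D + 1) → List A), L.Nodup →
    stepAux (popAll L q) v (stks c t o) =
      stepAux q v (stks (fun i => if i ∈ L then (c i).tail else c i) t o) := by
  induction L with
  | nil => intro c _; simp [popAll]
  | cons i L ih =>
    intro c hL
    rw [List.nodup_cons] at hL
    have h := ih (update c i (c i).tail) hL.2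
    rw [popAll, List.foldr_cons, stepAux, update_false]
    refine h.trans ?_
    congr 2
    funext i'
    by_cases hi : i' = i
    · subst hi; simp [hL.1]
    · simp [hi]

/-- The statements of the machine for a program: copy the input, run the program, clean up. -/
noncomputable def machineCode [Fintype A] (g : Gen A B) :
    Fin 3 ⊕ g.Lab → St A B g.depth (Fin 3 ⊕ g.Lab)
  | Sum.inl 0 => popVar (0, false) (.branch Option.isSome
      (pushVar (0, true) (.goto fun _ => Sum.inl 0)) (.goto fun _ => Sum.inl 1))
  | Sum.inl 1 => popVar (0, true) (.branch Option.isSome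
      (pushAll (List.finRange _) (.goto fun _ => Sum.inl 1)) (.goto fun _ => Sum.inr g.entry))
  | Sum.inl 2 => .peek (some (0, false)) (fun _ s => s) (popAll (List.finRange _)
      (.branch Option.isSome (.goto fun _ => Sum.inl 2) .halt))
  | Sum.inr l => g.code 0 Sum.inr (Sum.inl 2) l

theorem reach_copy₁ [Fintype A] (g : Gen A B) (c : Fin (g.depth + 1) → List A) (l : List A) :
    ∀ (r : List A) (v : Option A), Reach g.machineCode (l.length + 1)
      ⟨some (Sum.inl 0), v, stks (update c 0 l) (update (fun _ => []) 0 r) []⟩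
      ⟨some (Sum.inl 1), none,
        stks (update c 0 []) (update (fun _ => []) 0 (l.reverse ++ r)) []⟩ := by
  induction l with
  | nil =>
    intro r v
    have h := Reach.one (machineCode.eq_1 g) v
      (stks (update c 0 []) (update (fun _ => []) 0 r) [])
    rw [popVar, stepAux, update_false] at h
    simpa [stks] using h
  | cons a l ih =>
    intro r v
    have h := Reach.one (machineCode.eq_1 g) v
      (stks (update c 0 (a :: l)) (update (fun _ => []) 0 r) [])
    rw [popVar, stepAux, update_false] at h
    simp only [stks, update_self, List.head?_cons, stepAux, Option.isSome_some, cond_true,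
      stepAux_pushVar, update_true, List.tail_cons, update_idem] at h
    have h' := h.trans (ih (a :: r) _)
    rw [List.reverse_cons, List.append_assoc]
    rwa [Nat.add_comm 1] at h'

theorem reach_copy₂ [Fintype A] (g : Gen A B) (l : List A) :
    ∀ (r : List A) (v : Option A), Reach g.machineCode (l.length + 1)
      ⟨some (Sum.inl 1), v, stks (fun _ => r) (update (fun _ => []) 0 l) []⟩
      ⟨some (Sum.inr g.entry), none, stks (fun _ => l.reverse ++ r) (fun _ => []) []⟩ := by
  induction l with
  | nil =>
    intro r v
    have h := Reach.one (machineCode.eq_2 g) v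
      (stks (fun _ => r) (update (fun _ => []) 0 []) [])
    rw [popVar, stepAux, update_true] at h
    have h0 : update (fun _ : Fin (g.depth + 1) => ([] : List A)) 0 [] = fun _ => [] :=
      update_eq_self 0 (fun _ : Fin (g.depth + 1) => ([] : List A))
    simpa [stks, h0] using h
  | cons a l ih =>
    intro r v
    have h := Reach.one (machineCode.eq_2 g) v
      (stks (fun _ => r) (update (fun _ => []) 0 (a :: l)) [])
    rw [popVar, stepAux, update_true] at h
    simp only [stks, update_self, List.head?_cons, stepAux, Option.isSome_some, cond_true,
      stepAux_pushAll _ _ _ _ _ _ (List.nodup_finRange _), List.tail_cons, update_idem,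
      List.mem_finRange, if_true] at h
    have h' := h.trans (ih (a :: r) _)
    rw [List.reverse_cons, List.append_assoc]
    rwa [Nat.add_comm 1] at h'

theorem reach_cleanUp [Fintype A] (g : Gen A B) (o : List B) (l : List A) :
    ∀ (v : Option A), Reach g.machineCode (l.length + 1)
      ⟨some (Sum.inl 2), v, stks (fun _ => l) (fun _ => []) o⟩
      ⟨none, none, stks (fun _ => []) (fun _ => []) o⟩ := by
  induction l with
  | nil =>
    intro v
    have h := Reach.one (machineCode.eq_3 g) v
      (stks (fun _ => []) (fun _ => []) o)
    simpa [stks, stepAux_popAll _ _ _ _ _ _ (List.nodup_finRange _)] using h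
  | cons a l ih =>
    intro v
    have h := Reach.one (machineCode.eq_3 g) v
      (stks (fun _ => a :: l) (fun _ => []) o)
    simp only [stks, List.head?_cons, stepAux, Option.isSome_some, cond_true,
      stepAux_popAll _ _ _ _ _ _ (List.nodup_finRange _), List.tail_cons,
      List.mem_finRange, if_true] at h
    have h' := h.trans (ih _)
    rwa [Nat.add_comm 1] at h'

theorem reach_machineCode [Fintype A] (g : Gen A B) (x : List A) :
    Reach g.machineCode (x.length + 1 + (x.length + 1) + g.time x + (x.length + 1))
      ⟨some (Sum.inl 0), none, stks (update (fun _ => []) 0 x) (fun _ => []) []⟩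
      ⟨none, none, stks (fun _ => []) (fun _ => []) (g.out x)⟩ := by
  have h0 : update (fun _ : Fin (g.depth + 1) => ([] : List A)) 0 [] = fun _ => [] :=
    update_eq_self 0 (fun _ : Fin (g.depth + 1) => ([] : List A))
  have h1 := reach_copy₁ g (fun _ => []) x [] none
  have h2 := reach_copy₂ g x.reverse [] none
  obtain ⟨v, h3⟩ := g.reach_code (m := g.machineCode) (x := x) (D := g.depth) (j := 0)
    (e := Sum.inr) (exit := Sum.inl 2) (fun l => rfl) (by omega) none (fun _ => x) (fun _ => []) []
    (fun i _ _ => ⟨rfl, rfl⟩)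
  have h4 := reach_cleanUp g (g.out x) x v
  simp only [h0, List.append_nil, List.reverse_reverse, List.length_reverse] at h1 h2 h3
  exact ((h1.trans h2).trans h3).trans h4

open Classical in
/-- The function that is computed by a program is computable in polynomial time. -/
theorem polyTimeComputable_out [Finite A] (g : Gen A B) : PolyTimeComputable g.out := by
  have := Fintype.ofFinite A
  have := g.finite_lab
  have := Fintype.ofFinite g.Lab
  obtain ⟨p, hp⟩ := g.exists_time_le
  let tm : FinTM2 :=
    { K := Idx g.depth
      k₀ := some (0, false)
      k₁ := none
      Γ := Alph A B g.depth
      Λ := Fin 3 ⊕ g.Lab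
      main := Sum.inl 0
      σ := Option A
      initialState := none
      Γk₀Fin := inferInstanceAs (Fintype A)
      m := g.machineCode }
  refine ⟨⟨⟨tm, Equiv.refl A, Equiv.refl B⟩, .X + 1 + (.X + 1) + p + (.X + 1), fun x =>
    ⟨⟨x.length + 1 + (x.length + 1) + g.time x + (x.length + 1), ?_⟩, ?_⟩⟩⟩
  · have h := reach_machineCode g x
    have hinit : initList tm (List.map (Equiv.refl A).invFun x) =
        ⟨some (Sum.inl 0), none, stks (update (fun _ => []) 0 x) (fun _ => []) []⟩ := by
      refine congrArg (TM2.Cfg.mk _ _) (funext fun k => ?_)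
      rcases k with _ | ⟨i, _ | _⟩
      · rfl
      · by_cases hi : i = 0
        · subst hi
          exact (List.map_id x).trans (update_self (0 : Fin (g.depth + 1)) x fun _ => []).symm
        · have h1 : ¬ (some (i, false) : Idx g.depth) = some (0, false) := by simp [hi]
          exact (dif_neg h1).trans (update_of_ne hi x fun _ => []).symm
      · have h1 : ¬ (some (i, true) : Idx g.depth) = some (0, false) := by simp
        exact dif_neg h1
    have hhalt : haltList tm (List.map (Equiv.refl B).invFun (g.out x)) =
        ⟨none, none, stks (fun _ => []) (fun _ => []) (g.out x)⟩ := by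
      refine congrArg (TM2.Cfg.mk _ _) (funext fun k => ?_)
      rcases k with _ | ⟨i, _ | _⟩
      · exact List.map_id _
      · rfl
      · rfl
    exact (congrArg (fun c => (flip bind tm.step)^[_] (some c)) hinit).trans
      (Eq.trans h (congrArg some hhalt.symm))
  · have := hp x
    simp
    omega

end Gen

end LTLCount

namespace LTLCount

/-! ## Words that can be generated in polynomial time -/

/-- The functions that are computed by generating programs. -/
def IsGen {A B : Type} (r : List A → List B) : Prop :=
  ∃ g : Gen A B, ∀ x, g.out x = r x

section

variable {A B : Type}

theorem IsGen.polyTimeComputable [Finite A] {r : List A → List B} (h : IsGen r) :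
    PolyTimeComputable r := by
  obtain ⟨g, hg⟩ := h
  rw [← funext hg]
  exact g.polyTimeComputable_out

theorem isGen_const (w : List B) : IsGen fun _ : List A => w :=
  ⟨.emit w, fun _ => rfl⟩

theorem IsGen.append {r s : List A → List B} (hr : IsGen r) (hs : IsGen s) :
    IsGen fun x => r x ++ s x := by
  obtain ⟨g, hg⟩ := hr
  obtain ⟨h, hh⟩ := hs
  exact ⟨.seq g h, fun x => congrArg₂ (· ++ ·) (hg x) (hh x)⟩

theorem IsGen.cons {r : List A → List B} (b : B) (hr : IsGen r) : IsGen fun x => b :: r x :=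
  (isGen_const [b]).append hr

theorem isGen_flatMap (f : A → List B) : IsGen fun x : List A => x.flatMap f :=
  ⟨.foreach fun a => .emit (f a), fun _ => rfl⟩

/-- The number of repetitions `f n` can be generated for inputs of length `n`. -/
def IsCount (A : Type) (f : ℕ → ℕ) : Prop :=
  ∀ ⦃B : Type⦄ ⦃r : List A → List B⦄, IsGen r →
    IsGen fun x => (List.replicate (f x.length) (r x)).flatten

theorem isCount_id : IsCount A fun n => n := by
  rintro B r ⟨g, hg⟩
  refine ⟨.foreach fun _ => g, fun x => ?_⟩
  change x.flatMap (fun _ => g.out x) = (List.replicate x.length (r x)).flatten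
  rw [← hg, ← List.map_const', List.flatMap_def]

theorem IsCount.add {f g : ℕ → ℕ} (hf : IsCount A f) (hg : IsCount A g) :
    IsCount A fun n => f n + g n := by
  intro B r hr
  simpa only [List.replicate_add, List.flatten_append] using (hf hr).append (hg hr)

theorem isCount_const (c : ℕ) : IsCount A fun _ => c := by
  induction c with
  | zero => exact fun B r _ => isGen_const []
  | succ c ih => exact ih.add fun B r hr => by simpa using hr

theorem flatten_replicate_mul {α : Type} (l : List α) (m n : ℕ) :
    (List.replicate (m * n) l).flatten =
      (List.replicate m (List.replicate n l).flatten).flatten := by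
  induction m with
  | zero => simp
  | succ m ih => rw [Nat.succ_mul, Nat.add_comm, List.replicate_add, List.flatten_append, ih]; rfl

theorem IsCount.mul {f g : ℕ → ℕ} (hf : IsCount A f) (hg : IsCount A g) :
    IsCount A fun n => f n * g n := by
  intro B r hr
  simpa only [flatten_replicate_mul] using hf (hg hr)

theorem isCount_eval (p : Polynomial ℕ) : IsCount A fun n => p.eval n := by
  induction p using Polynomial.induction_on with
  | C c => simpa using isCount_const c
  | add p q hp hq => simpa using hp.add hq
  | monomial n c h => simpa [pow_succ, mul_assoc] using h.mul isCount_id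

theorem IsCount.replicate {f : ℕ → ℕ} (hf : IsCount A f) (b : B) :
    IsGen fun x : List A => List.replicate (f x.length) b := by
  have h := hf (isGen_const [b])
  convert h using 2 with x
  rw [List.flatten_replicate_singleton]

end

/-! ## Formulas over finite alphabets -/

namespace LTL

/-- The disjunction of a list of formulas. -/
def disj {AP : Type} : List (LTL AP) → LTL AP
  | [] => .neg .tt
  | φ :: l => .or φ (disj l)

/-- The conjunction of a list of formulas. -/
def conj {AP : Type} : List (LTL AP) → LTL AP
  | [] => .tt
  | φ :: l => .and φ (conj l)

/-- The formula `φ` holds in `n` steps. -/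
def nexts {AP : Type} (n : ℕ) (φ : LTL AP) : LTL AP :=
  LTL.next^[n] φ

/-- The formula `φ` holds from now on. -/
def always {AP : Type} (φ : LTL AP) : LTL AP :=
  .release (.neg .tt) φ

/-- The formulas of a list hold one after the other. -/
def sequence {AP : Type} : List (LTL AP) → LTL AP
  | [] => .tt
  | φ :: l => .and φ (.next (sequence l))

section

variable {AP : Type} {σ : ℕ → Set AP} {i : ℕ}

theorem satAt_disj {l : List (LTL AP)} : (disj l).SatAt σ i ↔ ∃ φ ∈ l, φ.SatAt σ i := by
  induction l with
  | nil => simp [disj, SatAt]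
  | cons φ l ih => simp [disj, SatAt, ih]

theorem satAt_conj {l : List (LTL AP)} : (conj l).SatAt σ i ↔ ∀ φ ∈ l, φ.SatAt σ i := by
  induction l with
  | nil => simp [conj, SatAt]
  | cons φ l ih => simp [conj, SatAt, ih]

theorem satAt_nexts {φ : LTL AP} (n : ℕ) : (nexts n φ).SatAt σ i ↔ φ.SatAt σ (i + n) := by
  induction n generalizing i with
  | zero => rfl
  | succ n ih =>
    rw [nexts, Function.iterate_succ_apply', SatAt, ← nexts, ih, Nat.add_right_comm, Nat.add_assoc]

theorem satAt_always {φ : LTL AP} : (always φ).SatAt σ i ↔ ∀ j, i ≤ j → φ.SatAt σ j := by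
  simp [always, SatAt]

theorem satAt_sequence {l : List (LTL AP)} :
    (sequence l).SatAt σ i ↔ ∀ j (hj : j < l.length), l[j].SatAt σ (i + j) := by
  induction l generalizing i with
  | nil => simp [sequence, SatAt]
  | cons φ l ih =>
    rw [sequence, SatAt, SatAt, ih]
    constructor
    · rintro ⟨h1, h2⟩ (_ | j) hj
      · exact h1
      · have := h2 j (by simpa using hj)
        rwa [Nat.add_assoc, Nat.add_comm 1] at this
    · refine fun h => ⟨h 0 (by simp), fun j hj => ?_⟩
      have := h (j + 1) (by simpa using hj)
      rwa [Nat.add_assoc, Nat.add_comm 1]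

open Classical in
/-- The present letter is the singleton of `a`. -/
noncomputable def letter [Fintype AP] (a : AP) : LTL AP :=
  .and (.atom a) (conj ((Finset.univ.erase a).toList.map fun b => .neg (.atom b)))

theorem satAt_letter [Fintype AP] {a : AP} : (letter a).SatAt σ i ↔ σ i = {a} := by
  classical
  simp only [letter, SatAt, satAt_conj, List.forall_mem_map, Finset.mem_toList, Finset.mem_erase,
    Finset.mem_univ, and_true, Set.eq_singleton_iff_unique_mem]
  refine and_congr_right fun _ => forall_congr' fun b => ?_
  tauto

end

theorem encode_nexts {c : ℕ} (φ : LTL (Fin c)) (n : ℕ) :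
    (nexts n φ).encode = List.replicate n .next ++ φ.encode := by
  induction n with
  | zero => rfl
  | succ n ih =>
    rw [nexts, Function.iterate_succ_apply', encode, ← nexts, ih]
    rfl

theorem encode_sequence {c : ℕ} (l : List (LTL (Fin c))) :
    (sequence l).encode = l.flatMap (fun φ => .and :: (φ.encode ++ [.next])) ++ [.tt] := by
  induction l with
  | nil => rfl
  | cons φ l ih => simp [sequence, encode, ih]

theorem isGen_encode_nexts {A : Type} {c : ℕ} {φ : List A → LTL (Fin c)}
    (hφ : IsGen fun x => (φ x).encode) {f : ℕ → ℕ} (hf : IsCount A f) :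
    IsGen fun x => (nexts (f x.length) (φ x)).encode := by
  simpa only [encode_nexts] using (hf.replicate Symb.next).append hφ

theorem isGen_encode_disj {A ι : Type} {c : ℕ} (l : List ι) {φ : ι → List A → LTL (Fin c)}
    (hφ : ∀ i, IsGen fun x => (φ i x).encode) :
    IsGen fun x => (disj (l.map fun i => φ i x)).encode := by
  induction l with
  | nil => exact isGen_const _
  | cons i l ih => exact ((hφ i).append ih).cons _

end LTL

end LTLCount

namespace LTLCount

/-! ## Words that are given by local constraints -/

/-- The infinite word `l` starts with `z`, its windows (four consecutive letters and the one at
distance `d`) satisfy `W`, and it consists of the letter `pad` after the position `m`. -/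
structure IsTiling {Λ : Type} (z : List Λ) (W : Λ → Λ → Λ → Λ → Λ → Prop) (pad : Λ) (d m : ℕ)
    (l : ℕ → Λ) : Prop where
  init : ∀ i (h : i < z.length), l i = z[i]
  window : ∀ i, W (l i) (l (i + 1)) (l (i + 2)) (l (i + 3)) (l (i + d))
  ne_pad : l m ≠ pad
  eq_pad : l (m + 1) = pad

section

variable {Λ : Type} {c : ℕ} (e : Λ ≃ Fin c) (W : Λ → Λ → Λ → Λ → Λ → Prop) (pad : Λ)

/-- The formula that describes a window. -/
noncomputable def windowFormula (d : ℕ) (q : Λ × Λ × Λ × Λ × Λ) : LTL (Fin c) :=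
  .and (.sequence [.letter (e q.1), .letter (e q.2.1), .letter (e q.2.2.1), .letter (e q.2.2.2.1)])
    (.nexts d (.letter (e q.2.2.2.2)))

theorem satAt_windowFormula {d : ℕ} {q : Λ × Λ × Λ × Λ × Λ} {σ : ℕ → Set (Fin c)} {i : ℕ} :
    (windowFormula e d q).SatAt σ i ↔ σ i = {e q.1} ∧ σ (i + 1) = {e q.2.1} ∧
      σ (i + 2) = {e q.2.2.1} ∧ σ (i + 3) = {e q.2.2.2.1} ∧ σ (i + d) = {e q.2.2.2.2} := by
  simp [windowFormula, LTL.sequence, LTL.SatAt, LTL.satAt_letter, LTL.satAt_nexts, Nat.add_assoc,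
    and_assoc]

open Classical in
/-- The windows that satisfy `W`. -/
noncomputable def windows (e : Λ ≃ Fin c) : List (Λ × Λ × Λ × Λ × Λ) :=
  letI := Fintype.ofEquiv _ e.symm
  (Finset.univ.filter fun q : Λ × Λ × Λ × Λ × Λ =>
    W q.1 q.2.1 q.2.2.1 q.2.2.2.1 q.2.2.2.2).toList

theorem mem_windows {q : Λ × Λ × Λ × Λ × Λ} :
    q ∈ windows W e ↔ W q.1 q.2.1 q.2.2.1 q.2.2.2.1 q.2.2.2.2 := by
  simp [windows]

/-- The formula that describes the words with the given constraints. -/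
noncomputable def tilingFormula (z : List Λ) (d m : ℕ) : LTL (Fin c) :=
  .and (.sequence (z.map fun a => .letter (e a)))
    (.and (.always (.disj ((windows W e).map fun q => windowFormula e d q)))
      (.nexts m (.and (.neg (.letter (e pad))) (.next (.letter (e pad))))))

theorem sat_tilingFormula {z : List Λ} {d m : ℕ} {σ : ℕ → Set (Fin c)} :
    (tilingFormula e W pad z d m).Sat σ ↔
      ∃ l, (fun i => {e (l i)}) = σ ∧ IsTiling z W pad d m l := by
  simp only [LTL.Sat, tilingFormula, LTL.SatAt, LTL.satAt_sequence, LTL.satAt_always,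
    LTL.satAt_disj, LTL.satAt_nexts, LTL.satAt_letter, mem_windows,
    satAt_windowFormula, List.getElem_map, List.length_map, Nat.zero_add, Nat.zero_le,
    forall_const, List.mem_map, exists_exists_and_eq_and]
  constructor
  · rintro ⟨h1, h2, h3, h4⟩
    have h5 : ∀ i, ∃ a, σ i = {e a} := fun i => by
      obtain ⟨q, -, h, -⟩ := h2 i
      exact ⟨_, h⟩
    choose l hl using h5
    obtain rfl : (fun i => {e (l i)}) = σ := funext fun i => (hl i).symm
    simp only [Set.singleton_eq_singleton_iff, EmbeddingLike.apply_eq_iff_eq] at h1 h2 h3 h4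
    refine ⟨l, rfl, h1, fun i => ?_, h3, h4⟩
    obtain ⟨⟨a, a', a'', a''', b⟩, h, h5, h6, h7, h8, h9⟩ := h2 i
    rw [h5, h6, h7, h8, h9]
    exact h
  · rintro ⟨l, rfl, h⟩
    simp only [Set.singleton_eq_singleton_iff, EmbeddingLike.apply_eq_iff_eq]
    exact ⟨h.init, fun i => ⟨(_, _, _, _, _), h.window i, rfl, rfl, rfl, rfl, rfl⟩, h.ne_pad,
      h.eq_pad⟩

variable {e W pad}

theorem IsTiling.eq_pad_of_lt (hW : ∀ b u v w, W pad b u v w → b = pad) {z : List Λ}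
    {d m : ℕ} {l : ℕ → Λ} (h : IsTiling z W pad d m l) (i : ℕ) (hi : m < i) : l i = pad := by
  induction i, hi using Nat.le_induction with
  | base => exact h.eq_pad
  | succ i _ ih =>
    exact hW _ _ _ _ (ih ▸ h.window i)

theorem numWordModels_tilingFormula (hW : ∀ b u v w, W pad b u v w → b = pad) (z : List Λ)
    (d m : ℕ) : (tilingFormula e W pad z d m).numWordModels (m + 2) =
      {l | IsTiling z W pad d m l}.ncard := by
  have himage : {x | (tilingFormula e W pad z d m).IsWordModel (m + 2) x} =
      (fun l : ℕ → Λ => ((List.range (m + 1)).map fun i => ({e (l i)} : Set (Fin c)),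
        [({e pad} : Set (Fin c))])) '' {l | IsTiling z W pad d m l} := by
    ext ⟨u, v⟩
    constructor
    · rintro ⟨h1, hv, h2⟩
      simp only at h1 hv h2
      obtain ⟨l, h3, h4⟩ := (sat_tilingFormula e W pad).1 h2
      have h5 := List.length_pos_iff.2 hv
      have h6 : v.length = 1 := by
        by_contra h6
        have h7 := (isLasso_omegaWord u v hv).periodic m (by omega)
        rw [← h3] at h7
        simp only [Nat.add_sub_cancel_left, Set.singleton_eq_singleton_iff,
          EmbeddingLike.apply_eq_iff_eq] at h7
        rw [h4.eq_pad_of_lt hW _ (by omega)] at h7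
        exact h4.ne_pad h7.symm
      have h7 : ∀ i (hi : i < (u ++ v).length), {e (l i)} = (u ++ v)[i] := fun i hi => by
        rw [← omegaWord_eq_getElem u v hv hi, ← h3]
      refine ⟨l, h4, Prod.ext (List.ext_getElem (by simp; omega) fun i h8 (h9 : i < u.length) => ?_)
        (List.ext_getElem (by simp [h6]) fun i h8 (h9 : i < v.length) => ?_)⟩
      · simp only [List.getElem_map, List.getElem_range]
        rw [h7 i (by rw [List.length_append]; omega), List.getElem_append_left h9]
      · have h10 : i = 0 := by omega
        have h11 := h7 (m + 1) (by rw [List.length_append]; omega)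
        rw [h4.eq_pad, List.getElem_append_right (by omega)] at h11
        subst h10
        simp only [List.getElem_cons_zero, h11]
        congr 1
        omega
    · rintro ⟨l, h, h1⟩
      simp only [Prod.mk.injEq] at h1
      obtain ⟨rfl, rfl⟩ := h1
      refine ⟨by simp, by simp, (sat_tilingFormula e W pad).2 ⟨l, funext fun i => ?_, h⟩⟩
      unfold omegaWord
      split_ifs with hi
      · simp
      · rw [h.eq_pad_of_lt hW i (by simpa using hi)]
        simp [Nat.mod_one]
  rw [LTL.numWordModels, himage, Set.InjOn.ncard_image]
  intro l h l' h' heq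
  funext i
  simp only [Prod.mk.injEq, and_true] at heq
  by_cases hi : i < m + 1
  · have h1 := List.map_inj_left.1 heq i (List.mem_range.2 hi)
    simpa using h1
  · rw [IsTiling.eq_pad_of_lt hW h i (by omega), IsTiling.eq_pad_of_lt hW h' i (by omega)]

/-- The instances that describe words with local constraints can be generated. -/
theorem isGen_encode_tilingFormula {A : Type} {z : List A → List Λ}
    (hz : ∀ f : Λ → List Symb, IsGen fun x => (z x).flatMap f) {d m : ℕ → ℕ} (hd : IsCount A d)
    (hm : IsCount A m) : IsGen fun x => Instance.encode
      ⟨c, tilingFormula e W pad (z x) (d x.length) (m x.length), m x.length + 2⟩ := by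
  simp only [Instance.encode, tilingFormula, LTL.encode, LTL.always]
  refine (isGen_const _).append (.cons _ (.append (.cons _ (.append ?_ (.cons _ (.append ?_ ?_))))
    ((hm.add (isCount_const 2)).replicate Symb.one)))
  · simp only [LTL.encode_sequence, List.flatMap_map]
    exact (hz _).append (isGen_const _)
  · refine (IsGen.append (isGen_const _) ?_).cons _
    refine LTL.isGen_encode_disj _ fun q => .cons _ (.append (isGen_const _) ?_)
    exact LTL.isGen_encode_nexts (φ := fun _ => _) (isGen_const _) hd
  · exact LTL.isGen_encode_nexts (φ := fun _ => _) (isGen_const _) hm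

end

end LTLCount

namespace LTLCount

/-! ## Accepting runs as sequences of transitions -/

namespace NTM

variable {A : Type} (M : NTM A)

/-- A transition of a machine: new state, symbols written, head movements. -/
abbrev Transition : Type := M.Q × (M.K → M.Γ) × (M.K → Move)

open Classical in
/-- The possible transitions, where accepting configurations are repeated. -/
noncomputable def transitions (q : M.Q) (r : M.K → M.Γ) : Set M.Transition :=
  if q ∈ M.accept then {(q, r, fun _ => .stay)} else M.δ q r

variable {M}

theorem Cfg.apply_injective (c : M.Cfg) : Function.Injective c.apply := by
  rintro ⟨q, w, m⟩ ⟨q', w', m'⟩ h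
  have h1 : q = q' := congrArg Cfg.state h
  have h2 : w = w' := funext fun k => by
    have := congrFun (congrFun (congrArg Cfg.tape h) k) (c.head k)
    simpa [apply] using this
  have h3 : m = m' := funext fun k => by
    have := congrFun (congrArg Cfg.head h) k
    simp only [apply, add_right_inj] at this
    generalize m k = a at *
    generalize m' k = b at *
    cases a <;> cases b <;> first | rfl | simp [Move.offset] at this
  rw [h1, h2, h3]

theorem Cfg.apply_stay (c : M.Cfg) : c.apply (c.state, c.read, fun _ => .stay) = c := by
  ext k
  · rfl
  · exact add_zero _
  · simp [apply, read]

/-- The transitions lead from a configuration to an accepting one. -/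
def IsScript : M.Cfg → List M.Transition → Prop
  | c, [] => c.state ∈ M.accept
  | c, t :: ts => t ∈ M.transitions c.state c.read ∧ IsScript (c.apply t) ts

open Classical in
/-- The run with the given transitions, up to the first accepting configuration. -/
noncomputable def runOf : M.Cfg → List M.Transition → List M.Cfg
  | c, [] => [c]
  | c, t :: ts => if c.state ∈ M.accept then [c] else c :: runOf (c.apply t) ts

theorem runOf_of_accept {c : M.Cfg} (h : c.state ∈ M.accept) (ts : List M.Transition) :
    runOf c ts = [c] := by
  cases ts <;> simp [runOf, h]

theorem head?_runOf (c : M.Cfg) (ts : List M.Transition) : (runOf c ts).head? = some c := by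
  cases ts
  · rfl
  · rw [runOf]; split_ifs <;> rfl

theorem runOf_spec (ts : List M.Transition) : ∀ {c : M.Cfg}, IsScript c ts →
    (runOf c ts).IsChain M.Step ∧ ∃ c', (runOf c ts).getLast? = some c' ∧ c'.state ∈ M.accept := by
  induction ts with
  | nil => exact fun {c} h => ⟨.singleton c, c, rfl, h⟩
  | cons t ts ih =>
    intro c h
    by_cases hc : c.state ∈ M.accept
    · rw [runOf_of_accept hc]
      exact ⟨.singleton c, c, rfl, hc⟩
    · obtain ⟨h1, h2⟩ := h
      obtain ⟨h3, c', h4, h5⟩ := ih h2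
      rw [transitions, if_neg hc] at h1
      rw [runOf, if_neg hc]
      refine ⟨List.isChain_cons.2 ⟨fun d hd => ?_, h3⟩, c', ?_, h5⟩
      · rw [head?_runOf, Option.mem_some] at hd
        exact ⟨hc, t, h1, hd.symm⟩
      · rw [List.getLast?_cons, h4]
        rfl

theorem runOf_inj (ts : List M.Transition) : ∀ {ts' : List M.Transition} {c : M.Cfg},
    ts.length = ts'.length → IsScript c ts → IsScript c ts' → runOf c ts = runOf c ts' →
    ts = ts' := by
  induction ts with
  | nil => exact fun h _ _ _ => (List.eq_nil_of_length_eq_zero h.symm).symm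
  | cons t ts ih =>
    rintro (_ | ⟨t', ts'⟩) c h ⟨h1, h2⟩ h3 h4
    · simp at h
    obtain ⟨h5, h6⟩ := h3
    have h7 : t = t' ∧ runOf (c.apply t) ts = runOf (c.apply t') ts' := by
      by_cases hc : c.state ∈ M.accept
      · rw [transitions, if_pos hc] at h1 h5
        rw [Set.mem_singleton_iff] at h1 h5
        rw [h1, h5, Cfg.apply_stay, runOf_of_accept hc, runOf_of_accept hc]
        exact ⟨rfl, rfl⟩
      · rw [runOf, runOf, if_neg hc, if_neg hc, List.cons.injEq] at h4
        have h8 := congrArg List.head? h4.2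
        rw [head?_runOf, head?_runOf, Option.some_inj] at h8
        exact ⟨c.apply_injective h8, h4.2⟩
    obtain ⟨rfl, h7⟩ := h7
    rw [ih (by simpa using h) h2 h6 h7]

theorem exists_runOf_eq (T : ℕ) : ∀ {c : M.Cfg} {ρ : List M.Cfg}, ρ.length ≤ T + 1 →
    ρ.head? = some c → ρ.IsChain M.Step → (∃ c', ρ.getLast? = some c' ∧ c'.state ∈ M.accept) →
    ∃ ts, (ts.length = T ∧ IsScript c ts) ∧ runOf c ts = ρ := by
  induction T with
  | zero =>
    rintro c (_ | ⟨c₀, _ | ⟨c₁, ρ⟩⟩) h1 h2 h3 ⟨c', h4, h5⟩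
    · simp at h2
    · simp only [List.head?_cons, Option.some_inj, List.getLast?_singleton] at h2 h4
      subst h2 h4
      exact ⟨[], ⟨rfl, h5⟩, rfl⟩
    · simp at h1
  | succ T ih =>
    rintro c (_ | ⟨c₀, _ | ⟨c₁, ρ⟩⟩) h1 h2 h3 ⟨c', h4, h5⟩
    · simp at h2
    · simp only [List.head?_cons, Option.some_inj, List.getLast?_singleton] at h2 h4
      subst h2 h4
      obtain ⟨ts, ⟨h6, h7⟩, h8⟩ := ih (c := c₀) (ρ := [c₀]) (by simp) rfl (.singleton _)
        ⟨c₀, rfl, h5⟩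
      refine ⟨(c₀.state, c₀.read, fun _ => .stay) :: ts, ⟨by simp [h6], ?_, ?_⟩, ?_⟩
      · rw [transitions, if_pos h5]; rfl
      · rwa [Cfg.apply_stay]
      · rw [runOf, if_pos h5]
    · simp only [List.head?_cons, Option.some_inj] at h2
      subst h2
      rw [List.isChain_cons_cons] at h3
      obtain ⟨⟨hc, t, ht, rfl⟩, h3⟩ := h3
      obtain ⟨ts, ⟨h6, h7⟩, h8⟩ := ih (by simpa using h1) rfl h3 ⟨c', by simpa using h4, h5⟩
      refine ⟨t :: ts, ⟨by simp [h6], ?_, h7⟩, ?_⟩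
      · rwa [transitions, if_neg hc]
      · rw [runOf, if_neg hc, h8]

/-- The accepting runs are counted by the sequences of transitions. -/
theorem numAcceptingRuns_eq {w : List A} {T : ℕ} (hT : ∀ ρ, M.IsRun w ρ → ρ.length ≤ T + 1) :
    M.numAcceptingRuns w = {ts | ts.length = T ∧ IsScript (M.init w) ts}.ncard := by
  have h : {ρ | M.IsAcceptingRun w ρ} =
      runOf (M.init w) '' {ts | ts.length = T ∧ IsScript (M.init w) ts} := by
    ext ρ
    constructor
    · rintro ⟨h1, h2⟩
      exact exists_runOf_eq T (hT ρ h1) h1.1 h1.2 h2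
    · rintro ⟨ts, ⟨-, h1⟩, rfl⟩
      obtain ⟨h2, h3⟩ := runOf_spec ts h1
      exact ⟨⟨head?_runOf _ _, h2⟩, h3⟩
  rw [numAcceptingRuns, h, Set.InjOn.ncard_image]
  rintro ts ⟨h1, h2⟩ ts' ⟨h3, h4⟩ h5
  exact runOf_inj ts (h1.trans h3.symm) h2 h4 h5

end NTM

end LTLCount

namespace LTLCount

namespace NTM

/-! ## Computation tableaux -/

variable {A : Type} (M : NTM A)

/-- A cell of a row of a tableau. A row describes the contents of the tapes relative to the
positions of the heads; it carries the transition that has led to it. -/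
@[ext]
structure Cell where
  /-- the cell is the first one of a row -/
  start : Bool
  /-- the next cell is the one under the heads -/
  pre : Bool
  /-- the transition of the row -/
  tr : M.Transition
  /-- the symbols on the tapes -/
  sym : M.K → M.Γ

instance : Finite Move :=
  Finite.of_injective
    (fun m : Move => match m with | .left => (0 : Fin 3) | .stay => 1 | .right => 2)
    (by rintro ⟨⟩ ⟨⟩ h <;> first | rfl | simp at h)

instance : Finite M.Cell :=
  Finite.of_injective (fun c : M.Cell => (c.start, c.pre, c.tr, c.sym)) fun c d h => by
    simp only [Prod.mk.injEq] at h
    exact Cell.ext h.1 h.2.1 h.2.2.1 h.2.2.2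

variable {M}

/-- The symbol in the cell `b` with left neighbour `a` after writing. -/
def Cell.written (a b : M.Cell) (t : M.Transition) (k : M.K) : M.Γ :=
  if a.pre then t.2.1 k else b.sym k

/-- The symbol in the cell below `b` after writing and moving the heads. -/
def Cell.moved (a' a b c : M.Cell) (t : M.Transition) (k : M.K) : M.Γ :=
  match t.2.2 k with
  | .left => Cell.written a' a t k
  | .stay => Cell.written a b t k
  | .right => Cell.written b c t k

/-- The local constraints on a tableau, where `y` is the cell below `x₂`. -/
structure Window (x₀ x₁ x₂ x₃ y : Option M.Cell) : Prop where
  eq_none : x₀ = none → x₁ = none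
  tr_eq : ∀ a b, x₀ = some a → x₁ = some b → b.start = false → b.tr = a.tr
  below : ∀ a' a b c d, x₀ = some a' → x₁ = some a → x₂ = some b → x₃ = some c → y = some d →
    d.start = b.start ∧ d.pre = b.pre ∧ d.sym = Cell.moved a' a b c d.tr
  step : ∀ a b d, x₁ = some a → x₂ = some b → y = some d → a.pre = true →
    d.tr ∈ M.transitions b.tr.1 b.sym
  accept : ∀ a b, x₁ = some a → x₂ = some b → y = none → a.pre = true → b.tr.1 ∈ M.accept

section

variable (x : List A) (T : ℕ)

/-- The number of cells of a row. -/
def width : ℕ := 2 * T + x.length + 3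

/-- The transition of the first row. -/
def startTransition : M.Transition :=
  (M.start, fun _ => M.blank, fun _ => .stay)

/-- The symbols in the first row. -/
def startSym (s : ℕ) (k : M.K) : M.Γ :=
  if k = M.inputTape ∧ T + 4 ≤ s then (x[s - (T + 4)]?).elim M.blank M.symb else M.blank

/-- The cells of the first row. -/
def startCell (s : ℕ) : M.Cell :=
  ⟨decide (s = 2), decide (s = T + 3), startTransition, startSym x T s⟩

variable (ts : List M.Transition)

/-- The transition at a position of the tableau. -/
def trAt (s : ℕ) : M.Transition :=
  ((startTransition :: ts)[(s - 2) / width x T]?).getD startTransition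

/-- The positions before the heads. -/
def preAt (s : ℕ) : Bool :=
  decide (2 ≤ s ∧ (s - 2) % width x T = T + 1)

/-- The symbols at a position of the tableau. -/
def symAt (s : ℕ) (k : M.K) : M.Γ :=
  if _h : s < width x T + 2 then startSym x T s k
  else
    have : 3 ≤ width x T := Nat.le_add_left 3 _
    match (trAt x T ts s).2.2 k with
    | .left => if preAt x T (s - width x T - 2) then (trAt x T ts s).2.1 k
      else symAt (s - width x T - 1) k
    | .stay => if preAt x T (s - width x T - 1) then (trAt x T ts s).2.1 k
      else symAt (s - width x T) k
    | .right => if preAt x T (s - width x T) then (trAt x T ts s).2.1 k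
      else symAt (s - width x T + 1) k
termination_by s

/-- The cell at a position of the tableau. -/
def cellAt (s : ℕ) : M.Cell :=
  ⟨decide (2 ≤ s ∧ (s - 2) % width x T = 0), preAt x T s, trAt x T ts s, symAt x T ts s⟩

/-- The tableau with the given transitions. -/
def tableau (s : ℕ) : Option M.Cell :=
  if s < (T + 1) * width x T + 2 then some (cellAt x T ts s) else none

theorem width_eq : width x T = 2 * T + x.length + 3 := rfl

variable {x T ts}

theorem cellAt_of_lt {s : ℕ} (hs : s < width x T + 2) : cellAt x T ts s = startCell x T s := by
  have hw := width_eq x T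
  have h : s - 2 < width x T := by omega
  refine Cell.ext ?_ ?_ ?_ (funext fun k => ?_)
  · simp only [cellAt, startCell, Nat.mod_eq_of_lt h]
    rw [Bool.eq_iff_iff, decide_eq_true_eq, decide_eq_true_eq]
    omega
  · simp only [cellAt, startCell, preAt, Nat.mod_eq_of_lt h]
    rw [Bool.eq_iff_iff, decide_eq_true_eq, decide_eq_true_eq]
    omega
  · simp [cellAt, startCell, trAt, Nat.div_eq_of_lt h]
  · simp only [cellAt, startCell]
    rw [symAt, dif_pos hs]

theorem sym_cellAt_add (s : ℕ) : (cellAt x T ts (s + (width x T + 2))).sym =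
    Cell.moved (cellAt x T ts s) (cellAt x T ts (s + 1)) (cellAt x T ts (s + 2))
      (cellAt x T ts (s + 3)) (trAt x T ts (s + (width x T + 2))) := by
  funext k
  change symAt x T ts (s + (width x T + 2)) k = _
  rw [symAt, dif_neg (by omega), Cell.moved]
  simp only [Cell.written, cellAt]
  rw [show s + (width x T + 2) - width x T - 2 = s by omega,
    show s + (width x T + 2) - width x T - 1 = s + 1 by omega,
    show s + (width x T + 2) - width x T = s + 2 by omega]
  rfl

theorem start_cellAt_add (s : ℕ) :
    (cellAt x T ts (s + (width x T + 2))).start = (cellAt x T ts (s + 2)).start := by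
  simp only [cellAt]
  rw [show s + (width x T + 2) - 2 = s + width x T by omega, Nat.add_mod_right,
    Nat.add_sub_cancel]
  congr 1
  simp
  intros
  omega

theorem pre_cellAt_add (s : ℕ) :
    (cellAt x T ts (s + (width x T + 2))).pre = (cellAt x T ts (s + 2)).pre := by
  simp only [cellAt, preAt]
  rw [show s + (width x T + 2) - 2 = s + width x T by omega, Nat.add_mod_right,
    Nat.add_sub_cancel]
  congr 1
  simp
  intros
  omega

theorem trAt_succ {s : ℕ} (h : (cellAt x T ts (s + 1)).start = false) :
    trAt x T ts (s + 1) = trAt x T ts s := by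
  rcases s with _ | _ | s
  · rfl
  · rfl
  · simp only [cellAt, decide_eq_false_iff_not] at h
    simp only [trAt]
    rw [show s + 1 + 1 + 1 - 2 = s + 1 by omega, show s + 1 + 1 - 2 = s by omega, Nat.succ_div,
      if_neg, Nat.add_zero]
    intro h1
    exact h ⟨by omega, Nat.mod_eq_zero_of_dvd h1⟩

theorem trAt_row {t i : ℕ} (hi : i < width x T) :
    trAt x T ts (t * width x T + (i + 2)) =
      ((startTransition :: ts)[t]?).getD startTransition := by
  rw [trAt, show t * width x T + (i + 2) - 2 = i + t * width x T by omega,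
    Nat.add_mul_div_right _ _ (by omega), Nat.div_eq_of_lt hi, Nat.zero_add]

theorem pre_cellAt_row {t i : ℕ} (hi : i < width x T) :
    (cellAt x T ts (t * width x T + (i + 2))).pre = true ↔ i = T + 1 := by
  simp only [cellAt, preAt, decide_eq_true_eq]
  rw [show t * width x T + (i + 2) - 2 = i + t * width x T by omega, Nat.add_mul_mod_self_right,
    Nat.mod_eq_of_lt hi]
  omega

theorem exists_of_pre {s : ℕ} (h : (cellAt x T ts s).pre = true) :
    ∃ t, s = t * width x T + (T + 3) := by
  simp only [cellAt, preAt, decide_eq_true_eq] at h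
  have h1 := Nat.div_add_mod' (s - 2) (width x T)
  exact ⟨(s - 2) / width x T, by omega⟩

theorem exists_of_start {s : ℕ} (h : (cellAt x T ts s).start = true) :
    ∃ t, s = t * width x T + 2 := by
  simp only [cellAt, decide_eq_true_eq] at h
  have h1 := Nat.div_add_mod' (s - 2) (width x T)
  exact ⟨(s - 2) / width x T, by omega⟩

/-- The configuration after the first `t` transitions. -/
def cfgAt (x : List A) (ts : List M.Transition) (t : ℕ) : M.Cfg :=
  (ts.take t).foldl Cfg.apply (M.init x)

theorem cfgAt_succ {t : ℕ} (ht : t < ts.length) :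
    cfgAt x ts (t + 1) = (cfgAt x ts t).apply ts[t] := by
  rw [cfgAt, List.take_succ_eq_append_getElem ht, List.foldl_append]
  rfl

theorem state_cfgAt {t : ℕ} (ht : t ≤ ts.length) :
    (cfgAt x ts t).state = (((startTransition :: ts)[t]?).getD startTransition).1 := by
  rcases t with _ | t
  · rfl
  · rw [cfgAt_succ ht, List.getElem?_cons_succ, List.getElem?_eq_getElem ht]
    rfl

/-- The rows of the tableau describe the configurations near the heads. -/
theorem symAt_row {t : ℕ} (ht : t ≤ ts.length) : ∀ {i : ℕ} (k : M.K), t + 4 ≤ i →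
    i + t ≤ 2 * T + 4 → symAt x T ts (t * width x T + i) k =
      (cfgAt x ts t).tape k ((cfgAt x ts t).head k + (i - (T + 4))) := by
  have hw := width_eq x T
  induction t with
  | zero =>
    intro i k h1 h2
    rw [symAt, dif_pos (by omega), startSym]
    simp only [cfgAt, List.take_zero, List.foldl_nil, init, Nat.zero_mul, zero_add]
    by_cases hi : T + 4 ≤ i
    · have h3 : (i : ℤ) - (T + 4) = ((i - (T + 4) : ℕ) : ℤ) := by omega
      rw [h3]
      simp only [Int.toNat_natCast, Int.natCast_nonneg, hi, and_true]
    · rw [if_neg (fun h => hi h.2), if_neg (fun h => hi (by omega))]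
  | succ t ih =>
    intro i k h1 h2
    have key : ∀ j, t + 3 ≤ j → j + 1 + t ≤ 2 * T + 4 →
        Cell.written (cellAt x T ts (t * width x T + j)) (cellAt x T ts (t * width x T + (j + 1)))
          ts[t] k = Function.update ((cfgAt x ts t).tape k) ((cfgAt x ts t).head k) (ts[t].2.1 k)
            ((cfgAt x ts t).head k + ((j + 1 : ℕ) - (T + 4))) := by
      intro j h3 h4
      have h5 := pre_cellAt_row (x := x) (T := T) (ts := ts) (t := t) (i := j - 2) (by omega)
      rw [Nat.sub_add_cancel (by omega)] at h5
      rw [Cell.written]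
      by_cases h6 : j = T + 3
      · rw [if_pos (h5.2 (by omega)), show ((j + 1 : ℕ) : ℤ) - (T + 4) = 0 by omega, add_zero,
          Function.update_self]
      · rw [if_neg (fun h => h6 (by have := h5.1 h; omega)), Function.update_of_ne (by omega)]
        exact ih (by omega) k (by omega) (by omega)
    obtain ⟨i, rfl⟩ := Nat.exists_eq_add_of_le h1
    have h3 : (t + 1) * width x T + (t + 1 + 4 + i) =
        t * width x T + (t + 3 + i) + (width x T + 2) := by
      rw [Nat.succ_mul]; omega
    have h4 := congrFun (sym_cellAt_add (x := x) (T := T) (ts := ts)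
      (t * width x T + (t + 3 + i))) k
    rw [← h3] at h4
    have h5 := trAt_row (x := x) (T := T) (ts := ts) (t := t + 1) (i := t + 3 + i) (by omega)
    rw [show t + 3 + i + 2 = t + 1 + 4 + i by omega, List.getElem?_cons_succ,
      List.getElem?_eq_getElem ht, Option.getD_some] at h5
    refine h4.trans ?_
    rw [h5, cfgAt_succ ht, Cell.moved]
    simp only [Cfg.apply]
    cases ts[t].2.2 k with
    | left =>
      refine (key (t + 3 + i) (by omega) (by omega)).trans (congrArg _ ?_)
      simp only [Move.offset]
      omega
    | stay =>
      refine (key (t + 3 + i + 1) (by omega) (by omega)).trans (congrArg _ ?_)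
      simp only [Move.offset]
      omega
    | right =>
      refine (key (t + 3 + i + 2) (by omega) (by omega)).trans (congrArg _ ?_)
      simp only [Move.offset]
      omega

theorem sym_cellAt_head {t : ℕ} (ht : t ≤ ts.length) (hT : t ≤ T) :
    (cellAt x T ts (t * width x T + (T + 4))).sym = (cfgAt x ts t).read := by
  funext k
  refine (symAt_row ht k (by omega) (by omega)).trans ?_
  simp [Cfg.read]

theorem tr_cellAt_head (t : ℕ) : (cellAt x T ts (t * width x T + (T + 4))).tr =
    ((startTransition :: ts)[t]?).getD startTransition :=
  trAt_row (i := T + 2) (by rw [width_eq]; omega)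

theorem isScript_iff {c : M.Cfg} : IsScript c ts ↔
    (∀ t (h : t < ts.length), ts[t] ∈ M.transitions ((ts.take t).foldl Cfg.apply c).state
      ((ts.take t).foldl Cfg.apply c).read) ∧ (ts.foldl Cfg.apply c).state ∈ M.accept := by
  induction ts generalizing c with
  | nil => simp [IsScript]
  | cons t ts ih =>
    rw [IsScript, ih, ← and_assoc]
    refine and_congr_left fun _ => ⟨?_, fun h => ⟨h 0 (by simp), fun s hs => ?_⟩⟩
    · rintro ⟨h1, h2⟩ (_ | s) hs
      · exact h1
      · exact h2 s (by simpa using hs)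
    · exact h (s + 1) (by simpa using hs)

theorem tableau_of_lt {s : ℕ} (h : s < (T + 1) * width x T + 2) :
    tableau x T ts s = some (cellAt x T ts s) := if_pos h

theorem tableau_eq_some {s : ℕ} {a : M.Cell} : tableau x T ts s = some a ↔
    s < (T + 1) * width x T + 2 ∧ cellAt x T ts s = a := by
  simp [tableau]

theorem tableau_eq_none {s : ℕ} : tableau x T ts s = none ↔ (T + 1) * width x T + 2 ≤ s := by
  simp [tableau]

variable (x T) in
/-- The words that describe accepting computations. -/
abbrev IsTableau (l : ℕ → Option M.Cell) : Prop :=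
  IsTiling ((List.range (width x T + 2)).map fun s => some (startCell x T s)) Window none
    (width x T + 2) ((T + 1) * width x T + 1) l

theorem isTableau_tableau (hts : ts.length = T) :
    IsTableau x T (tableau x T ts) ↔ IsScript (M.init x) ts := by
  have hw := width_eq x T
  have hm : (T + 1) * width x T = T * width x T + width x T := Nat.succ_mul _ _
  have hfinal : ts.foldl Cfg.apply (M.init x) = cfgAt x ts T := by
    rw [cfgAt, List.take_of_length_le hts.le]
  rw [isScript_iff, hfinal]
  constructor
  · refine fun h => ⟨fun t ht => ?_, ?_⟩
    · have hmul := Nat.mul_le_mul_right (width x T) (show t + 1 ≤ T by omega)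
      rw [Nat.succ_mul] at hmul
      have h1 := (h.window (t * width x T + (T + 2))).step _ _ _ (tableau_of_lt (by omega))
        (tableau_of_lt (by omega)) (tableau_of_lt (by omega))
        ((pre_cellAt_row (i := T + 1) (by omega)).2 rfl)
      have h2 := tr_cellAt_head (x := x) (T := T) (ts := ts) (t + 1)
      rw [show (t + 1) * width x T + (T + 4) = t * width x T + (T + 2) + (width x T + 2) by
        rw [Nat.succ_mul]; omega, List.getElem?_cons_succ, List.getElem?_eq_getElem ht,
        Option.getD_some] at h2
      rw [h2, Nat.add_assoc, sym_cellAt_head ht.le (by omega), tr_cellAt_head,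
        ← state_cfgAt (x := x) ht.le] at h1
      exact h1
    · have h1 := (h.window (T * width x T + (T + 2))).accept _ _ (tableau_of_lt (by omega))
        (tableau_of_lt (by omega)) (tableau_eq_none.2 (by omega))
        ((pre_cellAt_row (i := T + 1) (by omega)).2 rfl)
      rwa [Nat.add_assoc, tr_cellAt_head, ← state_cfgAt (x := x) hts.ge] at h1
  · rintro ⟨h1, h2⟩
    refine ⟨fun s hs => ?_, fun s => ⟨fun h => ?_, ?_, ?_, ?_, ?_⟩, ?_, ?_⟩
    · simp only [List.length_map, List.length_range] at hs
      rw [List.getElem_map, List.getElem_range, tableau_of_lt (by rw [hm]; omega),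
        cellAt_of_lt hs]
    · rw [tableau_eq_none] at h ⊢
      omega
    · simp only [tableau_eq_some]
      rintro _ _ ⟨-, rfl⟩ ⟨-, rfl⟩ h3
      exact trAt_succ h3
    · simp only [tableau_eq_some]
      rintro _ _ _ _ _ ⟨-, rfl⟩ ⟨-, rfl⟩ ⟨-, rfl⟩ ⟨-, rfl⟩ ⟨-, rfl⟩
      exact ⟨start_cellAt_add s, pre_cellAt_add s, sym_cellAt_add s⟩
    · simp only [tableau_eq_some]
      rintro _ _ _ ⟨-, rfl⟩ ⟨-, rfl⟩ ⟨h3, rfl⟩ h4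
      obtain ⟨t, ht⟩ := exists_of_pre h4
      have ht' : t < T := by
        by_contra h5
        have := Nat.mul_le_mul_right (width x T) (not_lt.1 h5)
        omega
      have h5 := h1 t (by omega)
      have h6 := tr_cellAt_head (x := x) (T := T) (ts := ts) (t + 1)
      rw [List.getElem?_cons_succ, List.getElem?_eq_getElem (by omega), Option.getD_some] at h6
      rw [show s + (width x T + 2) = (t + 1) * width x T + (T + 4) by
        rw [Nat.succ_mul]; omega, show s + 2 = t * width x T + (T + 4) by omega, h6,
        sym_cellAt_head (by omega) ht'.le, tr_cellAt_head, ← state_cfgAt (x := x) (by omega)]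
      exact h5
    · simp only [tableau_eq_some, tableau_eq_none]
      rintro _ _ ⟨-, rfl⟩ ⟨h3, rfl⟩ h4 h5
      obtain ⟨t, ht⟩ := exists_of_pre h5
      have htT : t = T := by
        rcases lt_trichotomy t T with h6 | h6 | h6
        · have := Nat.mul_le_mul_right (width x T) (show t + 1 ≤ T from h6)
          rw [Nat.succ_mul] at this
          omega
        · exact h6
        · have := Nat.mul_le_mul_right (width x T) (show T + 1 ≤ t from h6)
          omega
      rw [show s + 2 = T * width x T + (T + 4) by rw [htT] at ht; omega, tr_cellAt_head,
        ← state_cfgAt (x := x) hts.ge]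
      exact h2
    · rw [tableau_of_lt (by omega)]
      exact Option.some_ne_none _
    · exact tableau_eq_none.2 le_rfl

theorem IsTableau.exists_eq_some {l : ℕ → Option M.Cell} (h : IsTableau x T l) {s : ℕ}
    (hs : s < (T + 1) * width x T + 2) : ∃ a, l s = some a := by
  rw [← Option.ne_none_iff_exists']
  intro h1
  have h2 : ∀ i, s ≤ i → l i = none := fun i hi => by
    induction i, hi using Nat.le_induction with
    | base => exact h1
    | succ i _ ih => exact (h.window i).eq_none ih
  exact h.ne_pad (h2 _ (by omega))

theorem IsTableau.exists_eq_tableau {l : ℕ → Option M.Cell} (h : IsTableau x T l) :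
    ∃ ts : List M.Transition, ts.length = T ∧ l = tableau x T ts := by
  have hw := width_eq x T
  have hm : (T + 1) * width x T = T * width x T + width x T := Nat.succ_mul _ _
  let tr : ℕ → M.Transition := fun t => ((l ((t + 1) * width x T + 2)).map Cell.tr).getD
    startTransition
  refine ⟨(List.range T).map tr, by simp, ?_⟩
  set ts := (List.range T).map tr with hts
  have key : ∀ s, s < (T + 1) * width x T + 2 → l s = some (cellAt x T ts s) := by
    intro s
    induction s using Nat.strong_induction_on with
    | _ s ih =>
    intro hs
    by_cases hs' : s < width x T + 2
    · rw [cellAt_of_lt hs', h.init s (by simpa using hs')]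
      simp
    obtain ⟨i, rfl⟩ := Nat.exists_eq_add_of_le' (not_lt.1 hs')
    obtain ⟨d, hd⟩ := h.exists_eq_some hs
    obtain ⟨h1, h2, h3⟩ := (h.window i).below _ _ _ _ _ (ih i (by omega) (by omega))
      (ih (i + 1) (by omega) (by omega)) (ih (i + 2) (by omega) (by omega))
      (ih (i + 3) (by omega) (by omega)) hd
    rw [← start_cellAt_add] at h1
    rw [← pre_cellAt_add] at h2
    have h4 : d.tr = trAt x T ts (i + (width x T + 2)) := by
      by_cases h5 : (cellAt x T ts (i + (width x T + 2))).start = true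
      · obtain ⟨t, ht⟩ := exists_of_start h5
        rcases t with _ | t
        · omega
        have ht' : t < T := by
          by_contra h6
          have := Nat.mul_le_mul_right (width x T) (show T + 1 ≤ t + 1 by omega)
          omega
        have h6 := trAt_row (x := x) (T := T) (ts := ts) (t := t + 1) (i := 0) (by omega)
        rw [Nat.zero_add, ← ht, List.getElem?_cons_succ, hts, List.getElem?_map,
          List.getElem?_range ht'] at h6
        rw [h6]
        simp [tr, ← ht, hd]
      · rw [Bool.not_eq_true] at h5
        have h6 := (h.window (i + (width x T + 1))).tr_eq _ d (ih _ (by omega) (by omega)) hd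
          (h1.trans h5)
        exact h6.trans (trAt_succ h5).symm
    rw [h4, ← sym_cellAt_add] at h3
    rw [hd, Option.some_inj]
    exact Cell.ext h1 h2 h4 h3
  funext s
  by_cases hs : s < (T + 1) * width x T + 2
  · rw [key s hs, tableau_of_lt hs]
  · rw [tableau_eq_none.2 (not_lt.1 hs)]
    exact IsTiling.eq_pad_of_lt (fun _ _ _ _ h => h.eq_none rfl) h s (by omega)

theorem tableau_injOn : Set.InjOn (tableau (M := M) x T) {ts | ts.length = T} := by
  intro ts h ts' h' heq
  have h : ts.length = T := h
  have h' : ts'.length = T := h'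
  refine List.ext_getElem (h.trans h'.symm) fun t h1 h2 => ?_
  have hw := width_eq x T
  have hmul := Nat.mul_le_mul_right (width x T) (show t + 1 ≤ T by omega)
  have h3 := congrFun heq ((t + 1) * width x T + (T + 4))
  rw [tableau_of_lt (by rw [Nat.succ_mul T]; omega), tableau_of_lt (by rw [Nat.succ_mul T]; omega),
    Option.some_inj] at h3
  have h4 := congrArg Cell.tr h3
  simpa [tr_cellAt_head, h1, h2] using h4

theorem numAcceptingRuns_eq_ncard_isTableau (hT : ∀ ρ, M.IsRun x ρ → ρ.length ≤ T + 1) :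
    M.numAcceptingRuns x = {l : ℕ → Option M.Cell | IsTableau x T l}.ncard := by
  have h : {l : ℕ → Option M.Cell | IsTableau x T l} =
      tableau x T '' {ts | ts.length = T ∧ IsScript (M.init x) ts} := by
    ext l
    constructor
    · intro hl
      obtain ⟨ts, h1, rfl⟩ := IsTableau.exists_eq_tableau hl
      exact ⟨ts, ⟨h1, (isTableau_tableau h1).1 hl⟩, rfl⟩
    · rintro ⟨ts, ⟨h1, h2⟩, rfl⟩
      exact (isTableau_tableau h1).2 h2
  rw [numAcceptingRuns_eq hT, h, Set.InjOn.ncard_image (tableau_injOn.mono fun _ h => h.1)]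

/-- A cell of the first row. -/
def plainCell (start pre : Bool) (sym : M.K → M.Γ) : M.Cell :=
  ⟨start, pre, startTransition, sym⟩

theorem map_startCell :
    ((List.range (width x T + 2)).map fun s => some (startCell (M := M) x T s)) =
    [some (plainCell false false fun _ => M.blank), some (plainCell false false fun _ => M.blank),
      some (plainCell true false fun _ => M.blank)] ++
    (List.replicate T (some (plainCell false false fun _ => M.blank)) ++
      ([some (plainCell false true fun _ => M.blank)] ++
        (x.map (fun a => some (plainCell false false fun k =>
          if k = M.inputTape then M.symb a else M.blank)) ++
          List.replicate (T + 1) (some (plainCell false false fun _ => M.blank))))) := by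
  have hw := width_eq x T
  obtain ⟨U, hU⟩ : ∃ U, U = T + 1 := ⟨_, rfl⟩
  rw [← hU, show width x T + 2 = 3 + (T + (1 + (x.length + U))) by omega]
  simp only [List.range_add, List.map_append, List.map_map]
  have hblank : ∀ s, (s < T + 4 ∨ T + 4 + x.length ≤ s) →
      startSym (M := M) x T s = fun _ => M.blank := by
    refine fun s hs => funext fun k => ?_
    rw [startSym]
    split_ifs with h
    · rw [List.getElem?_eq_none (by omega)]
      rfl
    · rfl
  congr 1
  · simp [List.range_succ, startCell, plainCell, hblank]
  congr 1
  · refine List.eq_replicate_iff.2 ⟨by simp, ?_⟩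
    simp only [List.forall_mem_map, List.mem_range]
    intro s hs
    simp only [Function.comp, startCell, plainCell]
    rw [hblank _ (by omega), decide_eq_false (by omega), decide_eq_false (by omega)]
  congr 1
  · simp [startCell, plainCell, Nat.add_comm T 3]
    exact ⟨by omega, hblank _ (by omega)⟩
  congr 1
  · refine List.ext_getElem (by simp) fun s h1 h2 => ?_
    have h3 : s < x.length := by simpa using h2
    simp only [List.getElem_map, List.getElem_range, Function.comp, startCell, plainCell]
    rw [decide_eq_false (by omega), decide_eq_false (by omega)]
    congr 2
    funext k
    rw [startSym, show 3 + (T + (1 + s)) - (T + 4) = s by omega, List.getElem?_eq_getElem h3]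
    simp [show T + 4 ≤ 3 + (T + (1 + s)) by omega]
  · refine List.eq_replicate_iff.2 ⟨by simp, ?_⟩
    simp only [List.forall_mem_map, List.mem_range]
    intro s hs
    simp only [Function.comp, startCell, plainCell]
    rw [hblank _ (by omega), decide_eq_false (by omega), decide_eq_false (by omega)]

end

end NTM

theorem sharpPHard_countWordModelsUnary : SharpPHard countWordModelsUnary := by
  rintro A _ f ⟨M, ⟨p, hp⟩, hf⟩
  obtain ⟨c, ⟨e⟩⟩ := Finite.exists_equiv_fin (Option M.Cell)
  have hw : IsCount A fun n => 2 * p.eval n + n + 3 :=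
    (((isCount_const 2).mul (isCount_eval p)).add isCount_id).add (isCount_const 3)
  have hgen := isGen_encode_tilingFormula (A := A) (e := e) (W := NTM.Window) (pad := none)
    (z := fun x => (List.range (NTM.width x (p.eval x.length) + 2)).map fun s =>
      some (NTM.startCell x (p.eval x.length) s))
    (fun g => by
      simp only [NTM.map_startCell, List.flatMap_append, List.flatMap_map, List.flatMap_replicate]
      exact (isGen_const _).append ((isCount_eval p (isGen_const _)).append
        ((isGen_const _).append ((isGen_flatMap _).append
          (((isCount_eval p).add (isCount_const 1)) (isGen_const _)))))) (hw.add (isCount_const 2))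
    ((((isCount_eval p).add (isCount_const 1)).mul hw).add (isCount_const 1))
  refine ⟨_, hgen.polyTimeComputable, fun x => ?_⟩
  rw [hf, countWordModelsUnary, Instance.encode_injective.extend_apply,
    numWordModels_tilingFormula fun _ _ _ _ h => h.eq_none rfl]
  exact NTM.numAcceptingRuns_eq_ncard_isTableau (hp x)

end LTLCount

theorem mainTheorem1 : LTLCount.SharpPComplete LTLCount.countWordModelsUnary :=
  ⟨LTLCount.sharpPHard_countWordModelsUnary, LTLCount.inSharpP_countWordModelsUnary⟩
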